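/- Let $n\ge 0$ be an integer and $K$ a field of characteristic $0$. The elementary Schur polynomials $\mathbf s_k(t)$ are given by $e^{\sum_{i\ge1} t_i z^i}=\sum_{k\ge 0}\mathbf s_k(t)z^k$ ($\mathbf s_k=0$ for $k<0$), and $\mathbf s_\lambda(t)=\det(\mathbf s_{\lambda_i-i+j}(t))_{1\le i,j\le n}$ for a partition $\lambda$ with at most $n$ rows. Put $$V_{-1}(t)=\sum_{i\ge1}(i+1)t_{i+1}\tfrac{\partial}{\partial t_i},\quad V_0(t)=\sum_{i\ge1}it_i\tfrac{\partial}{\partial t_i},\quad V_1(t)=\sum_{i\ge2}(i-1)t_{i-1}\tfrac{\partial}{\partial t_i},$$ $$\mathbb V_{-1}=V_{-1}(t)-V_1(s)+n\bigl(t_1+\tfrac{\partial}{\partial s_1}\bigr),\quad \mathbb V_0=V_0(t)-V_0(s),\quad \mathbb V_1=-V_{-1}(s)+V_1(t)+n\bigl(s_1+\tfrac{\partial}{\partial t_1}\bigr).$$ Let $\Lambda_k f(k)=f(k+1)$ for functions of $k\in\mathbb Z$. A partition $\lambda$ with at most $n$ rows is identified with the strictly increasing sequence $x=(0+\lambda_n,1+\lambda_{n-1},\dots,n-1+\lambda_1)$,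 and similarly $\mu$ with $y$. A family $b^{(k)}_{\lambda\mu}$, $k\in\mathbb Z$, is written $b^{(k)}_{xy}$, with $b^{(k)}_{xy}=0$ if $x$ or $y$ does not come from a partition; $e_i$ is the $i$-th unit vector. **(a)** For arbitrary coefficients $b^{(k)}_{\lambda\mu}\in K$ ($k\in\mathbb Z$; $\lambda,\mu$ with at most $n$ rows), the formal power series $\sum_{\lambda,\mu}b^{(k)}_{\lambda\mu}\mathbf s_\lambda(t)\mathbf s_\mu(-s)$ is well defined, each of the operators $\tilde{\mathbb V}$ below is applicable to it (only finitely many terms contribute to each coefficient), and $$\tilde{\mathbb V}\sum_{\lambda,\mu}b^{(k)}_{\lambda\mu}\,\mathbf s_\lambda(t)\mathbf s_\mu(-s)=\sum_{\lambda,\mu}\tilde L(b)^{(k)}_{\lambda\mu}\,\mathbf s_\lambda(t)\mathbf s_\mu(-s)$$ (sums over $\lambda,\mu$ with at most $n$ rows) for the following pairs $(\tilde{\mathbb V},\tilde L)$, where in $\tilde{\mathbb V}$ the shift is made first, in the coefficients of the combined differential operator, and $z$ is then replaced as indicated, and where $p,q\in K$ are arbitrary: 1. shift $t_1\mapsto t_1+z$,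 $s_1\mapsto s_1-z$, then $z\mapsto k\Lambda_k^{-1}$: $\ (\mathbb V_{-1},L^{(1)}_-)$, $(\mathbb V_0,L^{(1)}_0)$, $(-\mathbb V_1,L^{(1)}_+)$; 2. shift $it_i\mapsto it_i-q(-1)^i$, $is_i\mapsto is_i-z\delta_{i1}$, then $z\mapsto k\Lambda_k^{-1}$: $\ (\mathbb V_0+\mathbb V_{-1},L^{(2)}_-)$, $(-(\mathbb V_0+\mathbb V_1),L^{(2)}_+)$; 3. shift $it_i\mapsto it_i-p(-z)^i$, $is_i\mapsto is_i+q(-z)^i$, then $z\mapsto\Lambda_k^{-1}$: $\ (\mathbb V_{-1}+(z+z^{-1})\mathbb V_0+\mathbb V_1,\ L^{(3)})$. Here, with sums over $1\le i\le n$ unless indicated and $A^{(k)}_{xy}=\sum_{1\le i<n,\;y_{i+1}-y_i=1}b^{(k)}_{x,y+e_i+e_{i+1}}$, $$L^{(1)}_-(b)^{(k)}_{xy}=-\sum_i\bigl((y_i+1)b^{(k)}_{x,y+e_i}-x_ib^{(k)}_{x-e_i,y}\bigr)+k\Bigl(n\,b^{(k-1)}_{xy}-\sum_i b^{(k-1)}_{x,y+2e_i}+A^{(k-1)}_{xy}\Bigr),$$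 $$L^{(1)}_0(b)^{(k)}_{xy}=-b^{(k)}_{xy}\sum_i(y_i-x_i)+k\Bigl(\sum_i b^{(k-1)}_{x+e_i,y}-\sum_i b^{(k-1)}_{x,y+e_i}\Bigr),$$ $L^{(1)}_+$ is $L^{(1)}_-$ with the roles of $x$ and $y$ exchanged, $$L^{(2)}_-(b)^{(k)}_{xy}=\sum_i\bigl(x_ib^{(k)}_{x-e_i,y}-(y_i+1)b^{(k)}_{x,y+e_i}+(x_i-y_i+q)b^{(k)}_{xy}\bigr)+k\Bigl(-\sum_i\bigl(b^{(k-1)}_{x,y+e_i}+b^{(k-1)}_{x,y+2e_i}\bigr)+A^{(k-1)}_{xy}\Bigr),$$ $$L^{(2)}_+(b)^{(k)}_{xy}=\sum_i\bigl(y_ib^{(k)}_{x,y-e_i}-(x_i+1+q)b^{(k)}_{x+e_i,y}+(y_i-x_i)b^{(k)}_{xy}\bigr)+k\sum_i\bigl(b^{(k-1)}_{xy}+b^{(k-1)}_{x,y+e_i}\bigr),$$ $$L^{(3)}(b)^{(k)}_{xy}=\sum_i\Bigl(x_ib^{(k)}_{x-e_i,y}+(x_i+p+1)b^{(k)}_{x+e_i,y}-y_ib^{(k)}_{x,y-e_i}-(y_i+q+1)b^{(k)}_{x,y+e_i}\Bigr)+\sum_i(x_i-y_i)\bigl(b^{(k-1)}_{xy}+b^{(k+1)}_{xy}\bigr)+n(p-q)\,b^{(k-1)}_{xy}.$$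 **(b)** These are the equations satisfied by three random walks of $n$ walkers in $\mathbb Z$ from $x$ to $y$ which are non-intersecting (their positions are strictly increasing at every time): for all $k\in\mathbb Z$ and all $x,y$ coming from partitions, $L(b)^{(k)}_{xy}=0$ in each of the following cases, where $b^{(k)}_{xy}$ is defined for all $x,y\in\mathbb Z^n$ and is $0$ for $k<0$. 1. $L=L^{(1)}_-,L^{(1)}_0,L^{(1)}_+$, and $b^{(k)}_{xy}$ is the number of walks during $k$ instants, at each of which exactly one walker moves one step to the left or to the right. 2. $L=L^{(2)}_-,L^{(2)}_+$ with an integer $q\ge0$, and $b^{(k)}_{xy}$ is the number of walks during $q+k$ instants, where at each of the first $q$ instants every walker may move one step to the right or stay put, and at each of the last $k$ instants exactly one walker moves one step to the left, with $2k+\sum_i(y_i-x_i)$ effective moves (steps taken by all the walkers) in total. 3. $L=L^{(3)}$ with integers $p,q\ge0$, and $b^{(k)}_{xy}$ is the number of walks during $p+q$ instants, where at each of the first $p$ instants every walker may move one step to the right or stay put, and at each of the last $q$ instants every walker may move one step to the left or stay put, with $k$ effective moves in total. -/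

import Mathlib

noncomputable section

namespace VirasoroFourier

open scoped BigOperators

/-- The variables: `Sum.inl i` is `t_i` and `Sum.inr i` is `s_i`, for `i = 1, 2, 3, …`. -/
abbrev Var := ℕ+ ⊕ ℕ+

/-- Formal power series in all the variables `t_1, t_2, …, s_1, s_2, …`. -/
abbrev Series (K : Type*) := MvPowerSeries Var K

/-! ### Schur polynomials in the variables `t` -/

section Schur

variable (K : Type*) [Field K]

/-- The power series `∑_{i ≥ 1} t_i z^i` in `z`. -/
def tSeries : PowerSeries (MvPolynomial ℕ+ K) :=
  PowerSeries.mk fun i => if h : 0 < i then MvPolynomial.X ⟨i, h⟩ else 0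

/-- The elementary Schur polynomial `s_k(t)`, the coefficient of `z^k` in
`exp (∑_{i ≥ 1} t_i z^i)`.  As `∑ t_i z^i` has no constant term, its `j`-th power contributes
to this coefficient only for `j ≤ k`; see `coeff_exp_tSeries` below. -/
def elemSchur (k : ℕ) : MvPolynomial ℕ+ K :=
  ∑ j ∈ Finset.range (k + 1), ((j.factorial : K)⁻¹) • PowerSeries.coeff k (tSeries K ^ j)

/-- Elementary Schur polynomials with an integer index, `0` for a negative index. -/
def elemSchurInt (k : ℤ) : MvPolynomial ℕ+ K :=
  if k < 0 then 0 else elemSchur K k.toNat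

/-- Partitions `λ_1 ≥ λ_2 ≥ … ≥ λ_n ≥ 0` with at most `n` rows; `lam i` is `λ_{i+1}`. -/
abbrev Part (n : ℕ) := {lam : Fin n → ℕ // Antitone lam}

/-- The Schur polynomial `s_λ(t) = det (s_{λ_i - i + j}(t))_{1 ≤ i, j ≤ n}`. -/
def schur {n : ℕ} (lam : Part n) : MvPolynomial ℕ+ K :=
  Matrix.det (Matrix.of fun i j : Fin n =>
    elemSchurInt K ((lam.1 i : ℤ) - (i : ℕ) + (j : ℕ)))

/-- `s_λ(t) s_μ(-s)`. -/
def schurPair {n : ℕ} (lam mu : Part n) : Series K :=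
  ((MvPolynomial.rename Sum.inl (schur K lam) *
    MvPolynomial.aeval (fun i : ℕ+ => -(MvPolynomial.X (Sum.inr i) : MvPolynomial Var K))
      (schur K mu) : MvPolynomial Var K) : Series K)

theorem hasSubst_tSeries : PowerSeries.HasSubst (tSeries K) := by
  apply PowerSeries.HasSubst.of_constantCoeff_zero'
  simp [tSeries]

theorem coeff_exp_tSeries [CharZero K] (k : ℕ) :
    PowerSeries.coeff k ((PowerSeries.exp K).subst (tSeries K)) = elemSchur K k := by
  rw [PowerSeries.coeff_subst' (hasSubst_tSeries K), finsum_eq_sum_of_support_subset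
    (s := Finset.range (k + 1))]
  · refine Finset.sum_congr rfl fun j _ => ?_
    simp [PowerSeries.coeff_exp]
  · intro j hj
    by_contra hlt
    apply hj
    have h0 : PowerSeries.X ∣ tSeries K := by
      rw [PowerSeries.X_dvd_iff]
      simp [tSeries]
    have h1 := pow_dvd_pow_of_dvd h0 j
    rw [PowerSeries.X_pow_dvd_iff] at h1
    have h2 := h1 k (by simpa using hlt)
    simp [h2]

end Schur

/-! ### Formal sums and double Schur series -/

section FormalSum

variable {K : Type*} [Field K]

/-- `G` is the formal sum of the family `f`: the coefficient of each monomial vanishes in all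
but finitely many members of the family, and these coefficients add up to that of `G`. -/
def IsFormalSum {ι : Type*} (f : ι → Series K) (G : Series K) : Prop :=
  ∀ m : Var →₀ ℕ,
    (Function.support fun i => MvPowerSeries.coeff m (f i)).Finite ∧
      ∑ᶠ i, MvPowerSeries.coeff m (f i) = MvPowerSeries.coeff m G

/-- The double Schur series `∑_{λ, μ} b^{(k)}_{λ μ} s_λ(t) s_μ(-s)`, summed coefficientwise over
all pairs of partitions with at most `n` rows, as a function of `k`. -/
def doubleSeries {n : ℕ} (b : ℤ → Part n → Part n → K) : ℤ → Series K := fun k m =>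
  ∑ᶠ p : Part n × Part n, b k p.1 p.2 * MvPowerSeries.coeff m (schurPair K p.1 p.2)

end FormalSum

/-! ### First-order differential operators and the Virasoro operators -/

section DiffOp

/-- First-order differential operators `P_0 + ∑_v P_v ∂/∂v` in the variables `t, s`, possibly
with infinitely many terms, with polynomial coefficients over `R`: the value at `none` is the
multiplication part `P_0`, the value at `some v` is the coefficient `P_v` of `∂/∂v`. -/
abbrev DiffOp (R : Type*) [CommRing R] := Option Var → MvPolynomial Var R

variable {R : Type*} [CommRing R]

/-- The operator of multiplication by the variable `v`. -/
def mulVar (v : Var) : DiffOp R := Pi.single none (MvPolynomial.X v)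

/-- The operator `∂/∂v`. -/
def partialVar (v : Var) : DiffOp R := Pi.single (some v) 1

/-- `V_{-1} = ∑_{i ≥ 1} (i+1) t_{i+1} ∂/∂t_i` in one family of variables (`e` selects it);
this is its coefficient of the derivative with respect to the `i`-th variable. -/
def virMinusOne (e : ℕ+ → Var) (i : ℕ+) : MvPolynomial Var R :=
  MvPolynomial.C (((i : ℕ) : R) + 1) * MvPolynomial.X (e (i + 1))

/-- `V_0 = ∑_{i ≥ 1} i t_i ∂/∂t_i`. -/
def virZero (e : ℕ+ → Var) (i : ℕ+) : MvPolynomial Var R :=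
  MvPolynomial.C ((i : ℕ) : R) * MvPolynomial.X (e i)

/-- `V_1 = ∑_{i ≥ 2} (i-1) t_{i-1} ∂/∂t_i`. -/
def virOne (e : ℕ+ → Var) (i : ℕ+) : MvPolynomial Var R :=
  if 1 < i then MvPolynomial.C (((i : ℕ) : R) - 1) * MvPolynomial.X (e (i - 1)) else 0

/-- The operator `∑_i c_i ∂/∂t_i`. -/
def alongT (c : ℕ+ → MvPolynomial Var R) : DiffOp R
  | some (Sum.inl i) => c i
  | _ => 0

/-- The operator `∑_i c_i ∂/∂s_i`. -/
def alongS (c : ℕ+ → MvPolynomial Var R) : DiffOp R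
  | some (Sum.inr i) => c i
  | _ => 0

variable (R)

/-- `𝕍_{-1} = V_{-1}(t) - V_1(s) + n (t_1 + ∂/∂s_1)`. -/
def bigVMinusOne (n : ℕ) : DiffOp R :=
  alongT (virMinusOne Sum.inl) - alongS (virOne Sum.inr) +
    n • (mulVar (Sum.inl 1) + partialVar (Sum.inr 1))

/-- `𝕍_0 = V_0(t) - V_0(s)`. -/
def bigVZero : DiffOp R :=
  alongT (virZero Sum.inl) - alongS (virZero Sum.inr)

/-- `𝕍_1 = -V_{-1}(s) + V_1(t) + n (s_1 + ∂/∂t_1)`. -/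
def bigVOne (n : ℕ) : DiffOp R :=
  -alongS (virMinusOne Sum.inr) + alongT (virOne Sum.inl) +
    n • (mulVar (Sum.inr 1) + partialVar (Sum.inl 1))

variable {R}

/-- The operator obtained by the shift of variables `v ↦ v + c v`. -/
def DiffOp.shift (c : Var → R) (D : DiffOp R) : DiffOp R := fun o =>
  MvPolynomial.aeval (fun v => MvPolynomial.X v + MvPolynomial.C (c v)) (D o)

end DiffOp

section Action

variable {K : Type*} [Field K]

/-- The shift `t_1 ↦ t_1 + z`, `s_1 ↦ s_1 - z`, with `z` the polynomial variable. -/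
def shiftOne : Var → Polynomial K
  | Sum.inl i => if i = 1 then Polynomial.X else 0
  | Sum.inr i => if i = 1 then -Polynomial.X else 0

/-- The shift `i t_i ↦ i t_i - q (-1)^i`, `s_1 ↦ s_1 - z`. -/
def shiftTwo (q : K) : Var → Polynomial K
  | Sum.inl i => Polynomial.C (-(q * (-1) ^ (i : ℕ) / ((i : ℕ) : K)))
  | Sum.inr i => if i = 1 then -Polynomial.X else 0

/-- The shift `i t_i ↦ i t_i - p (-z)^i`, `i s_i ↦ i s_i + q (-z)^i`, with `z = T` the variable
of Laurent polynomials. -/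
def shiftThree (p q : K) : Var → LaurentPolynomial K
  | Sum.inl i => -(LaurentPolynomial.C (p / ((i : ℕ) : K)) * (-LaurentPolynomial.T 1) ^ (i : ℕ))
  | Sum.inr i => LaurentPolynomial.C (q / ((i : ℕ) : K)) * (-LaurentPolynomial.T 1) ^ (i : ℕ)

/-- The operator `k Λ_k⁻¹`, that is `F ↦ (k ↦ k F(k-1))`, on functions of `k ∈ ℤ`. -/
def kLambdaInv : Module.End K (ℤ → Series K) where
  toFun F := fun k => (k : K) • F (k - 1)
  map_add' F G := by funext k; simp
  map_smul' c F := by funext k; exact smul_comm (k : K) c (F (k - 1))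

/-- The powers `Λ_k^j`, that is `F ↦ (k ↦ F(k+j))`, on functions of `k ∈ ℤ`. -/
def lambdaPow : Multiplicative ℤ →* Module.End K (ℤ → Series K) where
  toFun j :=
    { toFun := fun F k => F (k + j.toAdd)
      map_add' := fun _ _ => rfl
      map_smul' := fun _ _ => rfl }
  map_one' := by ext1 F; funext k; simp
  map_mul' i j := by ext1 F; funext k; simp [add_assoc]

/-- The substitution `z ↦ k Λ_k⁻¹` in polynomials in `z`. -/
def substKLambdaInv : Polynomial K →ₐ[K] Module.End K (ℤ → Series K) :=
  Polynomial.aeval kLambdaInv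

/-- The substitution `z ↦ Λ_k⁻¹` (hence `z⁻¹ ↦ Λ_k`) in Laurent polynomials in `z`. -/
def substLambdaInv : LaurentPolynomial K →ₐ[K] Module.End K (ℤ → Series K) :=
  AddMonoidAlgebra.lift K (Module.End K (ℤ → Series K)) ℤ
    (lambdaPow.comp (invMonoidHom : Multiplicative ℤ →* Multiplicative ℤ))

theorem substKLambdaInv_X (F : ℤ → Series K) (k : ℤ) :
    substKLambdaInv Polynomial.X F k = (k : K) • F (k - 1) := by
  simp [substKLambdaInv, kLambdaInv]

theorem substLambdaInv_T (j : ℤ) (F : ℤ → Series K) (k : ℤ) :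
    substLambdaInv (LaurentPolynomial.T j) F k = F (k - j) := by
  rw [substLambdaInv, LaurentPolynomial.T, AddMonoidAlgebra.lift_single]
  simp [lambdaPow, sub_eq_add_neg]

variable {R : Type*} [CommRing R] [Algebra K R]

/-- Multiplication of a function of `(t, s, k)` by a polynomial in `t, s` whose coefficients
are turned into operators in `k` by `ρ`. -/
def polyAct (ρ : R →ₐ[K] Module.End K (ℤ → Series K)) (P : MvPolynomial Var R)
    (F : ℤ → Series K) : ℤ → Series K := fun k =>
  ∑ m ∈ P.support, MvPowerSeries.monomial m (1 : K) * ρ (P.coeff m) F k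

/-- The terms of `D F`, with the coefficients in `R` turned into operators in `k` by `ρ`. -/
def DiffOp.term (ρ : R →ₐ[K] Module.End K (ℤ → Series K)) (D : DiffOp R)
    (F : ℤ → Series K) : Option Var → ℤ → Series K
  | none => polyAct ρ (D none) F
  | some v => polyAct ρ (D (some v)) fun k => MvPowerSeries.pderiv K v (F k)

/-- `D`, with its coefficients turned into operators in `k` by `ρ`, is applicable to `F` and
the result is `G`. -/
def DiffOp.MapsTo (ρ : R →ₐ[K] Module.End K (ℤ → Series K)) (D : DiffOp R)
    (F G : ℤ → Series K) : Prop :=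
  ∀ k : ℤ, IsFormalSum (fun o => D.term ρ F o k) (G k)

end Action

/-! ### Difference operators -/

section Difference

variable {K : Type*} [Field K] {n : ℕ}

/-- `x = (λ_n, 1 + λ_{n-1}, …, n - 1 + λ_1)`, a strictly increasing sequence. -/
def pos (lam : Part n) : Fin n → ℤ := fun i => (lam.1 (Fin.rev i) : ℤ) + (i : ℕ)

theorem pos_injective : Function.Injective (pos : Part n → Fin n → ℤ) := by
  intro a b h
  apply Subtype.ext
  funext i
  have := congrFun h (Fin.rev i)
  simpa [pos] using this

/-- The coefficients `b^{(k)}_{λ μ}` as a function of `k` and the positions `x`, `y` of `λ`, `μ`;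
it is `0` when `x` or `y` does not come from a partition. -/
def toPos (b : ℤ → Part n → Part n → K) : ℤ → (Fin n → ℤ) → (Fin n → ℤ) → K := fun k x y =>
  Function.extend (fun p : Part n × Part n => (pos p.1, pos p.2)) (fun p => b k p.1 p.2) 0 (x, y)

theorem toPos_pos (b : ℤ → Part n → Part n → K) (k : ℤ) (lam mu : Part n) :
    toPos b k (pos lam) (pos mu) = b k lam mu := by
  have h : Function.Injective (fun p : Part n × Part n => (pos p.1, pos p.2)) := by
    intro p p' hp
    exact Prod.ext (pos_injective (congrArg Prod.fst hp)) (pos_injective (congrArg Prod.snd hp))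
  exact h.extend_apply (fun p => b k p.1 p.2) 0 (lam, mu)

/-- The unit vector `e_i`. -/
abbrev e (i : Fin n) : Fin n → ℤ := Pi.single i 1

variable (B : ℤ → (Fin n → ℤ) → (Fin n → ℤ) → K) (k : ℤ) (x y : Fin n → ℤ)

/-- The sum of `B_{x, y + e_i + e_{i+1}}` over the `i` with `y_{i+1} = y_i + 1`. -/
def adjacentSum : K :=
  ∑ i : Fin n, ∑ j : Fin n,
    if (j : ℕ) = i + 1 ∧ y j = y i + 1 then B k x (y + e i + e j) else 0

/-- The operator `L^{(1)}_-`. -/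
def L1minus : K :=
  -∑ i, (((y i : K) + 1) * B k x (y + e i) - (x i : K) * B k (x - e i) y) +
    (k : K) * ((n : K) * B (k - 1) x y - ∑ i, B (k - 1) x (y + 2 • e i) +
      adjacentSum B (k - 1) x y)

/-- The operator `L^{(1)}_0`. -/
def L1zero : K :=
  -(B k x y * ∑ i, ((y i : K) - (x i : K))) +
    (k : K) * (∑ i, B (k - 1) (x + e i) y - ∑ i, B (k - 1) x (y + e i))

/-- The operator `L^{(1)}_+`, which is `L^{(1)}_-` with the roles of `x` and `y` exchanged. -/
def L1plus : K := L1minus (fun k x y => B k y x) k y x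

/-- The operator `L^{(2)}_-`. -/
def L2minus (q : K) : K :=
  ∑ i, ((x i : K) * B k (x - e i) y - ((y i : K) + 1) * B k x (y + e i) +
      ((x i : K) - (y i : K) + q) * B k x y) +
    (k : K) * (-∑ i, (B (k - 1) x (y + e i) + B (k - 1) x (y + 2 • e i)) +
      adjacentSum B (k - 1) x y)

/-- The operator `L^{(2)}_+`. -/
def L2plus (q : K) : K :=
  ∑ i, ((y i : K) * B k x (y - e i) - ((x i : K) + 1 + q) * B k (x + e i) y +
      ((y i : K) - (x i : K)) * B k x y) +
    (k : K) * ∑ i, (B (k - 1) x y + B (k - 1) x (y + e i))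

/-- The operator `L^{(3)}`. -/
def L3 (p q : K) : K :=
  ∑ i, (((x i : K) * B k (x - e i) y + ((x i : K) + p + 1) * B k (x + e i) y) -
      ((y i : K) * B k x (y - e i) + ((y i : K) + q + 1) * B k x (y + e i))) +
    (∑ i, ((x i : K) - (y i : K))) * (B (k - 1) x y + B (k + 1) x y) +
    (n : K) * (p - q) * B (k - 1) x y

end Difference

/-- The operator `D` in `(t, s, k)` acts on every double Schur series, whatever its
coefficients `b`, and the result is the double Schur series with coefficients `L b`. -/
def Translates {K : Type*} [Field K] {R : Type*} [CommRing R] [Algebra K R] {n : ℕ}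
    (ρ : R →ₐ[K] Module.End K (ℤ → Series K)) (D : DiffOp R)
    (L : (ℤ → (Fin n → ℤ) → (Fin n → ℤ) → K) → ℤ → (Fin n → ℤ) → (Fin n → ℤ) → K) : Prop :=
  ∀ b : ℤ → Part n → Part n → K,
    D.MapsTo ρ (doubleSeries b)
      (doubleSeries fun k lam mu => L (toPos b) k (pos lam) (pos mu))

/-! ### Non-intersecting walks -/

section Walks

variable {n : ℕ}

/-- `w` describes a walk of `n` non-intersecting walkers in `ℤ` from `x` to `y` during `N`
instants, where `step j` says which moves are allowed from time `j` to time `j + 1`. -/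
def IsWalk (N : ℕ) (step : ℕ → (Fin n → ℤ) → (Fin n → ℤ) → Prop) (x y : Fin n → ℤ)
    (w : Fin (N + 1) → Fin n → ℤ) : Prop :=
  w 0 = x ∧ w (Fin.last N) = y ∧ (∀ j, StrictMono (w j)) ∧
    ∀ j : Fin N, step j (w j.castSucc) (w j.succ)

/-- The number of effective moves: the steps taken by all the walkers. -/
def effectiveMoves {N : ℕ} (w : Fin (N + 1) → Fin n → ℤ) : ℤ :=
  ∑ j : Fin N, ∑ i, |w j.succ i - w j.castSucc i|

/-- Exactly one walker moves one step to the left. -/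
def OneLeft (a a' : Fin n → ℤ) : Prop := ∃ i, a' = a - e i

/-- Exactly one walker moves one step to the right. -/
def OneRight (a a' : Fin n → ℤ) : Prop := ∃ i, a' = a + e i

/-- Every walker moves one step to the left or stays put. -/
def MayLeft (a a' : Fin n → ℤ) : Prop := ∀ i, a' i = a i - 1 ∨ a' i = a i

/-- Every walker moves one step to the right or stays put. -/
def MayRight (a a' : Fin n → ℤ) : Prop := ∀ i, a' i = a i + 1 ∨ a' i = a i

/-- First random walk: `k` instants, at each of which exactly one walker moves one step to the
left or to the right. The number of such walks is `0` for `k < 0`. -/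
def walkOne (k : ℤ) (x y : Fin n → ℤ) : ℕ :=
  if k < 0 then 0 else
    Set.ncard {w : Fin (k.toNat + 1) → Fin n → ℤ |
      IsWalk k.toNat (fun _ a a' => OneLeft a a' ∨ OneRight a a') x y w ∧
        effectiveMoves w = k}

/-- Second random walk: at the first `q` instants each walker may move one step to the right or
stay put, at each of the next `k` instants exactly one walker moves one step to the left. The
number of such walks is `0` for `k < 0`. -/
def walkTwo (q : ℕ) (k : ℤ) (x y : Fin n → ℤ) : ℕ :=
  if k < 0 then 0 else
    Set.ncard {w : Fin (q + k.toNat + 1) → Fin n → ℤ |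
      IsWalk (q + k.toNat) (fun j a a' => if j < q then MayRight a a' else OneLeft a a') x y w ∧
        effectiveMoves w = 2 * k + ∑ i, (y i - x i)}

/-- Third random walk: at the first `p` instants each walker may move one step to the right or
stay put, at each of the next `q` instants each walker may move one step to the left or stay
put, with `k` effective moves in total. -/
def walkThree (p q : ℕ) (k : ℤ) (x y : Fin n → ℤ) : ℕ :=
  Set.ncard {w : Fin (p + q + 1) → Fin n → ℤ |
    IsWalk (p + q) (fun j a a' => if j < p then MayRight a a' else MayLeft a a') x y w ∧
      effectiveMoves w = k}

end Walks

end VirasoroFourier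

end

/-!
Both halves rest on alternating functions of positions. For part (a), `altSchur` extends the Schur
polynomials `s_λ(t)` from the positions of partitions to all integer vectors, as a Jacobi–Trudi
determinant. The generating series `E = exp (∑ t_i z^i)` satisfies `V E = V(∑ t_i z^i) E` for
every derivation `V` in the variables `t` (`coeffwise_elemSchurSeries`), which turns `V_{-1}`,
`V_0`, `V_1` and `∂/∂t_a` into shifts of the index of `s_k`. Jacobi's formula passes this on to
the determinants: `pderiv_altSchur`, `derMinusOne_altSchur`, `derZero_altSchur`, `derOne_altSchur`
express the result by moving one walker. The factors that depend on the column contribute a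
constant for `V_0` and nothing for `V_{±1}`, because there a shifted column either equals its
neighbour or has the factor zero. A move by one step keeps a strictly increasing sequence weakly
increasing, so that the result is again a Schur polynomial or zero; a jump by two steps, which
comes from `∂/∂t_2` and `∂/∂s_2`, may pass another walker, and antisymmetry then turns it into a
move of two adjacent walkers with a minus sign (`sum_jump_eq`). This is the origin of the term `A`
in `L^{(1)}_∓` and `L^{(2)}_-`.

Each `s_λ(t) s_μ(-s)` is homogeneous of degree `|λ| + |μ|`, so that only finitely many pairs
contribute to a coefficient. An operator whose action on the products `s_λ(t) s_μ(-s)` moves the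
positions therefore acts on double Schur series by the transposed operator on the coefficients
(`translates_of_shift`), and `Translates` is compatible with sums and with multiplication by the
operators in `k`. A shift of variables changes the Virasoro operators by the terms `1`, `∂/∂t_1`,
`∂/∂s_1`, `∂/∂t_2`, `∂/∂s_2` only, since in the combinations that occur the higher contributions
cancel.

For part (b), free walks with weights are counted by elements `P` of a group algebra, and
non-intersecting ones from `x` to `y` by the alternating sum `altCount` of the free counts from
`x` to the permutations of `y`. Both counts satisfy the same recursion in the last step: removing
it from a strictly increasing `y` leads to weakly increasing sequences, and on those that are not
strictly increasing both counts vanish (`exists_finset_walks`). Inside `altCount`, multiplication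
by `y_i - x_i` becomes the Euler derivation `eulerDer i` of `P` and a displacement of one walker
becomes a product (`sum_euler_altCount`). The difference equations thereby reduce to the
logarithmic derivatives of the three generating functions: `eulerDer_powInt_genOne`,
`eulerDer_genTwo`, `eulerDer_genThree`.
-/

noncomputable section

namespace VirasoroFourier

/-! ### Formal sums of power series -/

section FormalSums

variable {K : Type*} [Field K] {ι κ : Type*}

theorem isFormalSum_iff {f : ι → Series K} {G : Series K} :
    IsFormalSum f G ↔ ∀ m, ∃ s : Finset ι, (∀ i ∉ s, MvPowerSeries.coeff m (f i) = 0) ∧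
      ∑ i ∈ s, MvPowerSeries.coeff m (f i) = MvPowerSeries.coeff m G := by
  classical
  refine forall_congr' fun m => ⟨fun h => ⟨h.1.toFinset, fun i hi => ?_, ?_⟩, ?_⟩
  · simpa using hi
  · refine Eq.trans (finsum_eq_sum_of_support_subset _ ?_).symm h.2
    simp
  · rintro ⟨s, hs, hsum⟩
    have hsub : (Function.support fun i => MvPowerSeries.coeff m (f i)) ⊆ s := by
      intro i hi
      by_contra h
      exact hi (hs i (by simpa using h))
    exact ⟨s.finite_toSet.subset hsub, by rw [finsum_eq_sum_of_support_subset _ hsub, hsum]⟩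

/-- Finitely many coefficients of a formal sum are computed by one finite partial sum. -/
theorem IsFormalSum.exists_finset {f : ι → Series K} {G : Series K} (h : IsFormalSum f G)
    (M : Finset (Var →₀ ℕ)) : ∃ s : Finset ι, ∀ m ∈ M,
      (∀ i ∉ s, MvPowerSeries.coeff m (f i) = 0) ∧
        ∑ i ∈ s, MvPowerSeries.coeff m (f i) = MvPowerSeries.coeff m G := by
  classical
  rw [isFormalSum_iff] at h
  choose s hs hsum using h
  refine ⟨M.biUnion s, fun m hm => ⟨fun i hi => hs m i fun h' => hi ?_, ?_⟩⟩
  · exact Finset.mem_biUnion.2 ⟨m, hm, h'⟩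
  · rw [← hsum m]
    refine (Finset.sum_subset (Finset.subset_biUnion_of_mem s hm) fun i _ hi => hs m i hi).symm

theorem IsFormalSum.unique {f : ι → Series K} {G G' : Series K} (h : IsFormalSum f G)
    (h' : IsFormalSum f G') : G = G' := by
  ext m
  rw [← (h m).2, (h' m).2]

/-- A linear map between power series each of whose coefficients is a finite linear combination
of coefficients of the argument preserves formal sums. -/
theorem IsFormalSum.map_of_local {f : ι → Series K} {G : Series K} (h : IsFormalSum f G)
    (T : Series K → Series K) (M : (Var →₀ ℕ) → Finset (Var →₀ ℕ))
    (c : (Var →₀ ℕ) → (Var →₀ ℕ) → K)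
    (hT : ∀ F m, MvPowerSeries.coeff m (T F) =
      ∑ a ∈ M m, c m a * MvPowerSeries.coeff a F) :
    IsFormalSum (fun i => T (f i)) (T G) := by
  rw [isFormalSum_iff]
  intro m
  obtain ⟨s, hs⟩ := h.exists_finset (M m)
  refine ⟨s, fun i hi => ?_, ?_⟩
  · rw [hT]
    exact Finset.sum_eq_zero fun a ha => by rw [(hs a ha).1 i hi, mul_zero]
  · simp_rw [hT]
    rw [Finset.sum_comm]
    exact Finset.sum_congr rfl fun a ha => by rw [← Finset.mul_sum, (hs a ha).2]

theorem IsFormalSum.mul_left {f : ι → Series K} {G : Series K} (h : IsFormalSum f G)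
    (P : Series K) : IsFormalSum (fun i => P * f i) (P * G) := by
  classical
  refine h.map_of_local (fun F => P * F) (fun m => (Finset.HasAntidiagonal.antidiagonal m).image Prod.snd)
    (fun m a => MvPowerSeries.coeff (m - a) P) fun F m => ?_
  rw [MvPowerSeries.coeff_mul, Finset.sum_image]
  · refine Finset.sum_congr rfl fun p hp => ?_
    rw [← Finset.HasAntidiagonal.mem_antidiagonal.1 hp, add_tsub_cancel_right]
  · intro p hp p' hp' heq
    have h1 := Finset.HasAntidiagonal.mem_antidiagonal.1 hp
    have h2 := Finset.HasAntidiagonal.mem_antidiagonal.1 hp'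
    refine Prod.ext ?_ heq
    rw [← h2, heq] at h1
    exact add_right_cancel h1

theorem IsFormalSum.smul {f : ι → Series K} {G : Series K} (h : IsFormalSum f G)
    (c : K) : IsFormalSum (fun i => c • f i) (c • G) :=
  h.map_of_local (fun F => c • F) (fun m => {m}) (fun _ _ => c) fun F m => by simp

theorem IsFormalSum.pderiv {f : ι → Series K} {G : Series K} (h : IsFormalSum f G)
    (v : Var) :
    IsFormalSum (fun i => MvPowerSeries.pderiv K v (f i)) (MvPowerSeries.pderiv K v G) :=
  h.map_of_local (fun F => MvPowerSeries.pderiv K v F) (fun m => {m + Finsupp.single v 1})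
    (fun m _ => (m v : K) + 1) fun F m => by
      simp [MvPowerSeries.coeff_pderiv, mul_comm]

theorem isFormalSum_zero : IsFormalSum (fun _ : ι => (0 : Series K)) 0 := by
  rw [isFormalSum_iff]
  exact fun m => ⟨∅, by simp⟩

theorem IsFormalSum.add {f g : ι → Series K} {F G : Series K} (hf : IsFormalSum f F)
    (hg : IsFormalSum g G) : IsFormalSum (fun i => f i + g i) (F + G) := by
  classical
  rw [isFormalSum_iff] at *
  intro m
  obtain ⟨s, hs, hs'⟩ := hf m
  obtain ⟨t, ht, ht'⟩ := hg m
  refine ⟨s ∪ t, fun i hi => ?_, ?_⟩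
  · simp only [Finset.mem_union, not_or] at hi
    simp [hs i hi.1, ht i hi.2]
  · simp only [map_add, Finset.sum_add_distrib]
    rw [← hs', ← ht', ← Finset.sum_subset (Finset.subset_union_left (s₁ := s) (s₂ := t))
      (fun i _ hi => hs i hi),
      ← Finset.sum_subset (Finset.subset_union_right (s₁ := s) (s₂ := t))
      (fun i _ hi => ht i hi)]

theorem IsFormalSum.sum {α : Type*} (A : Finset α) {f : α → ι → Series K} {F : α → Series K}
    (h : ∀ a ∈ A, IsFormalSum (f a) (F a)) :
    IsFormalSum (fun i => ∑ a ∈ A, f a i) (∑ a ∈ A, F a) := by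
  classical
  induction A using Finset.induction_on with
  | empty => simpa using isFormalSum_zero
  | insert a A ha ih =>
    simp only [Finset.sum_insert ha]
    exact (h a (Finset.mem_insert_self a A)).add
      (ih fun a' ha' => h a' (Finset.mem_insert_of_mem ha'))

/-- A family that vanishes off the range of an injective map has the same formal sum as its
restriction along this map. -/
theorem isFormalSum_comp_iff {e : κ → ι} (he : Function.Injective e) {f : ι → Series K}
    (hf : ∀ i, i ∉ Set.range e → f i = 0) {G : Series K} :
    IsFormalSum (fun j => f (e j)) G ↔ IsFormalSum f G := by
  classical
  rw [isFormalSum_iff, isFormalSum_iff]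
  refine forall_congr' fun m => ⟨?_, ?_⟩
  · rintro ⟨s, hs, hsum⟩
    refine ⟨s.map ⟨e, he⟩, fun i hi => ?_, by simpa using hsum⟩
    by_cases hr : i ∈ Set.range e
    · obtain ⟨j, rfl⟩ := hr
      exact hs j fun hj => hi (Finset.mem_map_of_mem ⟨e, he⟩ hj)
    · simp [hf i hr]
  · rintro ⟨s, hs, hsum⟩
    refine ⟨s.preimage e he.injOn, fun j hj => hs _ (by simpa using hj), ?_⟩
    rw [← hsum, Finset.sum_preimage e s he.injOn (fun i => MvPowerSeries.coeff m (f i))]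
    intro i _ hi
    simp [hf i hi]

/-- A family with finite support has its finite sum as formal sum. -/
theorem isFormalSum_of_finset {f : ι → Series K} (s : Finset ι) (hs : ∀ i ∉ s, f i = 0) :
    IsFormalSum f (∑ i ∈ s, f i) := by
  rw [isFormalSum_iff]
  exact fun m => ⟨s, fun i hi => by simp [hs i hi], by simp⟩

/-- Interchange of two formal summations; for each coefficient only finitely many indices of the
outer summation matter, uniformly in the inner index. -/
theorem IsFormalSum.swap {f : κ → ι → Series K} {G : κ → Series K} {H : ι → Series K}
    (hG : ∀ o, IsFormalSum (f o) (G o)) (hH : ∀ i, IsFormalSum (fun o => f o i) (H i))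
    (hfin : ∀ m, {o | ∃ i, MvPowerSeries.coeff m (f o i) ≠ 0}.Finite) {F : Series K}
    (hF : IsFormalSum H F) : IsFormalSum G F := by
  classical
  rw [isFormalSum_iff]
  intro m
  set O := (hfin m).toFinset with hO
  have hO' : ∀ o ∉ O, ∀ i, MvPowerSeries.coeff m (f o i) = 0 := by
    intro o ho i
    by_contra hne
    exact ho ((hfin m).mem_toFinset.2 ⟨i, hne⟩)
  have hsum := IsFormalSum.sum O fun o _ => hG o
  obtain ⟨s, hs⟩ := hsum.exists_finset {m}
  have hs1 := hs m (Finset.mem_singleton_self m)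
  refine ⟨O, fun o ho => ?_, ?_⟩
  · obtain ⟨t, -, ht⟩ := isFormalSum_iff.1 (hG o) m
    rw [← ht]
    exact Finset.sum_eq_zero fun i _ => hO' o ho i
  · rw [← map_sum, ← hs1.2]
    have hHi : ∀ i, MvPowerSeries.coeff m (H i) = MvPowerSeries.coeff m (∑ o ∈ O, f o i) := by
      intro i
      rw [← (hH i m).2, map_sum]
      refine finsum_eq_sum_of_support_subset _ fun o ho => ?_
      by_contra h
      exact ho (hO' o (by simpa using h) i)
    simp_rw [← hHi]
    rw [← (hF m).2, finsum_eq_sum_of_support_subset]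
    intro i hi
    by_contra h
    exact hi ((hHi i).trans (hs1.1 i (by simpa using h)))

end FormalSums

/-! ### Derivations of elementary Schur polynomials -/

section ElemSchur

variable (K : Type*) [Field K]

/-- The generating series `∑_k s_k(t) z^k` of the elementary Schur polynomials. -/
def elemSchurSeries : PowerSeries (MvPolynomial ℕ+ K) := PowerSeries.mk (elemSchur K)

/-- A derivation of the coefficients applied coefficientwise to a power series in `z`. -/
def coeffwise (V : Derivation K (MvPolynomial ℕ+ K) (MvPolynomial ℕ+ K))
    (F : PowerSeries (MvPolynomial ℕ+ K)) : PowerSeries (MvPolynomial ℕ+ K) :=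
  PowerSeries.mk fun k => V (PowerSeries.coeff k F)

theorem coeffwise_mul (V : Derivation K (MvPolynomial ℕ+ K) (MvPolynomial ℕ+ K))
    (F G : PowerSeries (MvPolynomial ℕ+ K)) :
    coeffwise K V (F * G) = coeffwise K V F * G + F * coeffwise K V G := by
  ext1 k
  simp only [coeffwise, PowerSeries.coeff_mk, PowerSeries.coeff_mul, map_add, map_sum,
    Derivation.leibniz, smul_eq_mul, Finset.sum_add_distrib]
  rw [add_comm]
  congr 1
  exact Finset.sum_congr rfl fun _ _ => mul_comm _ _

theorem coeffwise_derivative (V : Derivation K (MvPolynomial ℕ+ K) (MvPolynomial ℕ+ K))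
    (F : PowerSeries (MvPolynomial ℕ+ K)) :
    coeffwise K V (PowerSeries.derivative _ F) = PowerSeries.derivative _ (coeffwise K V F) := by
  ext1 k
  simp [coeffwise, PowerSeries.coeff_derivative, mul_comm]

theorem elemSchurInt_of_neg {k : ℤ} (hk : k < 0) : elemSchurInt K k = 0 := if_pos hk

theorem elemSchurInt_natCast (k : ℕ) : elemSchurInt K k = elemSchur K k := by
  simp [elemSchurInt]

theorem coeff_tSeries (a : ℕ+) :
    PowerSeries.coeff (a : ℕ) (tSeries K) = MvPolynomial.X a := by
  rw [tSeries, PowerSeries.coeff_mk, dif_pos a.pos]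
  rfl

theorem coeffwise_tSeries_eq {V : Derivation K (MvPolynomial ℕ+ K) (MvPolynomial ℕ+ K)}
    {F : PowerSeries (MvPolynomial ℕ+ K)} (h0 : PowerSeries.coeff 0 F = 0)
    (h : ∀ a : ℕ+, V (MvPolynomial.X a) = PowerSeries.coeff (a : ℕ) F) :
    coeffwise K V (tSeries K) = F := by
  ext1 k
  rw [coeffwise, PowerSeries.coeff_mk]
  rcases Nat.eq_zero_or_pos k with rfl | hk
  · simp [h0, tSeries]
  · lift k to ℕ+ using hk
    rw [coeff_tSeries, h]

variable [CharZero K]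

/-- The differential equation `E' = (∑ t_i z^i)' E` of `E = exp (∑ t_i z^i)`. -/
theorem derivative_elemSchurSeries :
    PowerSeries.derivative _ (elemSchurSeries K) =
      PowerSeries.derivative _ (tSeries K) * elemSchurSeries K := by
  let _ : Algebra ℚ (MvPolynomial ℕ+ K) := Algebra.compHom _ (algebraMap ℚ K)
  have h : elemSchurSeries K =
      (PowerSeries.exp (MvPolynomial ℕ+ K)).subst (tSeries K) := by
    ext1 k
    rw [elemSchurSeries, PowerSeries.coeff_mk, ← coeff_exp_tSeries,
      PowerSeries.coeff_subst' (hasSubst_tSeries K), PowerSeries.coeff_subst' (hasSubst_tSeries K)]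
    refine finsum_congr fun d => ?_
    rw [PowerSeries.coeff_exp, PowerSeries.coeff_exp, ← algebraMap_smul (MvPolynomial ℕ+ K)]
    rfl
  rw [h, PowerSeries.derivative_subst (hasSubst_tSeries K), PowerSeries.derivative_exp, mul_comm]

/-- A power series solution of `F' = a F` that vanishes at the origin is zero. -/
theorem eq_zero_of_derivative_eq {F a : PowerSeries (MvPolynomial ℕ+ K)}
    (h : PowerSeries.derivative _ F = a * F) (h0 : PowerSeries.coeff 0 F = 0) : F = 0 := by
  ext1 k
  induction k using Nat.strong_induction_on with
  | _ k ih =>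
    cases k with
    | zero => simpa using h0
    | succ k =>
      have h1 := congrArg (PowerSeries.coeff k) h
      rw [PowerSeries.coeff_derivative, PowerSeries.coeff_mul, Finset.sum_eq_zero] at h1
      · have h2 : ((k : ℕ) : MvPolynomial ℕ+ K) + 1 ≠ 0 := by exact_mod_cast k.succ_ne_zero
        simpa [h2] using h1
      · intro p hp
        have := Finset.HasAntidiagonal.mem_antidiagonal.1 hp
        rw [ih p.2 (by omega)]
        simp

/-- Since `E = exp (∑ t_i z^i)`, every derivation `V` in the variables `t` satisfies
`V E = V(∑ t_i z^i) E`. -/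
theorem coeffwise_elemSchurSeries
    (V : Derivation K (MvPolynomial ℕ+ K) (MvPolynomial ℕ+ K)) :
    coeffwise K V (elemSchurSeries K) = coeffwise K V (tSeries K) * elemSchurSeries K := by
  rw [← sub_eq_zero]
  refine eq_zero_of_derivative_eq K (a := PowerSeries.derivative _ (tSeries K)) ?_ ?_
  · rw [map_sub, ← coeffwise_derivative, derivative_elemSchurSeries, coeffwise_mul,
      coeffwise_derivative, Derivation.leibniz, derivative_elemSchurSeries, smul_eq_mul,
      smul_eq_mul]
    ring
  · have h1 : elemSchur K 0 = 1 := by simp [elemSchur]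
    simp [coeffwise, elemSchurSeries, tSeries, PowerSeries.coeff_zero_eq_constantCoeff, h1]

/-- `V_{-1}` as a derivation of polynomials in `t`. -/
def derMinusOne : Derivation K (MvPolynomial ℕ+ K) (MvPolynomial ℕ+ K) :=
  MvPolynomial.mkDerivation K fun i =>
    MvPolynomial.C (((i : ℕ) : K) + 1) * MvPolynomial.X (i + 1)

/-- `V_0` as a derivation of polynomials in `t`. -/
def derZero : Derivation K (MvPolynomial ℕ+ K) (MvPolynomial ℕ+ K) :=
  MvPolynomial.mkDerivation K fun i => MvPolynomial.C ((i : ℕ) : K) * MvPolynomial.X i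

/-- `V_1` as a derivation of polynomials in `t`. -/
def derOne : Derivation K (MvPolynomial ℕ+ K) (MvPolynomial ℕ+ K) :=
  MvPolynomial.mkDerivation K fun i =>
    if 1 < i then MvPolynomial.C (((i : ℕ) : K) - 1) * MvPolynomial.X (i - 1) else 0

theorem derivation_elemSchur (V : Derivation K (MvPolynomial ℕ+ K) (MvPolynomial ℕ+ K)) (k : ℕ) :
    V (elemSchur K k) =
      PowerSeries.coeff k (coeffwise K V (tSeries K) * elemSchurSeries K) := by
  rw [← coeffwise_elemSchurSeries]
  simp [coeffwise, elemSchurSeries]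

theorem pderiv_elemSchurInt (a : ℕ+) (k : ℤ) :
    MvPolynomial.pderiv a (elemSchurInt K k) = elemSchurInt K (k - (a : ℕ)) := by
  rcases lt_or_ge k 0 with hk | hk
  · rw [elemSchurInt_of_neg K hk, elemSchurInt_of_neg K (by have := a.pos; omega), map_zero]
  lift k to ℕ using hk
  rw [elemSchurInt_natCast, derivation_elemSchur]
  have h : coeffwise K (MvPolynomial.pderiv a) (tSeries K) = PowerSeries.X ^ (a : ℕ) := by
    refine coeffwise_tSeries_eq K ?_ fun b => ?_
    · rw [PowerSeries.coeff_X_pow, if_neg a.pos.ne]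
    · rw [PowerSeries.coeff_X_pow, MvPolynomial.pderiv_X, Pi.single_apply]
      simp only [PNat.coe_inj, eq_comm]
  rw [h, PowerSeries.coeff_X_pow_mul']
  split_ifs with h1
  · rw [← Nat.cast_sub h1, elemSchurInt_natCast]
    simp [elemSchurSeries]
  · rw [elemSchurInt_of_neg K (by omega)]

theorem derMinusOne_elemSchurInt (k : ℤ) :
    derMinusOne K (elemSchurInt K k) = ((k : MvPolynomial ℕ+ K) + 1) * elemSchurInt K (k + 1) -
      MvPolynomial.X 1 * elemSchurInt K k := by
  rcases lt_or_ge k 0 with hk | hk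
  · rcases eq_or_ne k (-1) with rfl | h
    · simp [elemSchurInt_of_neg]
    · rw [elemSchurInt_of_neg K hk, elemSchurInt_of_neg K (by omega)]
      simp
  lift k to ℕ using hk
  rw [elemSchurInt_natCast, derivation_elemSchur]
  have h : coeffwise K (derMinusOne K) (tSeries K) =
      PowerSeries.derivative _ (tSeries K) - PowerSeries.C (MvPolynomial.X 1) := by
    refine coeffwise_tSeries_eq K ?_ fun b => ?_
    · have h1 := coeff_tSeries K 1
      rw [PNat.one_coe] at h1
      rw [map_sub, PowerSeries.coeff_derivative, zero_add, h1, PowerSeries.coeff_C]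
      simp
    · have h1 := coeff_tSeries K (b + 1)
      rw [PNat.add_coe, PNat.one_coe] at h1
      rw [map_sub, PowerSeries.coeff_derivative, h1, PowerSeries.coeff_C, if_neg b.ne_zero,
        derMinusOne, MvPolynomial.mkDerivation_X]
      simp [mul_comm]
  have h3 : elemSchurInt K ((k : ℤ) + 1) = elemSchur K (k + 1) := by
    exact_mod_cast elemSchurInt_natCast K (k + 1)
  rw [h, sub_mul, ← derivative_elemSchurSeries, map_sub, PowerSeries.coeff_derivative,
    PowerSeries.coeff_C_mul, h3]
  simp [elemSchurSeries, mul_comm]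

theorem derZero_elemSchurInt (k : ℤ) :
    derZero K (elemSchurInt K k) = (k : MvPolynomial ℕ+ K) * elemSchurInt K k := by
  rcases lt_or_ge k 0 with hk | hk
  · simp [elemSchurInt_of_neg K hk]
  lift k to ℕ using hk
  rw [elemSchurInt_natCast, derivation_elemSchur]
  have h : coeffwise K (derZero K) (tSeries K) =
      PowerSeries.X * PowerSeries.derivative _ (tSeries K) := by
    refine coeffwise_tSeries_eq K (by simp) fun b => ?_
    rw [derZero, MvPolynomial.mkDerivation_X, ← coeff_tSeries]
    obtain ⟨l, hl⟩ := Nat.exists_eq_add_of_le' b.pos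
    rw [hl, PowerSeries.coeff_succ_X_mul, PowerSeries.coeff_derivative]
    simp [mul_comm]
  rw [h, mul_assoc, ← derivative_elemSchurSeries]
  cases k with
  | zero => simp
  | succ k =>
    rw [PowerSeries.coeff_succ_X_mul, PowerSeries.coeff_derivative]
    simp [elemSchurSeries, mul_comm]

theorem derOne_elemSchurInt (k : ℤ) :
    derOne K (elemSchurInt K k) =
      ((k : MvPolynomial ℕ+ K) - 1) * elemSchurInt K (k - 1) := by
  rcases lt_or_ge k 0 with hk | hk
  · rw [elemSchurInt_of_neg K hk, elemSchurInt_of_neg K (by omega)]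
    simp
  lift k to ℕ using hk
  rw [elemSchurInt_natCast, derivation_elemSchur]
  have h : coeffwise K (derOne K) (tSeries K) =
      PowerSeries.X ^ 2 * PowerSeries.derivative _ (tSeries K) := by
    refine coeffwise_tSeries_eq K (by simp [PowerSeries.coeff_X_pow_mul']) fun b => ?_
    rw [derOne, MvPolynomial.mkDerivation_X, PowerSeries.coeff_X_pow_mul']
    have h0 : 1 < b ↔ 2 ≤ (b : ℕ) := by
      rw [← PNat.coe_lt_coe, PNat.one_coe]
      rfl
    split_ifs with h3 h1 h1
    rotate_left
    · exact absurd (h0.1 h3) h1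
    · exact absurd (h0.2 h1) h3
    · rfl
    obtain ⟨l, hl⟩ := Nat.exists_eq_add_of_le' h1
    have h2 : ((b - 1 : ℕ+) : ℕ) = l + 1 := by
      rw [PNat.sub_coe, if_pos (h0.2 h1), hl]
      simp
    rw [← coeff_tSeries, h2, PowerSeries.coeff_derivative, hl, Nat.add_sub_cancel]
    push_cast
    simp only [map_add, map_sub, map_natCast, map_one, map_ofNat]
    ring
  rw [h, mul_assoc, ← derivative_elemSchurSeries, PowerSeries.coeff_X_pow_mul']
  split_ifs with h1
  · obtain ⟨l, rfl⟩ := Nat.exists_eq_add_of_le' h1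
    have h3 : elemSchurInt K (((l + 2 : ℕ) : ℤ) - 1) = elemSchur K (l + 1) := by
      rw [← elemSchurInt_natCast]
      congr 1
      push_cast
      ring
    rw [PowerSeries.coeff_derivative, h3, mul_comm]
    congr 1
    · push_cast [Nat.add_sub_cancel]
      ring
    · simp [elemSchurSeries]
  · have h2 : k = 0 ∨ k = 1 := by omega
    rcases h2 with rfl | rfl
    · simp [elemSchurInt_of_neg]
    · simp

end ElemSchur

/-! ### Derivations of determinants -/

section Det

variable {A : Type*} [CommRing A] {n : ℕ}

theorem trace_mul_adjugate_eq_sum_row (M N : Matrix (Fin n) (Fin n) A) :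
    (N * M.adjugate).trace = ∑ i, (M.updateRow i (N i)).det := by
  rw [Matrix.trace]
  refine Finset.sum_congr rfl fun i _ => ?_
  rw [← Matrix.cramer_transpose_apply, Matrix.cramer_eq_adjugate_mulVec, Matrix.diag_apply,
    Matrix.mul_apply, Matrix.mulVec, dotProduct, ← Matrix.adjugate_transpose]
  exact Finset.sum_congr rfl fun j _ => mul_comm _ _

theorem trace_mul_adjugate_eq_sum_col (M N : Matrix (Fin n) (Fin n) A) :
    (N * M.adjugate).trace = ∑ j, (M.updateCol j fun i => N i j).det := by
  rw [Matrix.trace_mul_comm, Matrix.trace]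
  refine Finset.sum_congr rfl fun j _ => ?_
  rw [← Matrix.cramer_apply, Matrix.cramer_eq_adjugate_mulVec, Matrix.diag_apply,
    Matrix.mul_apply, Matrix.mulVec, dotProduct]

variable {K : Type*} [CommRing K] [Algebra K A]

theorem derivation_prod {ι : Type*} [DecidableEq ι] (D : Derivation K A A) (s : Finset ι)
    (f : ι → A) : D (∏ i ∈ s, f i) = ∑ i ∈ s, ∏ j ∈ s, Function.update f i (D (f i)) j := by
  induction s using Finset.induction_on with
  | empty => simp
  | insert a s ha ih =>
    rw [Finset.prod_insert ha, D.leibniz, ih, Finset.sum_insert ha, Finset.prod_insert ha,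
      Function.update_self, smul_eq_mul, smul_eq_mul, add_comm, mul_comm]
    congr 1
    · congr 1
      refine Finset.prod_congr rfl fun j hj => ?_
      rw [Function.update_of_ne]
      exact fun h => ha (h ▸ hj)
    · rw [Finset.mul_sum]
      refine Finset.sum_congr rfl fun i hi => ?_
      rw [Finset.prod_insert ha, Function.update_of_ne]
      exact fun h => ha (h ▸ hi)

/-- Jacobi's formula. -/
theorem derivation_det (D : Derivation K A A) (M : Matrix (Fin n) (Fin n) A) :
    D M.det = (M.map D * M.adjugate).trace := by
  rw [trace_mul_adjugate_eq_sum_col, Matrix.det_apply, map_sum]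
  simp_rw [Matrix.det_apply]
  rw [Finset.sum_comm]
  refine Finset.sum_congr rfl fun σ _ => ?_
  rw [Units.smul_def, map_zsmul, derivation_prod, Finset.smul_sum]
  refine Finset.sum_congr rfl fun i _ => ?_
  rw [Units.smul_def]
  congr 1
  refine Finset.prod_congr rfl fun j _ => ?_
  rw [Matrix.updateCol_apply, Function.update_apply]
  split_ifs with h
  · rw [Matrix.map_apply, h]
  · rfl

end Det

/-! ### Schur polynomials at arbitrary positions -/

section AltSchur

variable (K : Type*) [Field K] {n : ℕ}

/-- The Jacobi–Trudi matrix of arbitrary integer positions `x`; for the positions of a partition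
it is the matrix of the elementary Schur polynomials in the definition of `schur`. -/
def jacobiTrudi (x : Fin n → ℤ) : Matrix (Fin n) (Fin n) (MvPolynomial ℕ+ K) :=
  Matrix.of fun i j => elemSchurInt K (x (Fin.rev i) - ((n : ℤ) - 1) + (j : ℕ))

/-- The extension of Schur polynomials from the positions of a partition to arbitrary integer
positions, as an alternating function. -/
def altSchur (x : Fin n → ℤ) : MvPolynomial ℕ+ K := (jacobiTrudi K x).det

theorem altSchur_pos (lam : Part n) : altSchur K (pos lam) = schur K lam := by
  rw [altSchur, schur]
  congr 1
  ext1 i j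
  simp only [jacobiTrudi, pos, Matrix.of_apply, Fin.rev_rev, Fin.val_rev]
  congr 1
  have := i.2
  omega

theorem altSchur_comp (x : Fin n → ℤ) (σ : Equiv.Perm (Fin n)) :
    altSchur K (x ∘ σ) = (Equiv.Perm.sign σ : ℤ) • altSchur K x := by
  have h : jacobiTrudi K (x ∘ σ) =
      (jacobiTrudi K x).submatrix ((Fin.revPerm.symm.trans σ).trans Fin.revPerm) id := by
    ext1 i j
    simp [jacobiTrudi]
  rw [altSchur, h, Matrix.det_permute, altSchur]
  have h2 : Equiv.Perm.sign ((Fin.revPerm.symm.trans σ).trans Fin.revPerm) = Equiv.Perm.sign σ :=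
    Equiv.Perm.sign_symm_trans_trans σ Fin.revPerm
  rw [h2, zsmul_eq_mul]

theorem altSchur_of_neg {x : Fin n → ℤ} {i : Fin n} (hi : x i < 0) : altSchur K x = 0 := by
  refine Matrix.det_eq_zero_of_row_eq_zero (Fin.rev i) fun j => ?_
  have := j.2
  simp only [jacobiTrudi, Matrix.of_apply, Fin.rev_rev]
  exact elemSchurInt_of_neg K (by omega)

theorem altSchur_of_not_injective {x : Fin n → ℤ} (hx : ¬ Function.Injective x) :
    altSchur K x = 0 := by
  simp only [Function.Injective, not_forall] at hx
  obtain ⟨a, b, hab, hne⟩ := hx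
  refine Matrix.det_zero_of_row_eq (i := Fin.rev a) (j := Fin.rev b) (by simpa using hne) ?_
  funext j
  simp [jacobiTrudi, hab]

/-- Moving one walker by `c` is a shift by `c` of the indices in one row. -/
theorem det_updateRow_jacobiTrudi (x : Fin n → ℤ) (i : Fin n) (c : ℤ) :
    ((jacobiTrudi K x).updateRow (Fin.rev i) fun j =>
      elemSchurInt K (x i - ((n : ℤ) - 1) + (j : ℕ) + c)).det =
        altSchur K (x + Pi.single i c) := by
  rw [altSchur]
  congr 1
  ext1 a b
  rw [Matrix.updateRow_apply]
  split_ifs with h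
  · subst h
    simp only [jacobiTrudi, Matrix.of_apply, Fin.rev_rev, Pi.add_apply, Pi.single_eq_same]
    congr 1
    ring
  · have h' : Fin.rev a ≠ i := fun h' => h (by rw [← h', Fin.rev_rev])
    simp [jacobiTrudi, h']

theorem det_updateRow_jacobiTrudi_smul (x : Fin n → ℤ) (i : Fin n) (c : ℤ)
    (a : MvPolynomial ℕ+ K) :
    ((jacobiTrudi K x).updateRow (Fin.rev i) fun j =>
      a * elemSchurInt K (x i - ((n : ℤ) - 1) + (j : ℕ) + c)).det =
        a * altSchur K (x + Pi.single i c) := by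
  rw [← det_updateRow_jacobiTrudi, ← Matrix.det_updateRow_smul]
  rfl

/-- The sum over the rows of the Jacobi–Trudi determinants in which one row is shifted by `c`
and multiplied by a coefficient that depends on the row. -/
theorem trace_rowShift (x : Fin n → ℤ) (c : ℤ) (a : Fin n → MvPolynomial ℕ+ K) :
    ((Matrix.of fun i j : Fin n => a (Fin.rev i) *
      elemSchurInt K (x (Fin.rev i) - ((n : ℤ) - 1) + (j : ℕ) + c)) *
        (jacobiTrudi K x).adjugate).trace =
      ∑ i, a i * altSchur K (x + Pi.single i c) := by
  rw [trace_mul_adjugate_eq_sum_row, ← Equiv.sum_comp Fin.revPerm]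
  refine Finset.sum_congr rfl fun i _ => ?_
  rw [← det_updateRow_jacobiTrudi_smul]
  congr 2
  funext j
  simp

theorem trace_self_mul_adjugate (M : Matrix (Fin n) (Fin n) (MvPolynomial ℕ+ K)) :
    (M * M.adjugate).trace = (n : MvPolynomial ℕ+ K) * M.det := by
  rw [Matrix.mul_adjugate, Matrix.trace_smul, Matrix.trace_one, Fintype.card_fin, smul_eq_mul,
    mul_comm]

variable [CharZero K]

theorem pderiv_altSchur (a : ℕ+) (x : Fin n → ℤ) :
    MvPolynomial.pderiv a (altSchur K x) =
      ∑ i, altSchur K (x + Pi.single i (-((a : ℕ) : ℤ))) := by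
  rw [altSchur, derivation_det]
  have := trace_rowShift K x (-((a : ℕ) : ℤ)) fun _ => 1
  simp only [one_mul] at this
  rw [← this]
  congr 2
  ext1 i j
  simp only [jacobiTrudi, Matrix.map_apply, Matrix.of_apply, pderiv_elemSchurInt]
  rfl

theorem derMinusOne_altSchur (x : Fin n → ℤ) :
    derMinusOne K (altSchur K x) + (n : MvPolynomial ℕ+ K) * MvPolynomial.X 1 * altSchur K x =
      ∑ i, ((x i : MvPolynomial ℕ+ K) + 1) * altSchur K (x + Pi.single i 1) := by
  -- The factor of each entry depends on its row through `x i + 1` and on its column through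
  -- `n - 1 - j`. The second contribution vanishes: in the last column this factor is zero, and
  -- in the column `j` the shifted entries are those of the column `j + 1`.
  have h : (jacobiTrudi K x).map (derMinusOne K) =
      (Matrix.of fun i j : Fin n => ((x (Fin.rev i) : MvPolynomial ℕ+ K) + 1) *
        elemSchurInt K (x (Fin.rev i) - ((n : ℤ) - 1) + (j : ℕ) + 1)) -
      (Matrix.of fun i j : Fin n => ((n : MvPolynomial ℕ+ K) - 1 - (j : ℕ)) *
        elemSchurInt K (x (Fin.rev i) - ((n : ℤ) - 1) + (j : ℕ) + 1)) -
      (MvPolynomial.X 1 : MvPolynomial ℕ+ K) • jacobiTrudi K x := by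
    ext1 i j
    simp only [jacobiTrudi, Matrix.map_apply, Matrix.of_apply, derMinusOne_elemSchurInt,
      Matrix.sub_apply, Matrix.smul_apply, smul_eq_mul]
    push_cast
    ring
  rw [altSchur, derivation_det, h, sub_mul, sub_mul, Matrix.trace_sub, Matrix.trace_sub,
    trace_rowShift K x 1 fun i => (x i : MvPolynomial ℕ+ K) + 1, Matrix.smul_mul,
    Matrix.trace_smul, trace_self_mul_adjugate, trace_mul_adjugate_eq_sum_col,
    Finset.sum_eq_zero (s := Finset.univ) (f := fun j => Matrix.det _)]
  · rw [smul_eq_mul]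
    ring
  · intro j _
    rcases eq_or_ne ((j : ℕ) + 1) n with hj | hj
    · refine Matrix.det_eq_zero_of_column_eq_zero j fun i => ?_
      have h1 : (n : MvPolynomial ℕ+ K) - 1 - (j : ℕ) = 0 := by
        have h2 := congrArg (Nat.cast : ℕ → MvPolynomial ℕ+ K) hj
        push_cast at h2
        linear_combination -h2
      rw [Matrix.updateCol_self, Matrix.of_apply, h1, zero_mul]
    · have hlt : (j : ℕ) + 1 < n := lt_of_le_of_ne j.2 hj
      have hcol : ((jacobiTrudi K x).updateCol j fun i =>
          ((n : MvPolynomial ℕ+ K) - 1 - (j : ℕ)) •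
            jacobiTrudi K x i ⟨j + 1, hlt⟩).det = 0 := by
        have h3 := Matrix.det_updateCol_smul (jacobiTrudi K x) j
          ((n : MvPolynomial ℕ+ K) - 1 - (j : ℕ)) fun i => jacobiTrudi K x i ⟨j + 1, hlt⟩
        refine Eq.trans h3 ?_
        rw [Matrix.det_zero_of_column_eq (i := j) (j := ⟨j + 1, hlt⟩), mul_zero]
        · simp [Fin.ext_iff]
        · intro i
          rw [Matrix.updateCol_self, Matrix.updateCol_ne]
          simp [Fin.ext_iff]
      rw [← hcol]
      congr 2
      funext i
      simp only [jacobiTrudi, Matrix.of_apply, smul_eq_mul]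
      congr 2
      push_cast
      ring

theorem derZero_altSchur (x : Fin n → ℤ) :
    derZero K (altSchur K x) =
      ((∑ i, (x i : MvPolynomial ℕ+ K)) - ∑ i : Fin n, ((i : ℕ) : MvPolynomial ℕ+ K)) *
        altSchur K x := by
  have h : (jacobiTrudi K x).map (derZero K) =
      (Matrix.of fun i j : Fin n => (x (Fin.rev i) : MvPolynomial ℕ+ K) *
        elemSchurInt K (x (Fin.rev i) - ((n : ℤ) - 1) + (j : ℕ) + 0)) -
      (Matrix.of fun i j : Fin n => ((Fin.rev j : ℕ) : MvPolynomial ℕ+ K) *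
        elemSchurInt K (x (Fin.rev i) - ((n : ℤ) - 1) + (j : ℕ))) := by
    ext1 i j
    simp only [jacobiTrudi, Matrix.map_apply, Matrix.of_apply, derZero_elemSchurInt,
      Matrix.sub_apply, Fin.val_rev]
    rw [Nat.cast_sub j.2]
    push_cast
    ring_nf
  rw [altSchur, derivation_det, h, sub_mul, Matrix.trace_sub,
    trace_rowShift K x 0 fun i => (x i : MvPolynomial ℕ+ K), trace_mul_adjugate_eq_sum_col,
    sub_mul, Finset.sum_mul, Finset.sum_mul, ← Equiv.sum_comp Fin.revPerm
      fun i : Fin n => ((i : ℕ) : MvPolynomial ℕ+ K) * _]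
  congr 1
  · simp [altSchur]
  · refine Finset.sum_congr rfl fun j _ => ?_
    refine Eq.trans (Matrix.det_updateCol_smul (jacobiTrudi K x) j
      ((Fin.rev j : ℕ) : MvPolynomial ℕ+ K) fun i => jacobiTrudi K x i j) ?_
    rw [Matrix.updateCol_eq_self]
    rfl

theorem derOne_altSchur (x : Fin n → ℤ) :
    derOne K (altSchur K x) + (n : MvPolynomial ℕ+ K) * MvPolynomial.pderiv 1 (altSchur K x) =
      ∑ i, (x i : MvPolynomial ℕ+ K) * altSchur K (x + Pi.single i (-1)) := by
  -- The factor of each entry is `(x i - n) + j`. The part `j` that depends on the column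
  -- contributes nothing: it vanishes in the first column, and in any other column `j` the shifted
  -- entries are those of the column `j - 1`.
  have h : (jacobiTrudi K x).map (derOne K) =
      (Matrix.of fun i j : Fin n => ((x (Fin.rev i) : MvPolynomial ℕ+ K) - n) *
        elemSchurInt K (x (Fin.rev i) - ((n : ℤ) - 1) + (j : ℕ) + -1)) +
      (Matrix.of fun i j : Fin n => ((j : ℕ) : MvPolynomial ℕ+ K) *
        elemSchurInt K (x (Fin.rev i) - ((n : ℤ) - 1) + (j : ℕ) + -1)) := by
    ext1 i j
    simp only [jacobiTrudi, Matrix.map_apply, Matrix.of_apply, derOne_elemSchurInt,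
      Matrix.add_apply, ← sub_eq_add_neg]
    push_cast
    ring
  have h1 := pderiv_altSchur K 1 x
  rw [PNat.one_coe, Nat.cast_one] at h1
  rw [h1, altSchur, derivation_det, h, add_mul, Matrix.trace_add,
    trace_rowShift K x (-1) fun i => (x i : MvPolynomial ℕ+ K) - n,
    trace_mul_adjugate_eq_sum_col,
    Finset.sum_eq_zero (s := Finset.univ) (f := fun j => Matrix.det _)]
  · rw [add_zero, Finset.mul_sum, ← Finset.sum_add_distrib]
    exact Finset.sum_congr rfl fun i _ => by ring
  · intro j _
    rcases Nat.eq_zero_or_pos (j : ℕ) with hj | hj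
    · refine Matrix.det_eq_zero_of_column_eq_zero j fun i => ?_
      rw [Matrix.updateCol_self, Matrix.of_apply, hj, Nat.cast_zero, zero_mul]
    · have hlt : (j : ℕ) - 1 < n := lt_of_le_of_lt (Nat.sub_le _ _) j.2
      have hcol : ((jacobiTrudi K x).updateCol j fun i =>
          ((j : ℕ) : MvPolynomial ℕ+ K) • jacobiTrudi K x i ⟨j - 1, hlt⟩).det = 0 := by
        have h3 := Matrix.det_updateCol_smul (jacobiTrudi K x) j
          ((j : ℕ) : MvPolynomial ℕ+ K) fun i => jacobiTrudi K x i ⟨j - 1, hlt⟩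
        refine Eq.trans h3 ?_
        have hne : (⟨j - 1, hlt⟩ : Fin n) ≠ j := by
          simp only [ne_eq, Fin.ext_iff]
          omega
        rw [Matrix.det_zero_of_column_eq (i := j) (j := ⟨j - 1, hlt⟩) hne.symm, mul_zero]
        intro i
        rw [Matrix.updateCol_self, Matrix.updateCol_ne hne]
      rw [← hcol]
      congr 2
      funext i
      simp only [jacobiTrudi, Matrix.of_apply, smul_eq_mul]
      congr 2
      rw [Nat.cast_sub hj]
      push_cast
      ring

end AltSchur

/-! ### Positions of partitions -/

section Positions

variable {n : ℕ}

theorem pos_strictMono (lam : Part n) : StrictMono (pos lam) := by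
  intro a b hab
  have h1 := lam.2 (Fin.rev_le_rev.2 hab.le)
  have h2 : (a : ℕ) < b := hab
  simp only [pos]
  omega

/-- Along a strictly increasing sequence of integers, `x i - i` is weakly increasing. -/
theorem sub_val_mono {x : Fin n → ℤ} (hx : StrictMono x) :
    Monotone fun i => x i - ((i : ℕ) : ℤ) := by
  cases n with
  | zero => exact fun a => a.elim0
  | succ n =>
    refine Fin.monotone_iff_le_succ.2 fun i => ?_
    have := hx (Fin.castSucc_lt_succ (i := i))
    simp only [Fin.val_castSucc, Fin.val_succ]
    push_cast
    omega

/-- The positions of partitions are the strictly increasing sequences of nonnegative integers. -/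
theorem exists_pos_eq {x : Fin n → ℤ} (hx : StrictMono x) (h0 : ∀ i, 0 ≤ x i) :
    ∃ lam : Part n, pos lam = x := by
  have hm := sub_val_mono hx
  have hnn : ∀ i, 0 ≤ x i - ((i : ℕ) : ℤ) := by
    intro i
    have hn : 0 < n := i.pos
    have h1 := hm (show (⟨0, hn⟩ : Fin n) ≤ i from Nat.zero_le _)
    have h2 := h0 ⟨0, hn⟩
    simp only [Nat.cast_zero, sub_zero] at h1
    omega
  refine ⟨⟨fun i => (x (Fin.rev i) - ((Fin.rev i : ℕ) : ℤ)).toNat, fun a b hab => ?_⟩, ?_⟩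
  · exact Int.toNat_le_toNat (hm (Fin.rev_le_rev.2 hab))
  · funext i
    have := hnn i
    simp only [pos, Fin.rev_rev]
    omega

/-- If an alternating function takes `y` to one with two entries exchanged whenever `y i + 2 c`
jumps over another entry of `y`, the sum over the jumps by `2 c` splits into the jumps over free
places and the simultaneous moves by `c` of two adjacent entries, which count negatively. -/
theorem sum_jump_eq {M : Type*} [AddCommGroup M] {Φ : (Fin n → ℤ) → M}
    (hΦ : ∀ x a b, a ≠ b → Φ (x ∘ Equiv.swap a b) = -Φ x) {y : Fin n → ℤ}
    (hy : Function.Injective y) {c : ℤ} (hc : c ≠ 0) :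
    ∑ i, Φ (y + Pi.single i (2 * c)) =
      ∑ i, (if ∃ j, y j = y i + c then 0 else Φ (y + Pi.single i (2 * c))) -
        ∑ i, ∑ j, if y j = y i + c then Φ (y + Pi.single i c + Pi.single j c) else 0 := by
  rw [← Finset.sum_sub_distrib]
  refine Finset.sum_congr rfl fun i _ => ?_
  by_cases h : ∃ j, y j = y i + c
  · rw [if_pos h]
    obtain ⟨j, hj⟩ := h
    have hij : i ≠ j := by
      rintro rfl
      omega
    rw [Finset.sum_eq_single j]
    · rw [if_pos hj, zero_sub, ← hΦ _ i j hij]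
      congr 1
      funext k
      simp only [Function.comp, Pi.add_apply, Pi.single_apply]
      rcases eq_or_ne k i with rfl | hki
      · simp [hij.symm, hj]
        ring
      · rcases eq_or_ne k j with rfl | hkj
        · simp [hki, hij, hj]
        · simp [Equiv.swap_apply_of_ne_of_ne hki hkj, hki, hkj]
    · intro k _ hk
      rw [if_neg]
      intro h
      exact hk (hy (h.trans hj.symm))
    · simp
  · rw [if_neg h, Finset.sum_eq_zero, sub_zero]
    intro j _
    rw [if_neg fun hj => h ⟨j, hj⟩]

end Positions

/-! ### Products of two Schur polynomials and the differential operators -/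

section Pairs

variable (K : Type*) [Field K] {n : ℕ}

/-- The embedding of the polynomials in `t`. -/
def inT : MvPolynomial ℕ+ K →ₐ[K] MvPolynomial Var K := MvPolynomial.rename Sum.inl

/-- The embedding `f(t) ↦ f(-s)`. -/
def inNegS : MvPolynomial ℕ+ K →ₐ[K] MvPolynomial Var K :=
  MvPolynomial.aeval fun i : ℕ+ => -(MvPolynomial.X (Sum.inr i) : MvPolynomial Var K)

/-- `s_λ(t) s_μ(-s)` at arbitrary integer positions. -/
def altPair (p : (Fin n → ℤ) × (Fin n → ℤ)) : MvPolynomial Var K :=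
  inT K (altSchur K p.1) * inNegS K (altSchur K p.2)

theorem altPair_pos (lam mu : Part n) :
    (altPair K (pos lam, pos mu) : Series K) = schurPair K lam mu := by
  rw [altPair, altSchur_pos, altSchur_pos]
  rfl

variable {K}

/-- The action of a differential operator on polynomials. -/
def DiffOp.polyOp (D : DiffOp K) (f : MvPolynomial Var K) : MvPolynomial Var K :=
  D none * f + MvPolynomial.mkDerivation K (fun v => D (some v)) f

theorem DiffOp.polyOp_add (D D' : DiffOp K) (f : MvPolynomial Var K) :
    (D + D').polyOp f = D.polyOp f + D'.polyOp f := by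
  have h : MvPolynomial.mkDerivation K (fun v => (D + D') (some v)) =
      MvPolynomial.mkDerivation K (fun v => D (some v)) +
        MvPolynomial.mkDerivation K (fun v => D' (some v)) :=
    MvPolynomial.derivation_ext fun v => by simp [MvPolynomial.mkDerivation_X]
  rw [DiffOp.polyOp, h, Derivation.add_apply, Pi.add_apply, DiffOp.polyOp, DiffOp.polyOp]
  ring

theorem DiffOp.polyOp_smul (c : K) (D : DiffOp K) (f : MvPolynomial Var K) :
    (c • D).polyOp f = c • D.polyOp f := by
  have h : MvPolynomial.mkDerivation K (fun v => (c • D) (some v)) =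
      c • MvPolynomial.mkDerivation K (fun v => D (some v)) :=
    MvPolynomial.derivation_ext fun v => by simp [MvPolynomial.mkDerivation_X]
  rw [DiffOp.polyOp, h, Derivation.smul_apply, Pi.smul_apply, DiffOp.polyOp, smul_add,
    smul_mul_assoc]

/-- A derivation is transported by an algebra morphism as soon as it is on the variables. -/
theorem derivation_algHom (D : Derivation K (MvPolynomial Var K) (MvPolynomial Var K))
    (V : Derivation K (MvPolynomial ℕ+ K) (MvPolynomial ℕ+ K))
    (φ : MvPolynomial ℕ+ K →ₐ[K] MvPolynomial Var K)
    (h : ∀ i, D (φ (MvPolynomial.X i)) = φ (V (MvPolynomial.X i))) (f : MvPolynomial ℕ+ K) :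
    D (φ f) = φ (V f) := by
  induction f using MvPolynomial.induction_on with
  | C a =>
    rw [MvPolynomial.derivation_C, map_zero, ← MvPolynomial.algebraMap_eq, AlgHom.commutes,
      Derivation.map_algebraMap]
  | add f g hf hg => simp only [map_add, hf, hg]
  | mul_X f i hf => simp only [map_mul, Derivation.leibniz, smul_eq_mul, map_add, hf, h]

/-- `D` acts on products `f(t) g(-s)` through the operator `V` on the first factor. -/
def ActsOnT (D : DiffOp K) (V : MvPolynomial ℕ+ K → MvPolynomial ℕ+ K) : Prop :=
  ∀ f g, D.polyOp (inT K f * inNegS K g) = inT K (V f) * inNegS K g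

/-- `D` acts on products `f(t) g(-s)` through the operator `V` on the second factor. -/
def ActsOnS (D : DiffOp K) (V : MvPolynomial ℕ+ K → MvPolynomial ℕ+ K) : Prop :=
  ∀ f g, D.polyOp (inT K f * inNegS K g) = inT K f * inNegS K (V g)

theorem ActsOnT.add {D D' : DiffOp K} {V V' : MvPolynomial ℕ+ K → MvPolynomial ℕ+ K}
    (h : ActsOnT D V) (h' : ActsOnT D' V') : ActsOnT (D + D') fun f => V f + V' f := by
  intro f g
  rw [DiffOp.polyOp_add, h, h', map_add, add_mul]

theorem ActsOnS.add {D D' : DiffOp K} {V V' : MvPolynomial ℕ+ K → MvPolynomial ℕ+ K}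
    (h : ActsOnS D V) (h' : ActsOnS D' V') : ActsOnS (D + D') fun f => V f + V' f := by
  intro f g
  rw [DiffOp.polyOp_add, h, h', map_add, mul_add]

theorem ActsOnT.smul {D : DiffOp K} {V : MvPolynomial ℕ+ K → MvPolynomial ℕ+ K}
    (h : ActsOnT D V) (c : K) : ActsOnT (c • D) fun f => c • V f := by
  intro f g
  rw [DiffOp.polyOp_smul, h, map_smul, smul_mul_assoc]

theorem ActsOnS.smul {D : DiffOp K} {V : MvPolynomial ℕ+ K → MvPolynomial ℕ+ K}
    (h : ActsOnS D V) (c : K) : ActsOnS (c • D) fun f => c • V f := by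
  intro f g
  rw [DiffOp.polyOp_smul, h, map_smul, mul_smul_comm]

theorem actsOnT_alongT {c : ℕ+ → MvPolynomial Var K}
    (V : Derivation K (MvPolynomial ℕ+ K) (MvPolynomial ℕ+ K))
    (h : ∀ i, c i = inT K (V (MvPolynomial.X i))) : ActsOnT (alongT c) V := by
  intro f g
  have h1 := derivation_algHom (MvPolynomial.mkDerivation K fun v => alongT c (some v)) V (inT K)
    (fun i => by rw [inT, MvPolynomial.rename_X, MvPolynomial.mkDerivation_X, alongT, h, inT]) f
  have h2 := derivation_algHom (MvPolynomial.mkDerivation K fun v => alongT c (some v)) 0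
    (inNegS K) (fun i => by
      rw [inNegS, MvPolynomial.aeval_X, map_neg, MvPolynomial.mkDerivation_X]
      simp [alongT]) g
  rw [DiffOp.polyOp, Derivation.leibniz, h1, h2]
  simp [alongT, mul_comm]

theorem actsOnS_alongS {c : ℕ+ → MvPolynomial Var K}
    (V : Derivation K (MvPolynomial ℕ+ K) (MvPolynomial ℕ+ K))
    (h : ∀ i, c i = -inNegS K (V (MvPolynomial.X i))) : ActsOnS (alongS c) V := by
  intro f g
  have h1 := derivation_algHom (MvPolynomial.mkDerivation K fun v => alongS c (some v)) V
    (inNegS K) (fun i => by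
      rw [inNegS, MvPolynomial.aeval_X, map_neg, MvPolynomial.mkDerivation_X, alongS, h, inNegS,
        neg_neg]) g
  have h2 := derivation_algHom (MvPolynomial.mkDerivation K fun v => alongS c (some v)) 0
    (inT K) (fun i => by
      rw [inT, MvPolynomial.rename_X, MvPolynomial.mkDerivation_X]
      simp [alongS]) f
  rw [DiffOp.polyOp, Derivation.leibniz, h1, h2]
  simp [alongS]

theorem partialVar_inl_eq (a : ℕ+) :
    (partialVar (Sum.inl a) : DiffOp K) = alongT (Pi.single a 1) := by
  funext o
  rcases o with _ | i | i <;> simp [partialVar, alongT, Pi.single_apply]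

theorem partialVar_inr_eq (a : ℕ+) :
    (partialVar (Sum.inr a) : DiffOp K) = alongS (Pi.single a 1) := by
  funext o
  rcases o with _ | i | i <;> simp [partialVar, alongS, Pi.single_apply]

theorem actsOnT_partialVar (a : ℕ+) :
    ActsOnT (partialVar (Sum.inl a) : DiffOp K) (MvPolynomial.pderiv a) := by
  rw [partialVar_inl_eq]
  refine actsOnT_alongT _ fun i => ?_
  rw [MvPolynomial.pderiv_X, Pi.single_apply, Pi.single_apply]
  simp only [eq_comm, apply_ite (inT K), map_one, map_zero]

theorem actsOnS_partialVar (a : ℕ+) :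
    ActsOnS (partialVar (Sum.inr a) : DiffOp K) (-MvPolynomial.pderiv a) := by
  rw [partialVar_inr_eq]
  refine actsOnS_alongS (-MvPolynomial.pderiv a) fun i => ?_
  rw [Derivation.neg_apply, MvPolynomial.pderiv_X, Pi.single_apply, Pi.single_apply, map_neg,
    neg_neg]
  simp only [eq_comm, apply_ite (inNegS K), map_one, map_zero]

theorem polyOp_mulVar (v : Var) (f : MvPolynomial Var K) :
    (mulVar v : DiffOp K).polyOp f = MvPolynomial.X v * f := by
  have h : MvPolynomial.mkDerivation K (fun w => (mulVar v : DiffOp K) (some w)) = 0 :=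
    MvPolynomial.derivation_ext fun w => by simp [MvPolynomial.mkDerivation_X, mulVar]
  rw [DiffOp.polyOp, h]
  simp [mulVar]

theorem actsOnT_mulVar (a : ℕ+) :
    ActsOnT (mulVar (Sum.inl a) : DiffOp K) fun f => MvPolynomial.X a * f := by
  intro f g
  rw [polyOp_mulVar, map_mul, inT, MvPolynomial.rename_X, mul_assoc]

theorem actsOnS_mulVar (a : ℕ+) :
    ActsOnS (mulVar (Sum.inr a) : DiffOp K) fun f => -(MvPolynomial.X a * f) := by
  intro f g
  rw [polyOp_mulVar, map_neg, map_mul, inNegS, MvPolynomial.aeval_X]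
  ring

theorem actsOnT_virZero : ActsOnT (alongT (virZero Sum.inl) : DiffOp K) (derZero K) :=
  actsOnT_alongT _ fun i => by
    simp [virZero, derZero, MvPolynomial.mkDerivation_X, inT]

theorem actsOnS_virZero : ActsOnS (alongS (virZero Sum.inr) : DiffOp K) (derZero K) :=
  actsOnS_alongS _ fun i => by
    simp [virZero, derZero, MvPolynomial.mkDerivation_X, inNegS]

theorem actsOnT_virMinusOne :
    ActsOnT (alongT (virMinusOne Sum.inl) : DiffOp K) (derMinusOne K) :=
  actsOnT_alongT _ fun i => by
    simp [virMinusOne, derMinusOne, MvPolynomial.mkDerivation_X, inT]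

theorem actsOnS_virMinusOne :
    ActsOnS (alongS (virMinusOne Sum.inr) : DiffOp K) (derMinusOne K) :=
  actsOnS_alongS _ fun i => by
    simp [virMinusOne, derMinusOne, MvPolynomial.mkDerivation_X, inNegS]

theorem actsOnT_virOne : ActsOnT (alongT (virOne Sum.inl) : DiffOp K) (derOne K) :=
  actsOnT_alongT _ fun i => by
    simp [virOne, derOne, MvPolynomial.mkDerivation_X, inT, apply_ite (MvPolynomial.rename _)]

theorem actsOnS_virOne : ActsOnS (alongS (virOne Sum.inr) : DiffOp K) (derOne K) :=
  actsOnS_alongS _ fun i => by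
    rw [virOne, derOne, MvPolynomial.mkDerivation_X]
    split_ifs <;> simp [inNegS]

theorem derivation_sum_apply (s : Finset Var)
    (D : Var → Derivation K (MvPolynomial Var K) (MvPolynomial Var K)) (f : MvPolynomial Var K) :
    (∑ v ∈ s, D v) f = ∑ v ∈ s, D v f := by
  have h := map_sum (Derivation.coeFnAddMonoidHom (R := K) (A := MvPolynomial Var K)
    (M := MvPolynomial Var K)) D s
  exact (congrFun h f).trans (Finset.sum_apply f s _)

/-- The terms of a differential operator applied to a power series. -/
def DiffOp.seriesTerm (D : DiffOp K) (F : Series K) : Option Var → Series K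
  | none => (D none : Series K) * F
  | some v => (D (some v) : Series K) * MvPowerSeries.pderiv K v F

/-- On a polynomial `f` only the derivatives with respect to the variables of `f` contribute, so a
differential operator with infinitely many terms acts. -/
theorem isFormalSum_seriesTerm (D : DiffOp K) (f : MvPolynomial Var K) :
    IsFormalSum (D.seriesTerm (f : Series K)) (D.polyOp f : Series K) := by
  classical
  have hz : ∀ v ∉ f.vars, MvPolynomial.pderiv v f = 0 := fun v hv =>
    MvPolynomial.pderiv_eq_zero_of_notMem_vars hv
  have hd : MvPolynomial.mkDerivation K (fun v => D (some v)) f =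
      ∑ v ∈ f.vars, D (some v) * MvPolynomial.pderiv v f := by
    have h : MvPolynomial.mkDerivation K (fun v => D (some v)) f =
        (∑ v ∈ f.vars, D (some v) • MvPolynomial.pderiv v :
          Derivation K (MvPolynomial Var K) (MvPolynomial Var K)) f := by
      refine MvPolynomial.derivation_eq_of_forall_mem_vars fun w hw => ?_
      rw [MvPolynomial.mkDerivation_X, derivation_sum_apply,
        Finset.sum_eq_single_of_mem w hw]
      · simp
      · intro v _ hv
        simp [MvPolynomial.pderiv_X_of_ne hv.symm]
    rw [h, derivation_sum_apply]
    rfl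
  have h2 : (D.polyOp f : Series K) =
      ∑ o ∈ insert none (f.vars.map Function.Embedding.some), D.seriesTerm (f : Series K) o := by
    rw [Finset.sum_insert (by simp), Finset.sum_map, DiffOp.polyOp, hd]
    simp only [MvPolynomial.coe_add, MvPolynomial.coe_mul, DiffOp.seriesTerm,
      Function.Embedding.some_apply, MvPowerSeries.pderiv_coe]
    congr 1
    rw [← MvPolynomial.coeToMvPowerSeries.ringHom_apply, map_sum]
    simp
  rw [h2]
  refine isFormalSum_of_finset _ fun o ho => ?_
  rcases o with _ | v
  · simp at ho
  · have hv : v ∉ f.vars := by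
      intro hv
      apply ho
      simp [hv]
    rw [DiffOp.seriesTerm, MvPowerSeries.pderiv_coe, hz v hv]
    simp

/-- The derivation `∑ w_v v ∂/∂v` multiplies each monomial by its weight. -/
theorem coeff_mkDerivation_diag (w : Var → ℕ) (f : MvPolynomial Var K) (m : Var →₀ ℕ) :
    MvPolynomial.coeff m (MvPolynomial.mkDerivation K
      (fun v => MvPolynomial.C ((w v : ℕ) : K) * MvPolynomial.X v) f) =
      ((m.sum fun v a => a * w v : ℕ) : K) * MvPolynomial.coeff m f := by
  classical
  induction f using MvPolynomial.induction_on' with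
  | add p q hp hq => rw [map_add, MvPolynomial.coeff_add, hp, hq, MvPolynomial.coeff_add, mul_add]
  | monomial u a =>
    have h : MvPolynomial.mkDerivation K
        (fun v => MvPolynomial.C ((w v : ℕ) : K) * MvPolynomial.X v)
          (MvPolynomial.monomial u a) =
        MvPolynomial.monomial u (((u.sum fun v a => a * w v : ℕ) : K) * a) := by
      rw [MvPolynomial.mkDerivation_monomial, Finsupp.sum, Finsupp.sum, Finset.smul_sum,
        Nat.cast_sum, Finset.sum_mul, map_sum]
      refine Finset.sum_congr rfl fun v hv => ?_
      have h1 : u - Finsupp.single v 1 + Finsupp.single v 1 = u := by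
        refine tsub_add_cancel_of_le ?_
        rw [Finsupp.single_le_iff]
        exact Nat.one_le_iff_ne_zero.2 (Finsupp.mem_support_iff.1 hv)
      rw [smul_eq_mul, MvPolynomial.X, MvPolynomial.C_mul_monomial, MvPolynomial.monomial_mul,
        h1, MvPolynomial.smul_monomial]
      congr 1
      push_cast
      rw [smul_eq_mul]
      ring
    rw [h, MvPolynomial.coeff_monomial, MvPolynomial.coeff_monomial]
    split_ifs with h1
    · rw [h1]
    · simp

end Pairs

/-! ### Double Schur series -/

section DoubleSeries

variable {K : Type*} [Field K] {n : ℕ}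

theorem posPair_injective :
    Function.Injective fun p : Part n × Part n => (pos p.1, pos p.2) := fun _ _ h =>
  Prod.ext (pos_injective (congrArg Prod.fst h)) (pos_injective (congrArg Prod.snd h))

theorem toPos_of_notMem (b : ℤ → Part n → Part n → K) (k : ℤ)
    {p : (Fin n → ℤ) × (Fin n → ℤ)}
    (hp : p ∉ Set.range fun p : Part n × Part n => (pos p.1, pos p.2)) :
    toPos b k p.1 p.2 = 0 :=
  Function.extend_apply' _ _ _ hp

variable [CharZero K]

theorem derZero_altSchur_pos (lam : Part n) :
    derZero K (altSchur K (pos lam)) = ((∑ i, lam.1 i : ℕ) : K) • altSchur K (pos lam) := by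
  rw [derZero_altSchur, MvPolynomial.smul_eq_C_mul, map_natCast]
  congr 1
  rw [← Finset.sum_sub_distrib, ← Equiv.sum_comp Fin.revPerm lam.1, Nat.cast_sum]
  refine Finset.sum_congr rfl fun i _ => ?_
  simp [pos]

/-- `s_λ(t) s_μ(-s)` is homogeneous of degree `|λ| + |μ|` for the weights `i` of `t_i` and
`s_i`. -/
theorem weight_eq_of_coeff_schurPair_ne_zero {lam mu : Part n} {m : Var →₀ ℕ}
    (h : MvPowerSeries.coeff m (schurPair K lam mu) ≠ 0) :
    (m.sum fun v a => a * Sum.elim (fun i : ℕ+ => (i : ℕ)) (fun i : ℕ+ => (i : ℕ)) v) =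
      ∑ i, lam.1 i + ∑ i, mu.1 i := by
  have h1 := coeff_mkDerivation_diag (K := K)
    (Sum.elim (fun i : ℕ+ => (i : ℕ)) (fun i : ℕ+ => (i : ℕ)))
    (altPair K (pos lam, pos mu)) m
  have h2 : MvPolynomial.mkDerivation K (fun v => MvPolynomial.C (((Sum.elim
      (fun i : ℕ+ => (i : ℕ)) (fun i : ℕ+ => (i : ℕ)) v : ℕ)) : K) * MvPolynomial.X v)
        (altPair K (pos lam, pos mu)) =
      (alongT (virZero Sum.inl) + alongS (virZero Sum.inr) : DiffOp K).polyOp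
        (altPair K (pos lam, pos mu)) := by
    rw [DiffOp.polyOp]
    have h3 : (alongT (virZero Sum.inl) + alongS (virZero Sum.inr) : DiffOp K) none = 0 := by
      simp [alongT, alongS]
    rw [h3, zero_mul, zero_add]
    congr 2
    funext v
    rcases v with i | i <;> simp [alongT, alongS, virZero]
  rw [h2, DiffOp.polyOp_add, altPair, actsOnT_virZero, actsOnS_virZero, derZero_altSchur_pos,
    derZero_altSchur_pos, map_smul, map_smul, smul_mul_assoc, mul_smul_comm, ← add_smul,
    MvPolynomial.coeff_smul, smul_eq_mul] at h1
  rw [← altPair_pos, MvPolynomial.coeff_coe] at h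
  have h4 := mul_right_cancel₀ h h1
  exact_mod_cast h4.symm

/-- Each monomial occurs in only finitely many products, as its weight bounds the partitions. -/
theorem finite_schurPair_coeff_ne_zero (m : Var →₀ ℕ) :
    {p : Part n × Part n | MvPowerSeries.coeff m (schurPair K p.1 p.2) ≠ 0}.Finite := by
  set N := m.sum fun v a => a * Sum.elim (fun i : ℕ+ => (i : ℕ)) (fun i : ℕ+ => (i : ℕ)) v
    with hN
  have hfin : (Set.Iic (fun _ => N) ×ˢ Set.Iic (fun _ => N) :
      Set ((Fin n → ℕ) × (Fin n → ℕ))).Finite :=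
    (Set.finite_Iic _).prod (Set.finite_Iic _)
  refine (hfin.preimage (f := fun p : Part n × Part n => (p.1.1, p.2.1)) ?_).subset ?_
  · intro p _ p' _ h
    exact Prod.ext (Subtype.ext (congrArg Prod.fst h)) (Subtype.ext (congrArg Prod.snd h))
  · intro p hp
    have h1 := weight_eq_of_coeff_schurPair_ne_zero hp
    refine ⟨fun i => ?_, fun i => ?_⟩
    · have := Finset.single_le_sum (f := p.1.1) (fun _ _ => Nat.zero_le _) (Finset.mem_univ i)
      simp only
      omega
    · have := Finset.single_le_sum (f := p.2.1) (fun _ _ => Nat.zero_le _) (Finset.mem_univ i)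
      simp only
      omega

theorem isFormalSum_doubleSeries (b : ℤ → Part n → Part n → K) (k : ℤ) :
    IsFormalSum (fun p : Part n × Part n => b k p.1 p.2 • schurPair K p.1 p.2)
      (doubleSeries b k) := by
  intro m
  refine ⟨(finite_schurPair_coeff_ne_zero (K := K) m).subset fun p hp => ?_, ?_⟩
  · intro h
    apply hp
    simp [h]
  · simp only [map_smul, smul_eq_mul]
    rfl

/-- A family of coefficients indexed by positions may be summed over all positions as soon as the
terms at positions that do not come from partitions vanish. -/
theorem isFormalSum_altPair (g : ℤ → (Fin n → ℤ) → (Fin n → ℤ) → K) (k : ℤ)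
    (hg : ∀ p : (Fin n → ℤ) × (Fin n → ℤ),
      p ∉ (Set.range fun p : Part n × Part n => (pos p.1, pos p.2)) →
      g k p.1 p.2 • (altPair K p : Series K) = 0) :
    IsFormalSum (fun p : (Fin n → ℤ) × (Fin n → ℤ) => g k p.1 p.2 • (altPair K p : Series K))
      (doubleSeries (fun k lam mu => g k (pos lam) (pos mu)) k) := by
  rw [← isFormalSum_comp_iff posPair_injective hg]
  simp only [altPair_pos]
  exact isFormalSum_doubleSeries (fun k lam mu => g k (pos lam) (pos mu)) k

theorem isFormalSum_toPos (b : ℤ → Part n → Part n → K) (k : ℤ) :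
    IsFormalSum (fun p : (Fin n → ℤ) × (Fin n → ℤ) =>
      toPos b k p.1 p.2 • (altPair K p : Series K)) (doubleSeries b k) := by
  have h := isFormalSum_altPair (toPos b) k fun p hp => by rw [toPos_of_notMem b k hp, zero_smul]
  simpa only [toPos_pos] using h

theorem doubleSeries_add (b b' : ℤ → Part n → Part n → K) (k : ℤ) :
    doubleSeries (fun k lam mu => b k lam mu + b' k lam mu) k =
      doubleSeries b k + doubleSeries b' k := by
  refine (isFormalSum_doubleSeries _ k).unique ?_
  simpa only [add_smul] using (isFormalSum_doubleSeries b k).add (isFormalSum_doubleSeries b' k)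

theorem doubleSeries_smul (c : K) (b b' : ℤ → Part n → Part n → K) (k k' : ℤ)
    (h : ∀ lam mu, b' k' lam mu = c * b k lam mu) :
    doubleSeries b' k' = c • doubleSeries b k := by
  refine (isFormalSum_doubleSeries _ k').unique ?_
  simpa only [h, mul_smul] using (isFormalSum_doubleSeries b k).smul c

end DoubleSeries

/-! ### Operators acting on double Schur series -/

section Translation

variable {K : Type*} [Field K] {R : Type*} [CommRing R] [Algebra K R] {n : ℕ}

theorem polyAct_eq_sum (ρ : R →ₐ[K] Module.End K (ℤ → Series K)) (P : MvPolynomial Var R)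
    (F : ℤ → Series K) (k : ℤ) {s : Finset (Var →₀ ℕ)} (hs : P.support ⊆ s) :
    polyAct ρ P F k = ∑ m ∈ s, MvPowerSeries.monomial m (1 : K) * ρ (P.coeff m) F k := by
  refine Finset.sum_subset hs fun m _ hm => ?_
  rw [MvPolynomial.notMem_support_iff.1 hm, map_zero]
  simp

theorem polyAct_add (ρ : R →ₐ[K] Module.End K (ℤ → Series K)) (P Q : MvPolynomial Var R)
    (F : ℤ → Series K) (k : ℤ) :
    polyAct ρ (P + Q) F k = polyAct ρ P F k + polyAct ρ Q F k := by
  classical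
  rw [polyAct_eq_sum ρ (P + Q) F k MvPolynomial.support_add,
    polyAct_eq_sum ρ P F k (Finset.subset_union_left (s₂ := Q.support)),
    polyAct_eq_sum ρ Q F k (Finset.subset_union_right (s₁ := P.support)),
    ← Finset.sum_add_distrib]
  refine Finset.sum_congr rfl fun m _ => ?_
  rw [MvPolynomial.coeff_add, map_add, ← mul_add]
  rfl

theorem polyAct_smul (ρ : R →ₐ[K] Module.End K (ℤ → Series K)) (r : R) (P : MvPolynomial Var R)
    (F : ℤ → Series K) (k : ℤ) : polyAct ρ (r • P) F k = polyAct ρ P (ρ r F) k := by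
  rw [polyAct_eq_sum ρ (r • P) F k MvPolynomial.support_smul, polyAct]
  refine Finset.sum_congr rfl fun m _ => ?_
  rw [MvPolynomial.coeff_smul, smul_eq_mul, mul_comm r, map_mul]
  rfl

theorem polyAct_map (ρ : R →ₐ[K] Module.End K (ℤ → Series K)) (P : MvPolynomial Var K)
    (F : ℤ → Series K) (k : ℤ) :
    polyAct ρ (MvPolynomial.map (algebraMap K R) P) F k = (P : Series K) * F k := by
  classical
  rw [polyAct_eq_sum ρ _ F k (MvPolynomial.support_map_subset _ _)]
  have h : (P : Series K) = ∑ m ∈ P.support, MvPowerSeries.monomial m (P.coeff m) := by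
    conv_lhs => rw [P.as_sum]
    rw [← MvPolynomial.coeToMvPowerSeries.ringHom_apply, map_sum]
    simp
  rw [h, Finset.sum_mul]
  refine Finset.sum_congr rfl fun m _ => ?_
  rw [MvPolynomial.coeff_map, AlgHom.commutes, Module.algebraMap_end_apply, Pi.smul_apply,
    mul_smul_comm, ← smul_mul_assoc]
  congr 1
  rw [← map_smul, smul_eq_mul, mul_one]

variable (R) in
/-- A differential operator over `K` regarded as an operator over a `K`-algebra. -/
def DiffOp.baseChange (D : DiffOp K) : DiffOp R := fun o =>
  MvPolynomial.map (algebraMap K R) (D o)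

theorem term_baseChange (ρ : R →ₐ[K] Module.End K (ℤ → Series K)) (D : DiffOp K)
    (F : ℤ → Series K) (o : Option Var) (k : ℤ) :
    (D.baseChange R).term ρ F o k = D.seriesTerm (F k) o := by
  rcases o with _ | v
  · exact polyAct_map ρ _ _ _
  · exact polyAct_map ρ _ _ _

/-- The operator on coefficients only matters on strictly increasing `x` and `y` and on coefficients
that vanish elsewhere. -/
theorem Translates.congr {ρ : R →ₐ[K] Module.End K (ℤ → Series K)} {D D' : DiffOp R}
    {L L' : (ℤ → (Fin n → ℤ) → (Fin n → ℤ) → K) → ℤ → (Fin n → ℤ) → (Fin n → ℤ) → K}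
    (h : Translates ρ D L) (hD : D' = D)
    (hL : ∀ B, (∀ k x y, ¬ (StrictMono x ∧ StrictMono y) → B k x y = 0) →
      ∀ k x y, StrictMono x → StrictMono y → L' B k x y = L B k x y) :
    Translates ρ D' L' := by
  intro b
  have hb : (fun k (lam mu : Part n) => L' (toPos b) k (pos lam) (pos mu)) =
      fun k lam mu => L (toPos b) k (pos lam) (pos mu) := by
    funext k lam mu
    refine hL _ (fun k x y hxy => toPos_of_notMem b k (p := (x, y)) ?_) _ _ _ (pos_strictMono lam)
      (pos_strictMono mu)
    rintro ⟨p, hp⟩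
    obtain ⟨rfl, rfl⟩ := Prod.ext_iff.1 hp
    exact hxy ⟨pos_strictMono _, pos_strictMono _⟩
  rw [hD, hb]
  exact h b

/-- For every monomial only finitely many coefficients of the operator contain a monomial
dividing it. -/
def DiffOp.LocallyFinite (D : DiffOp K) : Prop :=
  ∀ m : Var →₀ ℕ, {o | ∃ a ∈ (D o).support, a ≤ m}.Finite

theorem DiffOp.LocallyFinite.seriesTerm {D : DiffOp K} (hD : D.LocallyFinite) {ι : Type*}
    (F : ι → Series K) (m : Var →₀ ℕ) :
    {o | ∃ i, MvPowerSeries.coeff m (D.seriesTerm (F i) o) ≠ 0}.Finite := by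
  classical
  have key : ∀ (P : MvPolynomial Var K) (G : Series K),
      MvPowerSeries.coeff m ((P : Series K) * G) ≠ 0 → ∃ a ∈ P.support, a ≤ m := by
    intro P G h
    rw [MvPowerSeries.coeff_mul] at h
    obtain ⟨p, hp, hne⟩ := Finset.exists_ne_zero_of_sum_ne_zero h
    refine ⟨p.1, MvPolynomial.mem_support_iff.2 fun h0 => hne ?_,
      Finset.HasAntidiagonal.antidiagonal.fst_le hp⟩
    rw [MvPolynomial.coeff_coe, h0, zero_mul]
  refine (hD m).subset ?_
  rintro o ⟨i, hi⟩
  rcases o with _ | v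
  · exact key _ _ hi
  · exact key _ _ hi

variable [CharZero K]

theorem Translates.add {ρ : R →ₐ[K] Module.End K (ℤ → Series K)} {D D' : DiffOp R}
    {L L' : (ℤ → (Fin n → ℤ) → (Fin n → ℤ) → K) → ℤ → (Fin n → ℤ) → (Fin n → ℤ) → K}
    (h : Translates ρ D L) (h' : Translates ρ D' L') :
    Translates ρ (D + D') fun B k x y => L B k x y + L' B k x y := by
  intro b k
  rw [doubleSeries_add (fun k lam mu => L (toPos b) k (pos lam) (pos mu))
    (fun k lam mu => L' (toPos b) k (pos lam) (pos mu))]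
  have := (h b k).add (h' b k)
  convert this using 2 with o
  rcases o with _ | v
  · exact polyAct_add ρ _ _ _ _
  · exact polyAct_add ρ _ _ _ _

theorem Translates.const_smul {ρ : R →ₐ[K] Module.End K (ℤ → Series K)} {D : DiffOp R}
    {L : (ℤ → (Fin n → ℤ) → (Fin n → ℤ) → K) → ℤ → (Fin n → ℤ) → (Fin n → ℤ) → K}
    (h : Translates ρ D L) (c : K) : Translates ρ (c • D) fun B k x y => c * L B k x y := by
  have hpoly : ∀ (P : MvPolynomial Var R) (F : ℤ → Series K) (k : ℤ),
      polyAct ρ (c • P) F k = c • polyAct ρ P F k := by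
    intro P F k
    rw [polyAct_eq_sum ρ (c • P) F k MvPolynomial.support_smul, polyAct, Finset.smul_sum]
    refine Finset.sum_congr rfl fun m _ => ?_
    rw [MvPolynomial.coeff_smul, map_smul, ← mul_smul_comm]
    rfl
  intro b k
  have h1 := (h b k).smul c
  rw [← doubleSeries_smul c (fun k lam mu => L (toPos b) k (pos lam) (pos mu))
    (fun k lam mu => c * L (toPos b) k (pos lam) (pos mu)) k k fun _ _ => rfl] at h1
  convert h1 using 2 with o
  rcases o with _ | v
  · exact hpoly _ _ _
  · exact hpoly _ _ _

/-- Multiplication of a differential operator by a scalar `r` that acts on functions of `k` by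
`F ↦ (k ↦ c k F(k - j))`. -/
theorem Translates.smul {ρ : R →ₐ[K] Module.End K (ℤ → Series K)} {D : DiffOp R}
    {L : (ℤ → (Fin n → ℤ) → (Fin n → ℤ) → K) → ℤ → (Fin n → ℤ) → (Fin n → ℤ) → K}
    (h : Translates ρ D L) {r : R} {c : ℤ → K} {j : ℤ}
    (hr : ∀ F k, ρ r F k = c k • F (k - j)) :
    Translates ρ (r • D) fun B => L fun k x y => c k * B (k - j) x y := by
  intro b k
  have hb : toPos (fun k lam mu => c k * b (k - j) lam mu) =
      fun k x y => c k * toPos b (k - j) x y := by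
    funext k x y
    by_cases hp : (x, y) ∈ Set.range fun p : Part n × Part n => (pos p.1, pos p.2)
    · obtain ⟨p, hp⟩ := hp
      obtain ⟨rfl, rfl⟩ := Prod.ext_iff.1 hp
      simp only [toPos_pos]
    · rw [toPos_of_notMem _ k hp, toPos_of_notMem b (k - j) hp, mul_zero]
  have h1 := h (fun k lam mu => c k * b (k - j) lam mu) k
  rw [hb] at h1
  have h2 : ρ r (doubleSeries b) = doubleSeries fun k lam mu => c k * b (k - j) lam mu := by
    funext k
    rw [hr]
    exact (doubleSeries_smul (c k) b _ (k - j) k fun _ _ => rfl).symm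
  convert h1 using 2 with o
  rcases o with _ | v
  · rw [DiffOp.term, DiffOp.term, Pi.smul_apply, polyAct_smul, h2]
  · rw [DiffOp.term, DiffOp.term, Pi.smul_apply, polyAct_smul, ← h2]
    congr 1
    funext k
    rw [hr, hr, Derivation.map_smul]

/-- If `D` maps each `s_λ(t) s_μ(-s)` to a combination of such products at shifted positions,
then it translates into the transposed operator on coefficients. Sums over positions are taken
over all integer vectors, so that the transposition is a translation of the summation index;
the hypothesis `hoff` says that no positions outside the partitions contribute. -/
theorem translates_of_shift (ρ : R →ₐ[K] Module.End K (ℤ → Series K)) {D : DiffOp K}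
    (hD : D.LocallyFinite) {α : Type*} [Fintype α]
    (c : α → (Fin n → ℤ) × (Fin n → ℤ) → K) (u : α → (Fin n → ℤ) × (Fin n → ℤ))
    (hact : ∀ lam mu : Part n, D.polyOp (altPair K (pos lam, pos mu)) =
      ∑ a, c a (pos lam, pos mu) • altPair K ((pos lam, pos mu) + u a))
    (hoff : ∀ a (lam mu : Part n), c a (pos lam, pos mu) ≠ 0 →
      (pos lam, pos mu) + u a ∉ (Set.range fun p : Part n × Part n => (pos p.1, pos p.2)) →
      altPair K ((pos lam, pos mu) + u a) = 0) :
    Translates ρ (D.baseChange R) fun B k x y =>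
      ∑ a, c a ((x, y) - u a) * B k (x - (u a).1) (y - (u a).2) := by
  intro b k
  have hzero : ∀ a p, toPos b k (p - u a).1 (p - u a).2 * c a (p - u a) ≠ 0 →
      p ∉ (Set.range fun p : Part n × Part n => (pos p.1, pos p.2)) →
      altPair K p = 0 := by
    intro a p hne hp
    have h1 : p - u a ∈ Set.range fun p : Part n × Part n => (pos p.1, pos p.2) := by
      by_contra h
      exact hne (by rw [toPos_of_notMem b k h, zero_mul])
    obtain ⟨q, hq⟩ := h1
    have h2 : p = (pos q.1, pos q.2) + u a := by
      rw [← sub_add_cancel p (u a), ← hq]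
    rw [h2]
    refine hoff a q.1 q.2 (fun h0 => hne ?_) (by rwa [← h2])
    rw [← hq]
    simp only [h0, mul_zero]
  simp only [term_baseChange]
  -- `D` is applied to each summand first; `H p` is the result for the summand `p`.
  refine IsFormalSum.swap (ι := (Fin n → ℤ) × (Fin n → ℤ))
    (f := fun o p => toPos b k p.1 p.2 • D.seriesTerm (altPair K p : Series K) o)
    (H := fun p => ∑ a, (toPos b k p.1 p.2 * c a p) • (altPair K (p + u a) : Series K))
    ?_ ?_ ?_ ?_
  · intro o
    have h := isFormalSum_toPos b k
    rcases o with _ | v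
    · simpa only [DiffOp.seriesTerm, mul_smul_comm] using h.mul_left (D none : Series K)
    · have h1 := (h.pderiv v).mul_left (D (some v) : Series K)
      simpa only [DiffOp.seriesTerm, Derivation.map_smul, mul_smul_comm] using h1
  · intro p
    by_cases hp : p ∈ Set.range fun p : Part n × Part n => (pos p.1, pos p.2)
    · obtain ⟨q, rfl⟩ := hp
      have h := (isFormalSum_seriesTerm D (altPair K (pos q.1, pos q.2))).smul
        (toPos b k (pos q.1) (pos q.2))
      have h2 : (D.polyOp (altPair K (pos q.1, pos q.2)) : Series K) =
          ∑ a, c a (pos q.1, pos q.2) • (altPair K ((pos q.1, pos q.2) + u a) : Series K) := by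
        rw [hact, ← MvPolynomial.coeToMvPowerSeries.ringHom_apply, map_sum]
        refine Finset.sum_congr rfl fun a _ => ?_
        rw [MvPolynomial.coeToMvPowerSeries.ringHom_apply, MvPolynomial.coe_smul]
      rw [h2, Finset.smul_sum] at h
      simpa only [mul_smul] using h
    · simp only [toPos_of_notMem b k hp, zero_smul, zero_mul, Finset.sum_const_zero]
      exact isFormalSum_zero
  · intro m
    refine (hD.seriesTerm (fun p : (Fin n → ℤ) × (Fin n → ℤ) => (altPair K p : Series K)) m).subset ?_
    rintro o ⟨p, hp⟩
    refine ⟨p, fun h0 => hp ?_⟩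
    rw [map_smul, h0, smul_zero]
  · have hg : ∀ p : (Fin n → ℤ) × (Fin n → ℤ),
        (∑ a, c a ((p.1, p.2) - u a) * toPos b k (p.1 - (u a).1) (p.2 - (u a).2)) •
          (altPair K p : Series K) =
        ∑ a, (toPos b k (p - u a).1 (p - u a).2 * c a (p - u a)) • (altPair K p : Series K) := by
      intro p
      rw [Finset.sum_smul]
      exact Finset.sum_congr rfl fun a _ => by rw [mul_comm]; rfl
    have h := isFormalSum_altPair (fun k x y =>
      ∑ a, c a ((x, y) - u a) * toPos b k (x - (u a).1) (y - (u a).2)) k fun p hp => by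
        rw [hg]
        refine Finset.sum_eq_zero fun a _ => ?_
        by_cases h0 : toPos b k (p - u a).1 (p - u a).2 * c a (p - u a) = 0
        · rw [h0, zero_smul]
        · rw [hzero a p h0 hp]
          simp
    -- Each summand `a` is reindexed by the translation by `u a`.
    have hzs : ∀ a (p : (Fin n → ℤ) × (Fin n → ℤ)),
        p ∉ (Set.range fun p : Part n × Part n => (pos p.1, pos p.2)) →
        (toPos b k (p - u a).1 (p - u a).2 * c a (p - u a)) • (altPair K p : Series K) = 0 := by
      intro a p hp
      by_cases h0 : toPos b k (p - u a).1 (p - u a).2 * c a (p - u a) = 0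
      · rw [h0, zero_smul]
      · rw [hzero a p h0 hp]
        simp
    have hsum := fun a => isFormalSum_altPair (fun k x y =>
      toPos b k ((x, y) - u a).1 ((x, y) - u a).2 * c a ((x, y) - u a)) k (hzs a)
    have h3 := IsFormalSum.sum Finset.univ fun a _ =>
      (isFormalSum_comp_iff (Equiv.addRight (u a)).injective (fun p hp =>
        absurd ((Equiv.addRight (u a)).surjective p) hp)).2 (hsum a)
    have h4 := IsFormalSum.sum Finset.univ fun a _ => hsum a
    simp only [hg] at h
    have h5 := h.unique h4
    rw [h5]
    simpa only [Equiv.coe_addRight, Prod.mk.eta, add_sub_cancel_right] using h3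

end Translation

/-! ### Translation of the basic operators -/

section Basic

variable {K : Type*} [Field K] {n : ℕ}

theorem DiffOp.LocallyFinite.add {D D' : DiffOp K} (h : D.LocallyFinite)
    (h' : D'.LocallyFinite) : (D + D').LocallyFinite := by
  classical
  intro m
  refine ((h m).union (h' m)).subset ?_
  rintro o ⟨a, ha, ham⟩
  rcases Finset.mem_union.1 (MvPolynomial.support_add ha) with h1 | h1
  · exact Or.inl ⟨a, h1, ham⟩
  · exact Or.inr ⟨a, h1, ham⟩

theorem DiffOp.LocallyFinite.smul {D : DiffOp K} (h : D.LocallyFinite) (c : K) :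
    (c • D).LocallyFinite := by
  intro m
  refine (h m).subset ?_
  rintro o ⟨a, ha, ham⟩
  exact ⟨a, MvPolynomial.support_smul ha, ham⟩

theorem locallyFinite_single (o : Option Var) (P : MvPolynomial Var K) :
    DiffOp.LocallyFinite (Pi.single o P : DiffOp K) := by
  intro m
  refine (Set.finite_singleton o).subset ?_
  rintro o' ⟨a, ha, -⟩
  by_contra h
  rw [Pi.single_eq_of_ne h] at ha
  simp at ha

/-- A family of coefficients of the form `c_i X_{w i}`, with `w` injective, gives a locally finite
operator. -/
theorem locallyFinite_of_coeff {D : DiffOp K} {c : ℕ+ → MvPolynomial Var K} {j : ℕ+ → Var}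
    (hD : ∀ o, D o ≠ 0 → ∃ i, o = some (j i) ∧ D o = c i) {w : ℕ+ → Var} {t : Set ℕ+}
    (hw : Set.InjOn w t)
    (hc : ∀ i, c i ≠ 0 → i ∈ t ∧ ∃ r, c i = MvPolynomial.C r * MvPolynomial.X (w i)) :
    D.LocallyFinite := by
  classical
  intro m
  have hfin : {i | i ∈ t ∧ w i ∈ m.support}.Finite := by
    refine Set.Finite.of_finite_image (f := w) (m.support.finite_toSet.subset ?_)
      (hw.mono fun i hi => hi.1)
    rintro _ ⟨i, hi, rfl⟩
    exact hi.2
  refine (hfin.image fun i => some (j i)).subset ?_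
  rintro o ⟨a, ha, ham⟩
  have h0 : D o ≠ 0 := by
    rintro h
    simp [h] at ha
  obtain ⟨i, rfl, hi⟩ := hD o h0
  rw [hi] at h0
  obtain ⟨hit, r, hr⟩ := hc i h0
  refine ⟨i, ⟨hit, ?_⟩, rfl⟩
  rw [hi, hr, MvPolynomial.X, MvPolynomial.C_mul_monomial] at ha
  have h1 := Finset.mem_singleton.1 (MvPolynomial.support_monomial_subset ha)
  rw [h1, Finsupp.single_le_iff] at ham
  exact Finsupp.mem_support_iff.2 (Nat.one_le_iff_ne_zero.1 ham)

theorem alongT_cases (c : ℕ+ → MvPolynomial Var K) (o : Option Var) (h : alongT c o ≠ 0) :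
    ∃ i, o = some (Sum.inl i) ∧ alongT c o = c i := by
  rcases o with _ | i | i
  · exact absurd rfl h
  · exact ⟨i, rfl, rfl⟩
  · exact absurd rfl h

theorem alongS_cases (c : ℕ+ → MvPolynomial Var K) (o : Option Var) (h : alongS c o ≠ 0) :
    ∃ i, o = some (Sum.inr i) ∧ alongS c o = c i := by
  rcases o with _ | i | i
  · exact absurd rfl h
  · exact absurd rfl h
  · exact ⟨i, rfl, rfl⟩

theorem injOn_sub_one : Set.InjOn (fun i : ℕ+ => i - 1) {i | 1 < i} := by
  intro a ha b hb h
  have h1 := PNat.add_sub_of_lt ha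
  have h2 := PNat.add_sub_of_lt hb
  simp only at h
  rw [← h1, h, h2]

theorem locallyFinite_virMinusOne {D : DiffOp K} {e : ℕ+ → Var} (he : Function.Injective e)
    (hD : ∀ o, D o ≠ 0 → ∃ i, o = some (e i) ∧ D o = virMinusOne e i) : D.LocallyFinite :=
  locallyFinite_of_coeff hD (w := fun i => e (i + 1)) (t := Set.univ)
    (fun _ _ _ _ h => add_right_cancel (he h)) fun _ _ => ⟨trivial, _, rfl⟩

theorem locallyFinite_virZero {D : DiffOp K} {e : ℕ+ → Var} (he : Function.Injective e)
    (hD : ∀ o, D o ≠ 0 → ∃ i, o = some (e i) ∧ D o = virZero e i) : D.LocallyFinite :=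
  locallyFinite_of_coeff hD (w := e) (t := Set.univ) he.injOn fun _ _ => ⟨trivial, _, rfl⟩

theorem locallyFinite_virOne {D : DiffOp K} {e : ℕ+ → Var} (he : Function.Injective e)
    (hD : ∀ o, D o ≠ 0 → ∃ i, o = some (e i) ∧ D o = virOne e i) : D.LocallyFinite :=
  locallyFinite_of_coeff hD (w := fun i => e (i - 1)) (t := {i | 1 < i})
    (fun _ ha _ hb h => injOn_sub_one ha hb (he h)) fun i hi => by
      rw [virOne] at hi ⊢
      split_ifs at hi ⊢ with h
      · exact ⟨h, _, rfl⟩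
      · exact absurd rfl hi

/-- An increasing sequence that is not the positions of a partition has a repeated or a negative
entry. -/
theorem altSchur_eq_zero_of_monotone {x : Fin n → ℤ} (hx : Monotone x)
    (h : x ∉ Set.range (pos : Part n → Fin n → ℤ)) : altSchur K x = 0 := by
  by_cases hi : Function.Injective x
  · by_cases h0 : ∀ i, 0 ≤ x i
    · exact absurd (exists_pos_eq (hx.strictMono_of_injective hi) h0) h
    · push Not at h0
      obtain ⟨i, hi⟩ := h0
      exact altSchur_of_neg K hi
  · exact altSchur_of_not_injective K hi

theorem monotone_add_single_one {x : Fin n → ℤ} (hx : StrictMono x) (i : Fin n) :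
    Monotone (x + Pi.single i 1) := by
  intro a b hab
  rcases hab.eq_or_lt with rfl | hab
  · exact le_rfl
  · have := hx hab
    simp only [Pi.add_apply, Pi.single_apply]
    split_ifs <;> omega

theorem monotone_add_single_neg_one {x : Fin n → ℤ} (hx : StrictMono x) (i : Fin n) :
    Monotone (x + Pi.single i (-1)) := by
  intro a b hab
  rcases hab.eq_or_lt with rfl | hab
  · exact le_rfl
  · have := hx hab
    simp only [Pi.add_apply, Pi.single_apply]
    split_ifs <;> omega

/-- The sum of the values of `f` after a jump of one walker by two places to the right, minus the
sum of the values after a move of two adjacent walkers by one place. It is used for `f` that vanish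
unless their argument is strictly increasing. -/
def jumpSum (f : (Fin n → ℤ) → K) (x : Fin n → ℤ) : K :=
  ∑ i, f (x + 2 • e i) -
    ∑ i : Fin n, ∑ j : Fin n, if (j : ℕ) = i + 1 ∧ x j = x i + 1 then f (x + e i + e j) else 0

/-- The sum over all `i` of the values at `x + 2 e_i` in `jumpSum` is one over jumps to free places,
as `f` vanishes for the others, and neighbouring values belong to neighbouring walkers. -/
theorem jumpSum_eq (f : (Fin n → ℤ) → K) (hf : ∀ x, ¬ StrictMono x → f x = 0)
    {x : Fin n → ℤ} (hx : StrictMono x) :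
    jumpSum f x = ∑ i, (if ∃ j, x j = x i + 1 then 0 else f (x + Pi.single i 2)) -
      ∑ i, ∑ j, if x j = x i + 1 then f (x + Pi.single i 1 + Pi.single j 1) else 0 := by
  rw [jumpSum]
  congr 1
  · refine Finset.sum_congr rfl fun i _ => ?_
    have h2 : 2 • e i = (Pi.single i 2 : Fin n → ℤ) := by
      rw [e, ← Pi.single_smul]
      rfl
    rw [h2]
    split_ifs with h
    · obtain ⟨j, hj⟩ := h
      refine hf _ fun hs => ?_
      have hij : i < j := hx.lt_iff_lt.1 (by omega)
      have := hs hij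
      simp [hij.ne'] at this
      omega
    · rfl
  · refine Finset.sum_congr rfl fun i _ => Finset.sum_congr rfl fun j _ => ?_
    refine if_congr ⟨fun h => h.2, fun h => ⟨?_, h⟩⟩ rfl rfl
    have hij : i < j := hx.lt_iff_lt.1 (by omega)
    by_contra hne
    have h1 : (i : ℕ) + 1 < j := lt_of_le_of_ne hij (Ne.symm hne)
    have h2 : (⟨i + 1, h1.trans j.2⟩ : Fin n) < j := h1
    have h3 : i < (⟨i + 1, h1.trans j.2⟩ : Fin n) := Nat.lt_succ_self _
    have h4 := hx h2
    have h5 := hx h3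
    omega

/-- The coefficients of `∂/∂t_2` in the basis of Schur polynomials: jumps by two places to the
left over free places, and moves of two adjacent walkers. -/
def jumpCoeff : Fin n ⊕ Fin n × Fin n → (Fin n → ℤ) → K
  | Sum.inl i, x => if ∃ j, x j = x i + -1 then 0 else 1
  | Sum.inr p, x => if x p.2 = x p.1 + -1 then -1 else 0

/-- The displacements that belong to `jumpCoeff`. -/
def jumpMove : Fin n ⊕ Fin n × Fin n → Fin n → ℤ
  | Sum.inl i => Pi.single i (-2)
  | Sum.inr p => Pi.single p.1 (-1) + Pi.single p.2 (-1)

theorem monotone_add_jumpMove (a : Fin n ⊕ Fin n × Fin n) (x : Fin n → ℤ) (hx : StrictMono x)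
    (h : (jumpCoeff a x : K) ≠ 0) : Monotone (x + jumpMove a) := by
  intro r s hrs
  rcases hrs.eq_or_lt with rfl | hrs
  · exact le_rfl
  have h1 := hx hrs
  rcases a with i | ⟨i, j⟩
  · have h2 : ¬ ∃ j, x j = x i + -1 := by
      intro h2
      simp [jumpCoeff, h2] at h
    push Not at h2
    have h3 := h2 r
    simp only [jumpMove, Pi.add_apply, Pi.single_apply]
    split_ifs with hr hs hs
    · omega
    · omega
    · subst hs
      omega
    · omega
  · have h2 : x j = x i + -1 := by
      by_contra h2
      simp [jumpCoeff, h2] at h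
    simp only [jumpMove, Pi.add_apply, Pi.single_apply]
    have hne : i ≠ j := by
      rintro rfl
      omega
    by_cases hsi : s = i
    · subst hsi
      by_cases hrj : r = j
      · subst hrj
        simp [hrs.ne, hrs.ne']
        omega
      · have : x r ≠ x j := fun h => hrj (hx.injective h)
        simp [hrs.ne, hrj, hne]
        omega
    · split_ifs <;> omega

/-- The transpose of `∂/∂t_2` on coefficients that vanish away from strictly increasing sequences is
`jumpSum`. -/
theorem sum_jumpCoeff (f : (Fin n → ℤ) → K) (hf : ∀ x, ¬ StrictMono x → f x = 0)
    {x : Fin n → ℤ} (hx : StrictMono x) :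
    ∑ a, jumpCoeff a (x - jumpMove a) * f (x - jumpMove a) = jumpSum f x := by
  rw [jumpSum_eq f hf hx, Fintype.sum_sum_type, Fintype.sum_prod_type, sub_eq_add_neg]
  congr 1
  · refine Finset.sum_congr rfl fun i _ => ?_
    have h : (∃ j, (x - Pi.single i (-2) : Fin n → ℤ) j =
        (x - Pi.single i (-2) : Fin n → ℤ) i + -1) ↔ ∃ j, x j = x i + 1 := by
      refine exists_congr fun j => ?_
      simp only [Pi.sub_apply, Pi.single_apply]
      split_ifs with h1
      · subst h1
        omega
      · omega
    have h' : x - Pi.single i (-2) = x + Pi.single i 2 := by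
      rw [Pi.single_neg, sub_neg_eq_add]
    have hc : (jumpCoeff (Sum.inl i) (x - Pi.single i (-2)) : K) =
        if ∃ j, x j = x i + 1 then 0 else 1 := if_congr h rfl rfl
    simp only [jumpMove, hc]
    rw [h']
    split_ifs <;> simp
  · rw [← Finset.sum_neg_distrib, Finset.sum_comm]
    refine Finset.sum_congr rfl fun i _ => ?_
    rw [← Finset.sum_neg_distrib]
    refine Finset.sum_congr rfl fun j _ => ?_
    have h' : x - jumpMove (Sum.inr (j, i)) = x + Pi.single i 1 + Pi.single j 1 := by
      simp only [jumpMove, Pi.single_neg]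
      abel
    rw [h']
    have h : (x + Pi.single i 1 + Pi.single j 1 : Fin n → ℤ) i =
        (x + Pi.single i 1 + Pi.single j 1 : Fin n → ℤ) j + -1 ↔
        x j = x i + 1 := by
      simp only [Pi.add_apply, Pi.single_apply]
      rcases eq_or_ne i j with rfl | hne
      · simp
      · simp only [hne, hne.symm, if_true, if_false]
        omega
    have hc : (jumpCoeff (Sum.inr (j, i)) (x + Pi.single i 1 + Pi.single j 1) : K) =
        if x j = x i + 1 then -1 else 0 := if_congr h rfl rfl
    rw [hc]
    split_ifs <;> simp

variable [CharZero K] {R : Type*} [CommRing R] [Algebra K R]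

/-- An operator in `t` that moves the positions in `s_λ(t)` translates into the transposed operator
in `x`. -/
theorem ActsOnT.translates {D : DiffOp K} {V : MvPolynomial ℕ+ K → MvPolynomial ℕ+ K}
    (h : ActsOnT D V) (hD : D.LocallyFinite) (ρ : R →ₐ[K] Module.End K (ℤ → Series K))
    {α : Type*} [Fintype α] (c : α → (Fin n → ℤ) → K) (u : α → Fin n → ℤ)
    (hV : ∀ x, StrictMono x → V (altSchur K x) = ∑ a, c a x • altSchur K (x + u a))
    (hmono : ∀ a x, StrictMono x → c a x ≠ 0 → Monotone (x + u a)) :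
    Translates ρ (D.baseChange R) fun B k x y => ∑ a, c a (x - u a) * B k (x - u a) y := by
  have h1 := translates_of_shift (n := n) ρ hD (fun a p => c a p.1) (fun a => (u a, 0)) ?_ ?_
  · simpa using h1
  · intro lam mu
    rw [altPair, h, hV _ (pos_strictMono lam), map_sum, Finset.sum_mul]
    refine Finset.sum_congr rfl fun a _ => ?_
    rw [map_smul, smul_mul_assoc]
    simp [altPair]
  · intro a lam mu hc hr
    rw [altPair, Prod.mk_add_mk, add_zero]
    rw [altSchur_eq_zero_of_monotone (hmono a _ (pos_strictMono lam) hc), map_zero, zero_mul]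
    rintro ⟨lam', hl⟩
    exact hr ⟨(lam', mu), by simp [hl]⟩

/-- An operator in `s` that moves the positions in `s_μ(-s)` translates into the transposed operator
in `y`. -/
theorem ActsOnS.translates {D : DiffOp K} {V : MvPolynomial ℕ+ K → MvPolynomial ℕ+ K}
    (h : ActsOnS D V) (hD : D.LocallyFinite) (ρ : R →ₐ[K] Module.End K (ℤ → Series K))
    {α : Type*} [Fintype α] (c : α → (Fin n → ℤ) → K) (u : α → Fin n → ℤ)
    (hV : ∀ x, StrictMono x → V (altSchur K x) = ∑ a, c a x • altSchur K (x + u a))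
    (hmono : ∀ a x, StrictMono x → c a x ≠ 0 → Monotone (x + u a)) :
    Translates ρ (D.baseChange R) fun B k x y => ∑ a, c a (y - u a) * B k x (y - u a) := by
  have h1 := translates_of_shift (n := n) ρ hD (fun a p => c a p.2) (fun a => (0, u a)) ?_ ?_
  · simpa using h1
  · intro lam mu
    rw [altPair, h, hV _ (pos_strictMono mu), map_sum, Finset.mul_sum]
    refine Finset.sum_congr rfl fun a _ => ?_
    rw [map_smul, mul_smul_comm]
    simp [altPair]
  · intro a lam mu hc hr
    rw [altPair, Prod.mk_add_mk, add_zero]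
    rw [altSchur_eq_zero_of_monotone (hmono a _ (pos_strictMono mu) hc), map_zero, mul_zero]
    rintro ⟨mu', hl⟩
    exact hr ⟨(lam, mu'), by simp [hl]⟩

theorem pderiv_two_altSchur {x : Fin n → ℤ} (hx : StrictMono x) :
    MvPolynomial.pderiv 2 (altSchur K x) =
      ∑ a, (jumpCoeff a x : K) • altSchur K (x + jumpMove a) := by
  have h2 : (-(((2 : ℕ+) : ℕ) : ℤ)) = 2 * (-1) := rfl
  rw [pderiv_altSchur, h2, sum_jump_eq (Φ := altSchur K) (fun x a b hab => by
    rw [altSchur_comp, Equiv.Perm.sign_swap hab]; simp) hx.injective (by norm_num),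
    Fintype.sum_sum_type, Fintype.sum_prod_type, sub_eq_add_neg, ← Finset.sum_neg_distrib]
  congr 1
  · refine Finset.sum_congr rfl fun i _ => ?_
    simp only [jumpCoeff, jumpMove]
    split_ifs <;> simp
  · refine Finset.sum_congr rfl fun i _ => ?_
    rw [← Finset.sum_neg_distrib]
    refine Finset.sum_congr rfl fun j _ => ?_
    simp only [jumpCoeff, jumpMove]
    split_ifs <;> simp [add_assoc]

end Basic

section BasicTranslations

variable {K : Type*} [Field K] [CharZero K] {R : Type*} [CommRing R] [Algebra K R] {n : ℕ}
  (ρ : R →ₐ[K] Module.End K (ℤ → Series K))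

theorem translates_one : Translates (n := n) ρ (DiffOp.baseChange R (Pi.single none 1 : DiffOp K))
    fun B k x y => B k x y := by
  have h : ActsOnT (Pi.single none 1 : DiffOp K) fun f => f := by
    intro f g
    have h : MvPolynomial.mkDerivation K (fun w => (Pi.single none 1 : DiffOp K) (some w)) = 0 :=
      MvPolynomial.derivation_ext fun w => by simp [MvPolynomial.mkDerivation_X]
    rw [DiffOp.polyOp, h]
    simp
  refine (h.translates (n := n) (locallyFinite_single _ _) ρ (α := Unit) (fun _ _ => 1)
    (fun _ => 0) (fun x _ => by simp) fun _ x hx _ => ?_).congr rfl fun B _ k x y _ _ => by simp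
  simpa using hx.monotone

theorem translates_pderiv_t_one :
    Translates (n := n) ρ ((partialVar (Sum.inl 1) : DiffOp K).baseChange R)
      fun B k x y => ∑ i, B k (x + e i) y := by
  refine ((actsOnT_partialVar 1).translates (n := n) (locallyFinite_single _ _) ρ
    (fun _ _ => 1) (fun i => Pi.single i (-1)) (fun x _ => ?_) fun i x hx _ =>
      monotone_add_single_neg_one hx i).congr rfl fun B _ k x y _ _ => ?_
  · simp [pderiv_altSchur]
  · simp [Pi.single_neg]

theorem translates_pderiv_s_one :
    Translates (n := n) ρ ((partialVar (Sum.inr 1) : DiffOp K).baseChange R)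
      fun B k x y => -∑ i, B k x (y + e i) := by
  refine ((actsOnS_partialVar 1).translates (n := n) (locallyFinite_single _ _) ρ
    (fun _ _ => -1) (fun i => Pi.single i (-1)) (fun x _ => ?_) fun i x hx _ =>
      monotone_add_single_neg_one hx i).congr rfl fun B _ k x y _ _ => ?_
  · simp [pderiv_altSchur]
  · simp [Pi.single_neg]

theorem translates_pderiv_t_two :
    Translates (n := n) ρ ((partialVar (Sum.inl 2) : DiffOp K).baseChange R)
      fun B k x y => jumpSum (fun x => B k x y) x := by
  refine ((actsOnT_partialVar 2).translates (n := n) (locallyFinite_single _ _) ρ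
    jumpCoeff jumpMove (fun x hx => pderiv_two_altSchur hx) monotone_add_jumpMove).congr rfl
      fun B hB k x y hx _ => ?_
  exact (sum_jumpCoeff (fun x => B k x y) (fun x hx => hB k x y fun h => hx h.1) hx).symm

theorem translates_pderiv_s_two :
    Translates (n := n) ρ ((partialVar (Sum.inr 2) : DiffOp K).baseChange R)
      fun B k x y => -jumpSum (fun y => B k x y) y := by
  refine ((actsOnS_partialVar 2).translates (n := n) (locallyFinite_single _ _) ρ
    (fun a x => -jumpCoeff a x) jumpMove (fun x hx => ?_)
    (fun a x hx hc => monotone_add_jumpMove (K := K) a x hx fun h => hc (by rw [h, neg_zero]))).congr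
      rfl fun B hB k x y _ hy => ?_
  · simp [pderiv_two_altSchur hx]
  · simp only [neg_mul, Finset.sum_neg_distrib]
    rw [← sum_jumpCoeff (fun y => B k x y) (fun y hy => hB k x y fun h => hy h.2) hy]

theorem translates_virZero_t :
    Translates (n := n) ρ ((alongT (virZero Sum.inl) : DiffOp K).baseChange R)
      fun B k x y => ((∑ i, (x i : K)) - ∑ i : Fin n, ((i : ℕ) : K)) * B k x y := by
  refine (actsOnT_virZero.translates (n := n)
    (locallyFinite_virZero Sum.inl_injective (alongT_cases _)) ρ (α := Unit)
    (fun _ x => (∑ i, (x i : K)) - ∑ i : Fin n, ((i : ℕ) : K)) (fun _ => 0) (fun x _ => ?_)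
    fun _ x hx _ => by simpa using hx.monotone).congr rfl fun B _ k x y _ _ => by simp
  simp [derZero_altSchur, MvPolynomial.smul_eq_C_mul]

theorem translates_virZero_s :
    Translates (n := n) ρ ((alongS (virZero Sum.inr) : DiffOp K).baseChange R)
      fun B k x y => ((∑ i, (y i : K)) - ∑ i : Fin n, ((i : ℕ) : K)) * B k x y := by
  refine (actsOnS_virZero.translates (n := n)
    (locallyFinite_virZero Sum.inr_injective (alongS_cases _)) ρ (α := Unit)
    (fun _ x => (∑ i, (x i : K)) - ∑ i : Fin n, ((i : ℕ) : K)) (fun _ => 0) (fun x _ => ?_)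
    fun _ x hx _ => by simpa using hx.monotone).congr rfl fun B _ k x y _ _ => by simp
  simp [derZero_altSchur, MvPolynomial.smul_eq_C_mul]

theorem derMinusOne_altSchur_smul (x : Fin n → ℤ) :
    derMinusOne K (altSchur K x) + (n : K) • (MvPolynomial.X 1 * altSchur K x) =
      ∑ i, ((x i : K) + 1) • altSchur K (x + Pi.single i 1) := by
  have h := derMinusOne_altSchur K x
  simp only [MvPolynomial.smul_eq_C_mul, map_add, map_intCast, map_natCast, map_one]
  rw [← h, mul_assoc]

theorem derOne_altSchur_smul (x : Fin n → ℤ) :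
    derOne K (altSchur K x) + (n : K) • MvPolynomial.pderiv 1 (altSchur K x) =
      ∑ i, (x i : K) • altSchur K (x + Pi.single i (-1)) := by
  have h := derOne_altSchur K x
  simp only [MvPolynomial.smul_eq_C_mul, map_intCast, map_natCast]
  rw [← h]

theorem translates_virMinusOne_t :
    Translates (n := n) ρ ((alongT (virMinusOne Sum.inl) +
      (n : K) • mulVar (Sum.inl 1) : DiffOp K).baseChange R)
      fun B k x y => ∑ i, (x i : K) * B k (x - e i) y := by
  refine ((actsOnT_virMinusOne.add ((actsOnT_mulVar 1).smul (n : K))).translates (n := n)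
    ((locallyFinite_virMinusOne Sum.inl_injective (alongT_cases _)).add
      ((locallyFinite_single _ _).smul _)) ρ
    (fun i x => (x i : K) + 1) (fun i => Pi.single i 1) (fun x _ => derMinusOne_altSchur_smul x)
    fun i x hx _ => monotone_add_single_one hx i).congr rfl fun B _ k x y _ _ => by simp

theorem translates_virMinusOne_s :
    Translates (n := n) ρ ((alongS (virMinusOne Sum.inr) +
      (-n : K) • mulVar (Sum.inr 1) : DiffOp K).baseChange R)
      fun B k x y => ∑ i, (y i : K) * B k x (y - e i) := by
  refine ((actsOnS_virMinusOne.add ((actsOnS_mulVar 1).smul (-n : K))).translates (n := n)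
    ((locallyFinite_virMinusOne Sum.inr_injective (alongS_cases _)).add
      ((locallyFinite_single _ _).smul _)) ρ
    (fun i x => (x i : K) + 1) (fun i => Pi.single i 1) (fun x _ => ?_)
    fun i x hx _ => monotone_add_single_one hx i).congr rfl fun B _ k x y _ _ => by simp
  rw [smul_neg, neg_smul, neg_neg]
  exact derMinusOne_altSchur_smul x

theorem translates_virOne_t :
    Translates (n := n) ρ ((alongT (virOne Sum.inl) +
      (n : K) • partialVar (Sum.inl 1) : DiffOp K).baseChange R)
      fun B k x y => ∑ i, ((x i : K) + 1) * B k (x + e i) y := by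
  refine ((actsOnT_virOne.add ((actsOnT_partialVar 1).smul (n : K))).translates (n := n)
    ((locallyFinite_virOne Sum.inl_injective (alongT_cases _)).add
      ((locallyFinite_single _ _).smul _)) ρ
    (fun i x => (x i : K)) (fun i => Pi.single i (-1)) (fun x _ => derOne_altSchur_smul x)
    fun i x hx _ => monotone_add_single_neg_one hx i).congr rfl fun B _ k x y _ _ => by
      simp [Pi.single_neg]

theorem translates_virOne_s :
    Translates (n := n) ρ ((alongS (virOne Sum.inr) +
      (-n : K) • partialVar (Sum.inr 1) : DiffOp K).baseChange R)
      fun B k x y => ∑ i, ((y i : K) + 1) * B k x (y + e i) := by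
  refine ((actsOnS_virOne.add ((actsOnS_partialVar 1).smul (-n : K))).translates (n := n)
    ((locallyFinite_virOne Sum.inr_injective (alongS_cases _)).add
      ((locallyFinite_single _ _).smul _)) ρ
    (fun i x => (x i : K)) (fun i => Pi.single i (-1)) (fun x _ => ?_)
    fun i x hx _ => monotone_add_single_neg_one hx i).congr rfl fun B _ k x y _ _ => by
      simp [Pi.single_neg]
  rw [Derivation.neg_apply, smul_neg, neg_smul, neg_neg]
  exact derOne_altSchur_smul x

end BasicTranslations

/-! ### Shifted Virasoro operators -/

section Shift

variable {K : Type*} [Field K] {R : Type*} [CommRing R] [Algebra K R]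

/-- The shift of variables `v ↦ v + c v` in polynomials. -/
def shiftHom (c : Var → R) : MvPolynomial Var R →ₐ[R] MvPolynomial Var R :=
  MvPolynomial.aeval fun v => MvPolynomial.X v + MvPolynomial.C (c v)

@[simp] theorem shift_apply (c : Var → R) (D : DiffOp R) (o : Option Var) :
    D.shift c o = shiftHom c (D o) := rfl

@[simp] theorem shiftHom_X (c : Var → R) (v : Var) :
    shiftHom c (MvPolynomial.X v) = MvPolynomial.X v + MvPolynomial.C (c v) :=
  MvPolynomial.aeval_X _ _

@[simp] theorem shiftHom_virMinusOne (c : Var → R) (e : ℕ+ → Var) (i : ℕ+) :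
    shiftHom c (virMinusOne e i) =
      virMinusOne e i + MvPolynomial.C (((i + 1 : ℕ+) : ℕ) * c (e (i + 1))) := by
  simp [virMinusOne, shiftHom_X, mul_add]

@[simp] theorem shiftHom_virZero (c : Var → R) (e : ℕ+ → Var) (i : ℕ+) :
    shiftHom c (virZero e i) = virZero e i + MvPolynomial.C ((i : ℕ) * c (e i)) := by
  simp [virZero, shiftHom_X, mul_add]

@[simp] theorem virOne_one (e : ℕ+ → Var) : (virOne e 1 : MvPolynomial Var R) = 0 := by
  simp [virOne]

theorem virOne_add_one (e : ℕ+ → Var) (i : ℕ+) :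
    (virOne e (i + 1) : MvPolynomial Var R) =
      MvPolynomial.C ((i : ℕ) : R) * MvPolynomial.X (e i) := by
  have h : i + 1 - 1 = i := by
    apply PNat.coe_injective
    rw [PNat.sub_coe, if_pos (PNat.lt_add_left 1 i)]
    simp
  rw [virOne, if_pos (PNat.lt_add_left 1 i), h]
  simp

@[simp] theorem shiftHom_virOne_add_one (c : Var → R) (e : ℕ+ → Var) (i : ℕ+) :
    shiftHom c (virOne e (i + 1)) =
      virOne e (i + 1) + MvPolynomial.C ((i : ℕ) * c (e i)) := by
  simp [virOne_add_one, shiftHom_X, mul_add]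

@[simp] theorem map_virMinusOne {R' : Type*} [CommRing R'] (f : R →+* R') (e : ℕ+ → Var) (i : ℕ+) :
    MvPolynomial.map f (virMinusOne e i) = virMinusOne e i := by
  simp [virMinusOne]

@[simp] theorem map_virZero {R' : Type*} [CommRing R'] (f : R →+* R') (e : ℕ+ → Var) (i : ℕ+) :
    MvPolynomial.map f (virZero e i) = virZero e i := by
  simp [virZero]

@[simp] theorem map_virOne {R' : Type*} [CommRing R'] (f : R →+* R') (e : ℕ+ → Var) (i : ℕ+) :
    MvPolynomial.map f (virOne e i) = virOne e i := by
  rw [virOne, virOne]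
  split_ifs <;> simp

@[simp] theorem baseChange_apply (D : DiffOp K) (o : Option Var) :
    D.baseChange R o = MvPolynomial.map (algebraMap K R) (D o) := rfl

theorem const_smul_eq (c : K) (P : MvPolynomial Var R) :
    c • P = MvPolynomial.C (algebraMap K R c) * P := by
  rw [← algebraMap_smul R, MvPolynomial.smul_eq_C_mul]

@[simp] theorem alongT_none (c : ℕ+ → MvPolynomial Var R) : alongT c none = 0 := rfl

@[simp] theorem alongT_inl (c : ℕ+ → MvPolynomial Var R) (i : ℕ+) :
    alongT c (some (Sum.inl i)) = c i := rfl

@[simp] theorem alongT_inr (c : ℕ+ → MvPolynomial Var R) (i : ℕ+) :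
    alongT c (some (Sum.inr i)) = 0 := rfl

@[simp] theorem alongS_none (c : ℕ+ → MvPolynomial Var R) : alongS c none = 0 := rfl

@[simp] theorem alongS_inl (c : ℕ+ → MvPolynomial Var R) (i : ℕ+) :
    alongS c (some (Sum.inl i)) = 0 := rfl

@[simp] theorem alongS_inr (c : ℕ+ → MvPolynomial Var R) (i : ℕ+) :
    alongS c (some (Sum.inr i)) = c i := rfl

@[simp] theorem mulVar_none (v : Var) : (mulVar v : DiffOp R) none = MvPolynomial.X v := by
  simp [mulVar]

@[simp] theorem mulVar_some (v w : Var) : (mulVar v : DiffOp R) (some w) = 0 := by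
  simp [mulVar]

@[simp] theorem partialVar_none (v : Var) : (partialVar v : DiffOp R) none = 0 := by
  simp [partialVar]

@[simp] theorem partialVar_some (v w : Var) :
    (partialVar v : DiffOp R) (some w) = if w = v then 1 else 0 := by
  simp [partialVar, Pi.single_apply]

theorem pnat_eq_one_or_succ (i : ℕ+) : i = 1 ∨ ∃ j, i = j + 1 := by
  rcases eq_or_ne i 1 with h | h
  · exact Or.inl h
  · obtain ⟨j, hj⟩ := PNat.exists_eq_succ_of_ne_one h
    exact Or.inr ⟨j, hj⟩

@[simp] theorem pnat_add_one_ne_one (i : ℕ+) : i + 1 ≠ 1 := (PNat.lt_add_left 1 i).ne'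

@[simp] theorem mul_shiftOne_inl (i : ℕ+) :
    ((i : ℕ) : Polynomial K) * shiftOne (Sum.inl i) = if i = 1 then Polynomial.X else 0 := by
  rw [shiftOne]
  split_ifs with h
  · simp [h]
  · simp

@[simp] theorem mul_shiftOne_inr (i : ℕ+) :
    ((i : ℕ) : Polynomial K) * shiftOne (Sum.inr i) = if i = 1 then -Polynomial.X else 0 := by
  rw [shiftOne]
  split_ifs with h
  · simp [h]
  · simp

@[simp] theorem mul_shiftTwo_inr (q : K) (i : ℕ+) :
    ((i : ℕ) : Polynomial K) * shiftTwo q (Sum.inr i) = if i = 1 then -Polynomial.X else 0 := by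
  rw [shiftTwo]
  split_ifs with h
  · simp [h]
  · simp

@[simp] theorem shiftTwo_inr_one (q : K) : shiftTwo q (Sum.inr 1) = -Polynomial.X := by
  simpa using mul_shiftTwo_inr q 1

variable [CharZero K]

@[simp] theorem mul_shiftTwo_inl (q : K) (i : ℕ+) :
    ((i : ℕ) : Polynomial K) * shiftTwo q (Sum.inl i) =
      Polynomial.C (-(q * (-1) ^ (i : ℕ))) := by
  have h : ((i : ℕ) : K) ≠ 0 := Nat.cast_ne_zero.2 i.ne_zero
  rw [shiftTwo, ← map_natCast Polynomial.C, ← map_mul]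
  congr 1
  field_simp

@[simp] theorem mul_shiftThree_inl (p q : K) (i : ℕ+) :
    ((i : ℕ) : LaurentPolynomial K) * shiftThree p q (Sum.inl i) =
      -(LaurentPolynomial.C p * (-LaurentPolynomial.T 1) ^ (i : ℕ)) := by
  have h : ((i : ℕ) : K) ≠ 0 := Nat.cast_ne_zero.2 i.ne_zero
  rw [shiftThree, mul_neg, ← mul_assoc, ← map_natCast LaurentPolynomial.C, ← map_mul,
    mul_div_cancel₀ _ h]

@[simp] theorem mul_shiftThree_inr (p q : K) (i : ℕ+) :
    ((i : ℕ) : LaurentPolynomial K) * shiftThree p q (Sum.inr i) =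
      LaurentPolynomial.C q * (-LaurentPolynomial.T 1) ^ (i : ℕ) := by
  have h : ((i : ℕ) : K) ≠ 0 := Nat.cast_ne_zero.2 i.ne_zero
  rw [shiftThree, ← mul_assoc, ← map_natCast LaurentPolynomial.C, ← map_mul,
    mul_div_cancel₀ _ h]

@[simp] theorem shiftTwo_inl_one (q : K) : shiftTwo q (Sum.inl 1) = Polynomial.C q := by
  simpa using mul_shiftTwo_inl q 1

@[simp] theorem shiftThree_inl_one (p q : K) :
    shiftThree p q (Sum.inl 1) = LaurentPolynomial.C p * LaurentPolynomial.T 1 := by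
  simpa using mul_shiftThree_inl p q 1

@[simp] theorem shiftThree_inr_one (p q : K) :
    shiftThree p q (Sum.inr 1) = -(LaurentPolynomial.C q * LaurentPolynomial.T 1) := by
  simpa using mul_shiftThree_inr p q 1

end Shift

section Cases

variable {K : Type*} [Field K] {n : ℕ}

theorem jumpSum_mul (c : K) (f : (Fin n → ℤ) → K) (x : Fin n → ℤ) :
    jumpSum (fun x => c * f x) x = c * jumpSum f x := by
  rw [jumpSum, jumpSum, mul_sub, Finset.mul_sum, Finset.mul_sum]
  congr 1
  refine Finset.sum_congr rfl fun i _ => ?_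
  rw [Finset.mul_sum]
  exact Finset.sum_congr rfl fun j _ => by rw [mul_ite, mul_zero]

theorem jumpSum_eq_adjacentSum (B : ℤ → (Fin n → ℤ) → (Fin n → ℤ) → K) (k : ℤ)
    (x y : Fin n → ℤ) :
    jumpSum (fun y => B k x y) y = ∑ i, B k x (y + 2 • e i) - adjacentSum B k x y := rfl

variable [CharZero K]

theorem pnat_add_one_eq_two_iff (j : ℕ+) : j + 1 = 2 ↔ j = 1 :=
  add_left_inj (1 : ℕ+) (b := j) (c := 1)

/-- The shift adds `z (n + ∂/∂s_2)` to `𝕍_{-1}`. -/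
theorem translates_L1minus :
    Translates (n := n) substKLambdaInv
      ((bigVMinusOne (Polynomial K) n).shift shiftOne) L1minus := by
  have h := ((translates_virMinusOne_t (n := n) (K := K) substKLambdaInv).add
    ((translates_virOne_s substKLambdaInv).const_smul (-1))).add
    ((((translates_one substKLambdaInv).const_smul (n : K)).add
      (translates_pderiv_s_two substKLambdaInv)).smul (r := Polynomial.X) (c := fun k => (k : K))
        (j := 1) substKLambdaInv_X)
  refine h.congr ?_ fun B _ k x y _ _ => ?_
  · funext o
    rcases o with _ | i | i
    · simp [bigVMinusOne, const_smul_eq, shiftOne, MvPolynomial.smul_eq_C_mul]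
      ring
    · simp [bigVMinusOne, -PNat.add_coe]
    · rcases pnat_eq_one_or_succ i with rfl | ⟨j, rfl⟩
      · simp [bigVMinusOne, MvPolynomial.smul_eq_C_mul]
      · simp [bigVMinusOne, MvPolynomial.smul_eq_C_mul, pnat_add_one_eq_two_iff,
          apply_ite MvPolynomial.C]
        split_ifs <;> ring
  · simp only [L1minus, Finset.sum_sub_distrib, jumpSum_mul, jumpSum_eq_adjacentSum]
    ring

/-- The shift adds `z (∂/∂t_1 + ∂/∂s_1)` to `𝕍_0`. -/
theorem translates_L1zero :
    Translates (n := n) substKLambdaInv ((bigVZero (Polynomial K)).shift shiftOne) L1zero := by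
  have h := ((translates_virZero_t (n := n) (K := K) substKLambdaInv).add
    ((translates_virZero_s substKLambdaInv).const_smul (-1))).add
    (((translates_pderiv_t_one substKLambdaInv).add
      (translates_pderiv_s_one substKLambdaInv)).smul (r := Polynomial.X) (c := fun k => (k : K))
        (j := 1) substKLambdaInv_X)
  refine h.congr ?_ fun B _ k x y _ _ => ?_
  · funext o
    rcases o with _ | i | i
    · simp [bigVZero]
    · simp [bigVZero, MvPolynomial.smul_eq_C_mul, apply_ite MvPolynomial.C]
    · simp [bigVZero, MvPolynomial.smul_eq_C_mul, apply_ite MvPolynomial.C]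
      split_ifs <;> ring
  · simp only [L1zero, Finset.sum_sub_distrib, ← Finset.mul_sum]
    ring

/-- The shift adds `z (n - ∂/∂t_2)` to `-𝕍_1`. -/
theorem translates_L1plus :
    Translates (n := n) substKLambdaInv
      ((-bigVOne (Polynomial K) n).shift shiftOne) L1plus := by
  have h := ((translates_virMinusOne_s (n := n) (K := K) substKLambdaInv).add
    ((translates_virOne_t substKLambdaInv).const_smul (-1))).add
    ((((translates_one substKLambdaInv).const_smul (n : K)).add
      ((translates_pderiv_t_two substKLambdaInv).const_smul (-1))).smul (r := Polynomial.X)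
        (c := fun k => (k : K)) (j := 1) substKLambdaInv_X)
  refine h.congr ?_ fun B _ k x y _ _ => ?_
  · funext o
    rcases o with _ | i | i
    · simp [bigVOne, const_smul_eq, shiftOne, MvPolynomial.smul_eq_C_mul]
      ring
    · rcases pnat_eq_one_or_succ i with rfl | ⟨j, rfl⟩
      · simp [bigVOne, MvPolynomial.smul_eq_C_mul]
      · simp [bigVOne, MvPolynomial.smul_eq_C_mul, pnat_add_one_eq_two_iff,
          apply_ite MvPolynomial.C]
        split_ifs <;> ring
    · simp [bigVOne, -PNat.add_coe]
  · simp only [L1plus, L1minus, Finset.sum_sub_distrib, jumpSum_mul]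
    rw [jumpSum_eq_adjacentSum (fun k x y => B k y x)]
    ring

/-- The shift adds `n q + z (∂/∂s_1 + ∂/∂s_2)` to `𝕍_0 + 𝕍_{-1}`. -/
theorem translates_L2minus (q : K) :
    Translates (n := n) substKLambdaInv
      ((bigVZero (Polynomial K) + bigVMinusOne (Polynomial K) n).shift (shiftTwo q))
      fun B k x y => L2minus B k x y q := by
  have h := (((((translates_virZero_t (n := n) (K := K) substKLambdaInv).add
    ((translates_virZero_s substKLambdaInv).const_smul (-1))).add
    (translates_virMinusOne_t substKLambdaInv)).add
    ((translates_virOne_s substKLambdaInv).const_smul (-1))).add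
    ((translates_one substKLambdaInv).const_smul (n * q))).add
    (((translates_pderiv_s_one substKLambdaInv).add
      (translates_pderiv_s_two substKLambdaInv)).smul (r := Polynomial.X)
        (c := fun k => (k : K)) (j := 1) substKLambdaInv_X)
  refine h.congr ?_ fun B _ k x y _ _ => ?_
  · funext o
    rcases o with _ | i | i
    · simp [bigVZero, bigVMinusOne, const_smul_eq, shiftTwo, MvPolynomial.smul_eq_C_mul]
      ring
    · -- The constant terms of the two shifted coefficients cancel.
      simp [bigVZero, bigVMinusOne, -PNat.add_coe]
      simp [pow_succ]
      ring
    · rcases pnat_eq_one_or_succ i with rfl | ⟨j, rfl⟩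
      · simp [bigVZero, bigVMinusOne, MvPolynomial.smul_eq_C_mul]
        ring
      · simp [bigVZero, bigVMinusOne, MvPolynomial.smul_eq_C_mul, pnat_add_one_eq_two_iff,
          apply_ite MvPolynomial.C, -PNat.add_coe]
        split_ifs <;> ring
  · simp only [L2minus, Finset.sum_sub_distrib, Finset.sum_add_distrib, jumpSum_mul,
      jumpSum_eq_adjacentSum, ← Finset.mul_sum, ← Finset.sum_mul, Finset.sum_const,
      Finset.card_univ, Fintype.card_fin, nsmul_eq_mul]
    ring

/-- The shift adds `-q ∂/∂t_1 + z (n - ∂/∂s_1)` to `-(𝕍_0 + 𝕍_1)`. -/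
theorem translates_L2plus (q : K) :
    Translates (n := n) substKLambdaInv
      ((-(bigVZero (Polynomial K) + bigVOne (Polynomial K) n)).shift (shiftTwo q))
      fun B k x y => L2plus B k x y q := by
  have h := ((((((translates_virZero_t (n := n) (K := K) substKLambdaInv).const_smul (-1)).add
    (translates_virZero_s substKLambdaInv)).add
    (translates_virMinusOne_s substKLambdaInv)).add
    ((translates_virOne_t substKLambdaInv).const_smul (-1))).add
    ((translates_pderiv_t_one substKLambdaInv).const_smul (-q))).add
    ((((translates_one substKLambdaInv).const_smul (n : K)).add
      ((translates_pderiv_s_one substKLambdaInv).const_smul (-1))).smul (r := Polynomial.X)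
        (c := fun k => (k : K)) (j := 1) substKLambdaInv_X)
  refine h.congr ?_ fun B _ k x y _ _ => ?_
  · funext o
    rcases o with _ | i | i
    · simp [bigVZero, bigVOne, const_smul_eq, shiftTwo, MvPolynomial.smul_eq_C_mul]
      ring
    · -- The constant terms of the two shifted coefficients cancel for `i > 1`.
      rcases pnat_eq_one_or_succ i with rfl | ⟨j, rfl⟩
      · simp [bigVZero, bigVOne, const_smul_eq]
        ring
      · simp [bigVZero, bigVOne, -PNat.add_coe]
        simp [pow_succ]
        ring
    · simp [bigVZero, bigVOne, MvPolynomial.smul_eq_C_mul,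
          apply_ite MvPolynomial.C, -PNat.add_coe]
      split_ifs <;> ring
  · simp only [L2plus, Finset.sum_sub_distrib, Finset.sum_add_distrib, add_mul,
      ← Finset.mul_sum, ← Finset.sum_mul, Finset.sum_const,
      Finset.card_univ, Fintype.card_fin, nsmul_eq_mul]
    ring

/-- The shift adds `p ∂/∂t_1 + q ∂/∂s_1 + n (p - q) z`. -/
theorem translates_L3 (p q : K) :
    Translates (n := n) substLambdaInv
      ((bigVMinusOne (LaurentPolynomial K) n +
        (LaurentPolynomial.T 1 + LaurentPolynomial.T (-1) : LaurentPolynomial K) •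
          bigVZero (LaurentPolynomial K) +
        bigVOne (LaurentPolynomial K) n).shift (shiftThree p q))
      fun B k x y => L3 B k x y p q := by
  have hT : ∀ (j : ℤ) (F : ℤ → Series K) (k : ℤ),
      substLambdaInv (LaurentPolynomial.T j) F k = (1 : K) • F (k - j) := fun j F k => by
    rw [one_smul, substLambdaInv_T]
  have h0 := (translates_virZero_t (n := n) (K := K) substLambdaInv).add
    ((translates_virZero_s substLambdaInv).const_smul (-1))
  have h := ((((((((translates_virMinusOne_t (n := n) (K := K) substLambdaInv).add
    ((translates_virOne_s substLambdaInv).const_smul (-1))).add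
    (translates_virOne_t substLambdaInv)).add
    ((translates_virMinusOne_s substLambdaInv).const_smul (-1))).add
    (h0.smul (hT 1))).add (h0.smul (hT (-1)))).add
    ((translates_pderiv_t_one substLambdaInv).const_smul p)).add
    ((translates_pderiv_s_one substLambdaInv).const_smul q)).add
    (((translates_one substLambdaInv).const_smul (n * (p - q))).smul (hT 1))
  -- `z⁻¹ (-z)^(i+1) = -(-z)^i`
  have hinv : (MvPolynomial.C (LaurentPolynomial.T (-1)) : MvPolynomial Var (LaurentPolynomial K)) *
      MvPolynomial.C (LaurentPolynomial.T 1) = 1 := by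
    rw [← map_mul, ← LaurentPolynomial.T_add]
    simp
  refine h.congr ?_ fun B _ k x y _ _ => ?_
  · funext o
    rcases o with _ | i | i
    · simp [bigVZero, bigVMinusOne, bigVOne, const_smul_eq, shiftThree,
        MvPolynomial.smul_eq_C_mul]
      ring
    · rcases pnat_eq_one_or_succ i with rfl | ⟨j, rfl⟩
      · simp [bigVZero, bigVMinusOne, bigVOne, const_smul_eq, MvPolynomial.smul_eq_C_mul,
          -PNat.add_coe]
        simp [pow_succ]
        linear_combination MvPolynomial.C (LaurentPolynomial.C p) * hinv
      · simp [bigVZero, bigVMinusOne, bigVOne, MvPolynomial.smul_eq_C_mul,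
          -PNat.add_coe]
        simp [pow_succ]
        linear_combination (MvPolynomial.C (LaurentPolynomial.C p) *
          MvPolynomial.C (LaurentPolynomial.T 1) ^ (j : ℕ) * (-1) ^ (j : ℕ)) * hinv
    · rcases pnat_eq_one_or_succ i with rfl | ⟨j, rfl⟩
      · simp [bigVZero, bigVMinusOne, bigVOne, const_smul_eq, MvPolynomial.smul_eq_C_mul,
          -PNat.add_coe]
        simp [pow_succ]
        linear_combination MvPolynomial.C (LaurentPolynomial.C q) * hinv
      · simp [bigVZero, bigVMinusOne, bigVOne, MvPolynomial.smul_eq_C_mul,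
          -PNat.add_coe]
        simp [pow_succ]
        linear_combination (MvPolynomial.C (LaurentPolynomial.C q) *
          MvPolynomial.C (LaurentPolynomial.T 1) ^ (j : ℕ) * (-1) ^ (j : ℕ)) * hinv
  · simp only [L3, Finset.sum_sub_distrib, Finset.sum_add_distrib, add_mul, one_mul,
      sub_neg_eq_add, ← Finset.mul_sum]
    ring

end Cases

/-! ### The group algebra of moves -/

section WalkAlgebra

variable (K : Type*) [Field K] (n : ℕ)

/-- The group algebra in which walks without the non-intersection condition are counted: the
basis element at `(M, u)` stands for a displacement `u` of the walkers of weight `M`. -/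
abbrev WalkAlg := AddMonoidAlgebra K (ℤ × (Fin n → ℤ))

variable {n}

/-- The displacement `u` with weight `M`, as an element of the group algebra. -/
def move (M : ℤ) (u : Fin n → ℤ) : WalkAlg K n := AddMonoidAlgebra.single (M, u) 1

theorem move_zero : move K 0 (0 : Fin n → ℤ) = 1 := rfl

theorem move_mul_move (M N : ℤ) (u v : Fin n → ℤ) :
    move K M u * move K N v = move K (M + N) (u + v) := by
  simp [move, AddMonoidAlgebra.single_mul_single]

theorem prod_move {ι : Type*} (s : Finset ι) (f : ι → ℤ) (u : ι → Fin n → ℤ) :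
    ∏ i ∈ s, move K (f i) (u i) = move K (∑ i ∈ s, f i) (∑ i ∈ s, u i) := by
  classical
  induction s using Finset.induction_on with
  | empty => simp [move_zero]
  | insert i s hi ih => rw [Finset.prod_insert hi, ih, move_mul_move, Finset.sum_insert hi,
      Finset.sum_insert hi]

theorem coeff_move_mul (M N : ℤ) (u v : Fin n → ℤ) (f : WalkAlg K n) :
    (move K M u * f).coeff (N, v) = f.coeff (N - M, v - u) := by
  rw [move, AddMonoidAlgebra.coeff_single_mul_apply, one_mul, Prod.neg_mk, Prod.mk_add_mk,
    neg_add_eq_sub, neg_add_eq_sub]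

/-- The operator that multiplies a displacement by its `i`-th component. -/
def eulerMap (i : Fin n) : WalkAlg K n →ₗ[K] WalkAlg K n where
  toFun f := AddMonoidAlgebra.ofCoeff <|
    Finsupp.onFinset f.coeff.support (fun g => (g.2 i : K) * f.coeff g) fun g hg => by
      rw [Finsupp.mem_support_iff]
      exact right_ne_zero_of_mul hg
  map_add' f g := by
    ext
    simp [mul_add]
  map_smul' c f := by
    ext
    simp [mul_left_comm]

theorem eulerMap_single (i : Fin n) (a : ℤ × (Fin n → ℤ)) (r : K) :
    eulerMap K i (AddMonoidAlgebra.single a r) =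
      AddMonoidAlgebra.single a ((a.2 i : K) * r) := by
  ext g
  change (g.2 i : K) * (AddMonoidAlgebra.single a r).coeff g = _
  rw [AddMonoidAlgebra.coeff_single, AddMonoidAlgebra.coeff_single, Finsupp.single_apply,
    Finsupp.single_apply]
  split_ifs with h
  · rw [h]
  · rw [mul_zero]

/-- The operator `eulerMap` is a derivation. -/
def eulerDer (i : Fin n) : Derivation K (WalkAlg K n) (WalkAlg K n) :=
  Derivation.mk' (eulerMap K i) fun f g => by
    simp only [smul_eq_mul]
    induction f using AddMonoidAlgebra.induction_linear with
    | zero => simp only [zero_mul, mul_zero, map_zero, add_zero]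
    | add f f' hf hf' => rw [add_mul, map_add, map_add, hf, hf']; ring
    | single a r =>
      induction g using AddMonoidAlgebra.induction_linear with
      | zero => simp only [zero_mul, mul_zero, map_zero, add_zero]
      | add g g' hg hg' => rw [mul_add, map_add, map_add, hg, hg']; ring
      | single b s =>
        rw [AddMonoidAlgebra.single_mul_single, eulerMap_single, eulerMap_single,
          eulerMap_single, AddMonoidAlgebra.single_mul_single, AddMonoidAlgebra.single_mul_single,
          add_comm b a, ← AddMonoidAlgebra.single_add]
        congr 1
        push_cast [Prod.snd_add, Pi.add_apply]
        ring

theorem coeff_eulerDer (i : Fin n) (f : WalkAlg K n) (g : ℤ × (Fin n → ℤ)) :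
    (eulerDer K i f).coeff g = (g.2 i : K) * f.coeff g := rfl

theorem eulerDer_move (i : Fin n) (M : ℤ) (u : Fin n → ℤ) :
    eulerDer K i (move K M u) = (u i : WalkAlg K n) * move K M u := by
  rw [← zsmul_eq_mul, ← Int.cast_smul_eq_zsmul K, move, AddMonoidAlgebra.smul_single, smul_eq_mul]
  exact eulerMap_single K i _ _

/-! ### Alternating counts -/

/-- The alternating sum of the numbers of free walks of weight `M` from `x` to the permutations
of `y`, as a linear function of the generating function of the free walks. -/
def altCount (M : ℤ) (x y : Fin n → ℤ) : WalkAlg K n →ₗ[K] K where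
  toFun P := ∑ σ : Equiv.Perm (Fin n), ((Equiv.Perm.sign σ : ℤ) : K) * P.coeff (M, y ∘ σ - x)
  map_add' P Q := by simp [mul_add, Finset.sum_add_distrib]
  map_smul' c P := by simp [Finset.mul_sum, mul_left_comm]

variable {K}

theorem altCount_apply (M : ℤ) (x y : Fin n → ℤ) (P : WalkAlg K n) :
    altCount K M x y P =
      ∑ σ : Equiv.Perm (Fin n), ((Equiv.Perm.sign σ : ℤ) : K) * P.coeff (M, y ∘ σ - x) := rfl

theorem altCount_comp_right (M : ℤ) (x y : Fin n → ℤ) (τ : Equiv.Perm (Fin n))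
    (P : WalkAlg K n) :
    altCount K M x (y ∘ τ) P = ((Equiv.Perm.sign τ : ℤ) : K) * altCount K M x y P := by
  symm
  rw [altCount_apply, altCount_apply, Finset.mul_sum, ← Equiv.sum_comp (Equiv.mulLeft τ)]
  refine Finset.sum_congr rfl fun σ _ => ?_
  have h : Equiv.Perm.sign τ * Equiv.Perm.sign (τ * σ) = Equiv.Perm.sign σ := by
    rw [Equiv.Perm.sign_mul, ← mul_assoc, Int.units_mul_self, one_mul]
  rw [Equiv.coe_mulLeft, Equiv.Perm.coe_mul, ← Function.comp_assoc, ← mul_assoc, ← Int.cast_mul,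
    ← Units.val_mul, h]

/-- The generating function does not change under permutations of the walkers. -/
def IsSymm (P : WalkAlg K n) : Prop :=
  ∀ (σ : Equiv.Perm (Fin n)) (M : ℤ) (u : Fin n → ℤ), P.coeff (M, u ∘ σ) = P.coeff (M, u)

theorem altCount_comp_left {P : WalkAlg K n} (hP : IsSymm P) (M : ℤ) (x y : Fin n → ℤ)
    (τ : Equiv.Perm (Fin n)) :
    altCount K M (x ∘ τ) y P = ((Equiv.Perm.sign τ : ℤ) : K) * altCount K M x y P := by
  rw [altCount_apply, altCount_apply, Finset.mul_sum, ← Equiv.sum_comp (Equiv.mulRight τ)]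
  refine Finset.sum_congr rfl fun σ _ => ?_
  have h : y ∘ ⇑(σ * τ) - x ∘ τ = (y ∘ σ - x) ∘ τ := rfl
  rw [Equiv.coe_mulRight, h, hP, Equiv.Perm.sign_mul, Units.val_mul]
  push_cast
  ring

theorem altCount_swap_right (M : ℤ) (x y : Fin n → ℤ) (P : WalkAlg K n) (a b : Fin n)
    (h : a ≠ b) : altCount K M x (y ∘ Equiv.swap a b) P = -altCount K M x y P := by
  rw [altCount_comp_right, Equiv.Perm.sign_swap h]
  simp

theorem altCount_swap_left {P : WalkAlg K n} (hP : IsSymm P) (M : ℤ) (x y : Fin n → ℤ)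
    (a b : Fin n) (h : a ≠ b) :
    altCount K M (x ∘ Equiv.swap a b) y P = -altCount K M x y P := by
  rw [altCount_comp_left hP, Equiv.Perm.sign_swap h]
  simp

/-- A function that changes sign when two entries of its argument are exchanged vanishes when
two entries are equal. -/
theorem eq_zero_of_alternating [CharZero K] {f : (Fin n → ℤ) → K}
    (hf : ∀ x a b, a ≠ b → f (x ∘ Equiv.swap a b) = -f x) {x : Fin n → ℤ}
    (hx : ¬ Function.Injective x) : f x = 0 := by
  simp only [Function.Injective, not_forall] at hx
  obtain ⟨a, b, hab, hne⟩ := hx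
  have h : x ∘ Equiv.swap a b = x := by
    funext c
    rw [Function.comp_apply, Equiv.swap_apply_def]
    split_ifs with h1 h2
    · rw [h1, hab]
    · rw [h2, hab]
    · rfl
  exact self_eq_neg.1 (by rw [← hf x a b hne, h])

theorem altCount_intCast_mul (M : ℤ) (x y : Fin n → ℤ) (c : ℤ) (P : WalkAlg K n) :
    altCount K M x y (c * P) = c * altCount K M x y P := by
  rw [← zsmul_eq_mul, map_zsmul, zsmul_eq_mul]

theorem altCount_natCast_mul (M : ℤ) (x y : Fin n → ℤ) (c : ℕ) (P : WalkAlg K n) :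
    altCount K M x y (c * P) = c * altCount K M x y P := by
  rw [← nsmul_eq_mul, map_nsmul, nsmul_eq_mul]

theorem altCount_sub_weight (M N : ℤ) (x y : Fin n → ℤ) (P : WalkAlg K n) :
    altCount K (M - N) x y P = altCount K M x y (move K N 0 * P) := by
  simp only [altCount_apply, coeff_move_mul, sub_zero]

theorem altCount_sub_left (M : ℤ) (x y u : Fin n → ℤ) (P : WalkAlg K n) :
    altCount K M (x - u) y P = altCount K M x y (move K 0 (-u) * P) := by
  simp only [altCount_apply, coeff_move_mul, sub_zero]
  simp only [sub_neg_eq_add, sub_sub_eq_add_sub, sub_add_eq_add_sub]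

theorem single_comp_perm (σ : Equiv.Perm (Fin n)) (i : Fin n) (c : ℤ) :
    (Pi.single (σ i) c : Fin n → ℤ) ∘ σ = Pi.single i c := by
  funext j
  simp [Pi.single_apply]

/-- A sum over the walkers with a displacement of the end point is, inside the alternating
count, a sum over the displaced walkers. -/
theorem sum_mul_altCount_add_right (f : ℤ → K) (M c : ℤ) (x y : Fin n → ℤ) (P : WalkAlg K n) :
    ∑ i, f (y i) * altCount K M x (y + Pi.single i c) P =
      ∑ σ : Equiv.Perm (Fin n), ((Equiv.Perm.sign σ : ℤ) : K) *
        ∑ i, f ((y ∘ σ) i) * P.coeff (M, y ∘ σ - x + Pi.single i c) := by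
  simp only [altCount_apply, Finset.mul_sum]
  rw [Finset.sum_comm]
  refine Finset.sum_congr rfl fun σ _ => ?_
  rw [← Equiv.sum_comp σ]
  refine Finset.sum_congr rfl fun i _ => ?_
  have h : (y + Pi.single (σ i) c) ∘ σ - x = y ∘ σ - x + Pi.single i c := by
    rw [← single_comp_perm σ i c, sub_add_eq_add_sub]
    rfl
  rw [h, Function.comp_apply]
  ring

theorem sum_altCount_add_right (M c : ℤ) (x y : Fin n → ℤ) (P : WalkAlg K n) :
    ∑ i, altCount K M x (y + Pi.single i c) P =
      altCount K M x y (∑ i, move K 0 (Pi.single i (-c)) * P) := by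
  have h := sum_mul_altCount_add_right (fun _ => (1 : K)) M c x y P
  simp only [one_mul] at h
  rw [h, altCount_apply]
  refine Finset.sum_congr rfl fun σ _ => ?_
  rw [AddMonoidAlgebra.coeff_sum, Finsupp.finsetSum_apply]
  congr 1
  refine Finset.sum_congr rfl fun i _ => ?_
  rw [coeff_move_mul, sub_zero, Pi.single_neg, sub_neg_eq_add]

theorem sum_altCount_sub_left (M c : ℤ) (x y : Fin n → ℤ) (P : WalkAlg K n) :
    ∑ i, altCount K M (x - Pi.single i c) y P =
      altCount K M x y (∑ i, move K 0 (Pi.single i (-c)) * P) := by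
  simp only [altCount_sub_left, map_sum, Pi.single_neg]

/-- The Euler derivations, composed with displacements, in terms of alternating counts. -/
theorem sum_euler_altCount (M c : ℤ) (x y : Fin n → ℤ) (P : WalkAlg K n) :
    ∑ i, (((y i : K) + c) * altCount K M x (y + Pi.single i c) P -
        (x i : K) * altCount K M (x - Pi.single i c) y P) =
      altCount K M x y (∑ i, move K 0 (Pi.single i (-c)) * eulerDer K i P) := by
  rw [Finset.sum_sub_distrib, sum_mul_altCount_add_right (fun a => (a : K) + c)]
  simp only [altCount_apply, Finset.mul_sum]
  rw [Finset.sum_comm (s := (Finset.univ : Finset (Fin n))), ← Finset.sum_sub_distrib]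
  refine Finset.sum_congr rfl fun σ _ => ?_
  rw [← Finset.sum_sub_distrib, AddMonoidAlgebra.coeff_sum, Finsupp.finsetSum_apply,
    Finset.mul_sum]
  refine Finset.sum_congr rfl fun i _ => ?_
  have h : y ∘ σ - (x - Pi.single i c) = y ∘ σ - x + Pi.single i c := by abel
  rw [coeff_move_mul, coeff_eulerDer, sub_zero, Pi.single_neg, sub_neg_eq_add, h]
  simp only [Pi.add_apply, Pi.sub_apply, Pi.single_eq_same]
  push_cast
  ring

theorem sum_sub_mul_altCount (M : ℤ) (x y : Fin n → ℤ) (P : WalkAlg K n) :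
    (∑ i, ((y i : K) - (x i : K))) * altCount K M x y P =
      altCount K M x y (∑ i, eulerDer K i P) := by
  have h := sum_euler_altCount M 0 x y P
  simp only [Pi.single_zero, add_zero, sub_zero, neg_zero, Int.cast_zero, move_zero, one_mul,
    ← sub_mul, ← Finset.sum_mul] at h
  exact h

end WalkAlgebra

/-! ### Counting non-intersecting walks -/

section Counting

variable {n : ℕ}

theorem isWalk_succ {N : ℕ} {step : ℕ → (Fin n → ℤ) → (Fin n → ℤ) → Prop} {x y : Fin n → ℤ}
    {w : Fin (N + 2) → Fin n → ℤ} :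
    IsWalk (N + 1) step x y w ↔
      IsWalk N step x (w (Fin.last N).castSucc) (fun j => w j.castSucc) ∧
        w (Fin.last (N + 1)) = y ∧ StrictMono y ∧ step N (w (Fin.last N).castSucc) y := by
  constructor
  · rintro ⟨h0, h1, h2, h3⟩
    refine ⟨⟨h0, rfl, fun j => h2 _, fun j => h3 j.castSucc⟩, h1, h1 ▸ h2 _, ?_⟩
    have := h3 (Fin.last N)
    rwa [Fin.succ_last, h1] at this
  · rintro ⟨⟨h0, -, h2, h3⟩, h1, h4, h5⟩
    refine ⟨h0, h1, fun j => ?_, fun j => ?_⟩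
    · refine Fin.lastCases ?_ (fun j => ?_) j
      · rwa [h1]
      · exact h2 j
    · refine Fin.lastCases ?_ (fun j => ?_) j
      · rw [Fin.succ_last, h1]
        exact h5
      · exact h3 j

variable (K : Type*) [Field K]

/-- The generating function of the displacements in `S`, where the weight of a displacement is
the sum over the walkers of the weights `g` of their moves. -/
def stepGen (g : ℤ → ℤ) (S : Finset (Fin n → ℤ)) : WalkAlg K n :=
  ∑ v ∈ S, move K (∑ i, g (v i)) v

/-- Sets of displacements that do not depend on the order of the walkers and do not allow two
neighbouring walkers to exchange their positions. -/
structure IsStepSet (S : Finset (Fin n → ℤ)) : Prop where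
  comp_perm : ∀ v ∈ S, ∀ σ : Equiv.Perm (Fin n), v ∘ σ ∈ S
  sub_le_one : ∀ v ∈ S, ∀ a b, v b - v a ≤ 1

variable {K} {S : Finset (Fin n → ℤ)}

theorem IsStepSet.monotone_sub (hS : IsStepSet S) {v y : Fin n → ℤ} (hv : v ∈ S)
    (hy : StrictMono y) : Monotone (y - v) := by
  intro a b hab
  rcases hab.eq_or_lt with rfl | hab
  · exact le_rfl
  · have h1 := hy hab
    have h2 := hS.sub_le_one v hv a b
    simp only [Pi.sub_apply]
    omega

theorem coeff_stepGen_mul (g : ℤ → ℤ) (S : Finset (Fin n → ℤ)) (P : WalkAlg K n) (M : ℤ)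
    (u : Fin n → ℤ) :
    (stepGen K g S * P).coeff (M, u) = ∑ v ∈ S, P.coeff (M - ∑ i, g (v i), u - v) := by
  rw [stepGen, Finset.sum_mul, AddMonoidAlgebra.coeff_sum, Finsupp.finsetSum_apply]
  simp only [coeff_move_mul]

theorem IsStepSet.sum_comp {M : Type*} [AddCommMonoid M] (hS : IsStepSet S)
    (σ : Equiv.Perm (Fin n)) (f : (Fin n → ℤ) → M) : ∑ v ∈ S, f (v ∘ σ) = ∑ v ∈ S, f v := by
  refine Finset.sum_bij' (fun v _ => v ∘ σ) (fun v _ => v ∘ σ.symm)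
    (fun v hv => hS.comp_perm v hv σ) (fun v hv => hS.comp_perm v hv σ.symm) ?_ ?_ ?_
  · intro v _
    funext i
    simp
  · intro v _
    funext i
    simp
  · intro v _
    rfl

theorem isSymm_one : IsSymm (1 : WalkAlg K n) := by
  intro σ M u
  rw [← move_zero, move, AddMonoidAlgebra.coeff_single, Finsupp.single_apply,
    Finsupp.single_apply]
  refine if_congr ?_ rfl rfl
  simp only [Prod.mk.injEq]
  refine and_congr_right fun _ => ⟨fun h => ?_, fun h => ?_⟩
  · funext i
    simpa using congrFun h (σ.symm i)
  · rw [← h]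
    rfl

theorem IsSymm.stepGen_mul {P : WalkAlg K n} (hP : IsSymm P) (hS : IsStepSet S) (g : ℤ → ℤ) :
    IsSymm (stepGen K g S * P) := by
  intro σ M u
  rw [coeff_stepGen_mul, coeff_stepGen_mul, ← hS.sum_comp σ]
  refine Finset.sum_congr rfl fun v _ => ?_
  have h : u ∘ σ - v ∘ σ = (u - v) ∘ σ := rfl
  rw [h, hP]
  congr 3
  exact Equiv.sum_comp σ fun i => g (v i)

theorem isSymm_prod_stepGen {S : ℕ → Finset (Fin n → ℤ)} (hS : ∀ j, IsStepSet (S j))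
    (g : ℤ → ℤ) (N : ℕ) : IsSymm (∏ j ∈ Finset.range N, stepGen K g (S j)) := by
  induction N with
  | zero => exact isSymm_one
  | succ N ih =>
    rw [Finset.prod_range_succ, mul_comm]
    exact ih.stepGen_mul (hS N) g

/-- The recursion of the alternating count in the last step. -/
theorem altCount_stepGen_mul (hS : IsStepSet S) (g : ℤ → ℤ) (P : WalkAlg K n) (M : ℤ)
    (x y : Fin n → ℤ) :
    altCount K M x y (stepGen K g S * P) =
      ∑ v ∈ S, altCount K (M - ∑ i, g (v i)) x (y - v) P := by
  simp only [altCount_apply, coeff_stepGen_mul, Finset.mul_sum]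
  rw [Finset.sum_comm (s := S)]
  refine Finset.sum_congr rfl fun σ _ => ?_
  rw [← hS.sum_comp σ]
  refine Finset.sum_congr rfl fun v _ => ?_
  have h : y ∘ σ - x - v ∘ σ = (y - v) ∘ σ - x := sub_right_comm _ _ _
  rw [h]
  congr 4
  exact Equiv.sum_comp σ fun i => g (v i)

/-- On strictly increasing end points only the identity permutation contributes to the count of walks
of length zero. -/
theorem altCount_one {x y : Fin n → ℤ} (hx : StrictMono x) (hy : StrictMono y) (M : ℤ) :
    altCount K M x y 1 = if M = 0 ∧ x = y then 1 else 0 := by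
  have h1 : ∀ σ : Equiv.Perm (Fin n), y ∘ σ - x = 0 → σ = 1 ∧ x = y := by
    intro σ h
    have h2 : y ∘ σ = x := sub_eq_zero.1 h
    have h3 : x = y := by
      refine (StrictMono.range_inj hx hy).1 ?_
      rw [← h2, σ.surjective.range_comp]
    refine ⟨Equiv.ext fun i => hy.injective ?_, h3⟩
    rw [h3] at h2
    exact congrFun h2 i
  rw [altCount_apply, Finset.sum_eq_single 1]
  · rw [← move_zero, move, AddMonoidAlgebra.coeff_single, Finsupp.single_apply]
    simp only [Equiv.Perm.sign_one, Units.val_one, Int.cast_one, one_mul]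
    refine if_congr ?_ rfl rfl
    rw [Prod.mk.injEq, eq_comm (a := (0 : ℤ)), eq_comm (a := (0 : Fin n → ℤ)), sub_eq_zero,
      eq_comm (a := x)]
    rfl
  · intro σ _ hσ
    rw [← move_zero, move, AddMonoidAlgebra.coeff_single, Finsupp.single_apply, if_neg, mul_zero]
    intro h
    exact hσ (h1 σ (Prod.mk.inj h).2.symm).1
  · simp

variable [CharZero K]

theorem altCount_eq_zero_of_left {P : WalkAlg K n} (hP : IsSymm P) (M : ℤ) {x y : Fin n → ℤ}
    (hx : Monotone x) (h : ¬ StrictMono x) : altCount K M x y P = 0 :=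
  eq_zero_of_alternating (f := fun x => altCount K M x y P)
    (fun x a b hab => altCount_swap_left hP M x y a b hab)
    fun hi => h (hx.strictMono_of_injective hi)

theorem altCount_eq_zero_of_right (P : WalkAlg K n) (M : ℤ) {x y : Fin n → ℤ}
    (hy : Monotone y) (h : ¬ StrictMono y) : altCount K M x y P = 0 :=
  eq_zero_of_alternating (f := fun y => altCount K M x y P)
    (fun y a b hab => altCount_swap_right M x y P a b hab)
    fun hi => h (hy.strictMono_of_injective hi)

/-- The determinantal count of non-intersecting walks: on increasing end points, the number of
walks of given weight is the alternating count of the free walks. The induction on the number of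
instants removes the last step. -/
theorem exists_finset_walks {S : ℕ → Finset (Fin n → ℤ)} (hS : ∀ j, IsStepSet (S j))
    (g : ℤ → ℤ) {x : Fin n → ℤ} (hx : Monotone x) (N : ℕ) (M : ℤ) {y : Fin n → ℤ}
    (hy : Monotone y) :
    ∃ F : Finset (Fin (N + 1) → Fin n → ℤ),
      (∀ w, w ∈ F ↔ IsWalk N (fun j a a' => a' - a ∈ S j) x y w ∧
        ∑ j : Fin N, ∑ i, g (w j.succ i - w j.castSucc i) = M) ∧
      (F.card : K) = altCount K M x y (∏ j ∈ Finset.range N, stepGen K g (S j)) := by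
  classical
  induction N generalizing M y with
  | zero =>
    by_cases hs : StrictMono x ∧ StrictMono y
    · rw [Finset.range_zero, Finset.prod_empty, altCount_one hs.1 hs.2]
      by_cases h : M = 0 ∧ x = y
      · refine ⟨{fun _ => x}, fun w => ?_, by rw [if_pos h]; simp⟩
        rw [Finset.mem_singleton]
        constructor
        · rintro rfl
          exact ⟨⟨rfl, h.2, fun _ => hs.1, fun j => j.elim0⟩, by simp [h.1]⟩
        · rintro ⟨hw, -⟩
          funext j
          rw [show j = 0 from Fin.fin_one_eq_zero j]
          exact hw.1
      · refine ⟨∅, fun w => ?_, by rw [if_neg h]; simp⟩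
        simp only [Finset.notMem_empty, false_iff]
        rintro ⟨hw, hM⟩
        exact h ⟨by rw [← hM]; simp, hw.1.symm.trans hw.2.1⟩
    · refine ⟨∅, fun w => ?_, ?_⟩
      · simp only [Finset.notMem_empty, false_iff]
        rintro ⟨hw, -⟩
        exact hs ⟨hw.1 ▸ hw.2.2.1 0, hw.2.1 ▸ hw.2.2.1 _⟩
      · rw [Finset.card_empty, Nat.cast_zero]
        symm
        rw [not_and_or] at hs
        rcases hs with hs | hs
        · exact altCount_eq_zero_of_left isSymm_one M hx hs
        · exact altCount_eq_zero_of_right _ M hy hs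
  | succ N ih =>
    by_cases hs : StrictMono y
    · have hF : ∀ v, ∃ F : Finset (Fin (N + 1) → Fin n → ℤ), v ∈ S N →
          (∀ w, w ∈ F ↔ IsWalk N (fun j a a' => a' - a ∈ S j) x (y - v) w ∧
            ∑ j : Fin N, ∑ i, g (w j.succ i - w j.castSucc i) = M - ∑ i, g (v i)) ∧
          (F.card : K) = altCount K (M - ∑ i, g (v i)) x (y - v)
            (∏ j ∈ Finset.range N, stepGen K g (S j)) := by
        intro v
        by_cases hv : v ∈ S N
        · obtain ⟨F, hF⟩ := ih (M - ∑ i, g (v i)) ((hS N).monotone_sub hv hs)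
          exact ⟨F, fun _ => hF⟩
        · exact ⟨∅, fun h => absurd h hv⟩
      choose F hF using hF
      -- the walks to `y` extend the walks to `y - v` by the step `v`
      have hinj : Function.Injective fun w : Fin (N + 1) → Fin n → ℤ =>
          (Fin.snoc w y : Fin (N + 2) → Fin n → ℤ) := by
        intro w w' h
        have h1 := congrArg (Fin.init (α := fun _ => Fin n → ℤ)) h
        simpa using h1
      refine ⟨(S N).biUnion fun v => (F v).map ⟨_, hinj⟩, fun w => ?_, ?_⟩
      · have hsum : ∀ v, w (Fin.last (N + 1)) = y → w (Fin.last N).castSucc = y - v →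
            (∑ j : Fin (N + 1), ∑ i, g (w j.succ i - w j.castSucc i) = M ↔
              ∑ j : Fin N, ∑ i, g (w j.castSucc.succ i - w j.castSucc.castSucc i) =
                M - ∑ i, g (v i)) := by
          intro v h1 h2
          rw [Fin.sum_univ_castSucc, Fin.succ_last, h1, h2]
          simp only [Pi.sub_apply, sub_sub_cancel]
          exact eq_sub_iff_add_eq.symm
        rw [isWalk_succ]
        simp only [Finset.mem_biUnion, Finset.mem_map, Function.Embedding.coeFn_mk]
        constructor
        · rintro ⟨v, hv, w', hw', rfl⟩
          rw [(hF v hv).1] at hw'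
          have h2 : (Fin.snoc w' y : Fin (N + 2) → Fin n → ℤ) (Fin.last N).castSucc = y - v := by
            rw [Fin.snoc_castSucc]
            exact hw'.1.2.1
          have h1 : (Fin.snoc w' y : Fin (N + 2) → Fin n → ℤ) (Fin.last (N + 1)) = y :=
            Fin.snoc_last _ _
          rw [hsum v h1 h2, h2]
          refine ⟨⟨?_, h1, hs, ?_⟩, ?_⟩
          · simpa only [Fin.snoc_castSucc] using hw'.1
          · rwa [sub_sub_cancel]
          · simp only [← Fin.castSucc_succ, Fin.snoc_castSucc]
            exact hw'.2
        · rintro ⟨⟨hw, h1, -, hv⟩, hM⟩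
          refine ⟨y - w (Fin.last N).castSucc, hv, fun j => w j.castSucc, ?_, ?_⟩
          · rw [(hF _ hv).1, sub_sub_cancel]
            exact ⟨hw, (hsum _ h1 (sub_sub_cancel _ _).symm).1 hM⟩
          · rw [← h1]
            exact Fin.snoc_init_self w
      · rw [Finset.card_biUnion, Nat.cast_sum, Finset.prod_range_succ, mul_comm,
          altCount_stepGen_mul (hS N)]
        · refine Finset.sum_congr rfl fun v hv => ?_
          rw [Finset.card_map, (hF v hv).2]
        · intro v hv v' hv' hne
          refine Finset.disjoint_left.2 fun w hw hw' => hne ?_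
          obtain ⟨w1, h1, rfl⟩ := Finset.mem_map.1 hw
          obtain ⟨w2, h2, h3⟩ := Finset.mem_map.1 hw'
          rw [hinj h3] at h2
          have h4 := ((hF v hv).1 _).1 h1
          have h5 := ((hF v' hv').1 _).1 h2
          exact sub_right_injective (h4.1.2.1.symm.trans h5.1.2.1)
    · refine ⟨∅, fun w => ?_, ?_⟩
      · simp only [Finset.notMem_empty, false_iff]
        rintro ⟨hw, -⟩
        exact hs (hw.2.1 ▸ hw.2.2.1 _)
      · rw [Finset.card_empty, Nat.cast_zero, altCount_eq_zero_of_right _ M hy hs]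

theorem ncard_walks {S : ℕ → Finset (Fin n → ℤ)} (hS : ∀ j, IsStepSet (S j))
    (g : ℤ → ℤ) (N : ℕ) (M : ℤ) {x y : Fin n → ℤ} (hx : Monotone x) (hy : Monotone y) :
    (Set.ncard {w : Fin (N + 1) → Fin n → ℤ |
      IsWalk N (fun j a a' => a' - a ∈ S j) x y w ∧
        ∑ j : Fin N, ∑ i, g (w j.succ i - w j.castSucc i) = M} : K) =
      altCount K M x y (∏ j ∈ Finset.range N, stepGen K g (S j)) := by
  obtain ⟨F, hF, hc⟩ := exists_finset_walks (K := K) hS g hx N M hy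
  rw [← hc, ← Set.ncard_coe_finset]
  congr 2
  ext w
  exact (hF w).symm

end Counting

/-! ### Generating functions of the three walks -/

section Generating

variable {K : Type*} [Field K] {n : ℕ}

/-- The displacements of exactly one walker by `c`. -/
def singleSteps (n : ℕ) (c : ℤ) : Finset (Fin n → ℤ) := Finset.univ.image fun i => Pi.single i c

/-- The displacements in which every walker moves by `0` or by `c`. -/
def boxSteps (n : ℕ) (c : ℤ) : Finset (Fin n → ℤ) := Fintype.piFinset fun _ => {0, c}

theorem mem_singleSteps {c : ℤ} {v : Fin n → ℤ} : v ∈ singleSteps n c ↔ ∃ i, Pi.single i c = v := by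
  simp [singleSteps]

theorem mem_boxSteps {c : ℤ} {v : Fin n → ℤ} : v ∈ boxSteps n c ↔ ∀ i, v i = 0 ∨ v i = c := by
  simp [boxSteps]

theorem isStepSet_singleSteps {c : ℤ} (hc : |c| = 1) : IsStepSet (singleSteps n c) where
  comp_perm v hv σ := by
    obtain ⟨i, rfl⟩ := mem_singleSteps.1 hv
    rw [← σ.apply_symm_apply i, single_comp_perm]
    exact mem_singleSteps.2 ⟨_, rfl⟩
  sub_le_one v hv a b := by
    obtain ⟨i, rfl⟩ := mem_singleSteps.1 hv
    rcases eq_or_eq_neg_of_abs_eq hc with rfl | rfl <;> simp only [Pi.single_apply] <;>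
      split_ifs <;> norm_num

theorem isStepSet_boxSteps {c : ℤ} (hc : |c| = 1) : IsStepSet (boxSteps n c) where
  comp_perm v hv σ := mem_boxSteps.2 fun i => mem_boxSteps.1 hv (σ i)
  sub_le_one v hv a b := by
    rcases eq_or_eq_neg_of_abs_eq hc with rfl | rfl <;>
      rcases mem_boxSteps.1 hv a with ha | ha <;> rcases mem_boxSteps.1 hv b with hb | hb <;>
        rw [ha, hb] <;> norm_num

theorem IsStepSet.union {S T : Finset (Fin n → ℤ)} (hS : IsStepSet S) (hT : IsStepSet T) :
    IsStepSet (S ∪ T) where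
  comp_perm v hv σ := by
    rcases Finset.mem_union.1 hv with hv | hv
    · exact Finset.mem_union_left _ (hS.comp_perm v hv σ)
    · exact Finset.mem_union_right _ (hT.comp_perm v hv σ)
  sub_le_one v hv a b := by
    rcases Finset.mem_union.1 hv with hv | hv
    · exact hS.sub_le_one v hv a b
    · exact hT.sub_le_one v hv a b

variable (K n)

/-- The generating function of the displacements of one walker by `c`, with weight `M`. -/
def singleGen (M c : ℤ) : WalkAlg K n := ∑ i, move K M (Pi.single i c)

/-- The generating function of the displacements in which every walker moves by `0` or by `c`,
where each move by `c` has weight `M`. -/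
def boxGen (M c : ℤ) : WalkAlg K n := ∏ i, (1 + move K M (Pi.single i c))

variable {K n}

theorem stepGen_singleSteps {g : ℤ → ℤ} (hg : g 0 = 0) {c : ℤ} (hc : c ≠ 0) :
    stepGen K g (singleSteps n c) = singleGen K n (g c) c := by
  rw [stepGen, singleSteps, Finset.sum_image]
  · refine Finset.sum_congr rfl fun i _ => ?_
    congr 1
    rw [Finset.sum_eq_single i]
    · rw [Pi.single_eq_same]
    · intro j _ hj
      rw [Pi.single_eq_of_ne hj, hg]
    · simp
  · intro i _ j _ h
    by_contra hij
    have := congrFun h i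
    simp only [Pi.single_eq_same, Pi.single_eq_of_ne hij] at this
    exact hc this

theorem stepGen_union (g : ℤ → ℤ) :
    stepGen K g (singleSteps n 1 ∪ singleSteps n (-1)) =
      stepGen K g (singleSteps n 1) + stepGen K g (singleSteps n (-1)) := by
  rw [stepGen, Finset.sum_union]
  · rfl
  · refine Finset.disjoint_left.2 fun v hv hv' => ?_
    obtain ⟨i, rfl⟩ := mem_singleSteps.1 hv
    obtain ⟨j, h⟩ := mem_singleSteps.1 hv'
    have := congrFun h i
    rw [Pi.single_eq_same, Pi.single_apply] at this
    split_ifs at this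
    omega

theorem stepGen_boxSteps {g : ℤ → ℤ} (hg : g 0 = 0) {c : ℤ} (hc : c ≠ 0) :
    stepGen K g (boxSteps n c) = boxGen K n (g c) c := by
  have h : boxGen K n (g c) c =
      ∏ i : Fin n, ∑ a ∈ ({0, c} : Finset ℤ), move K (g a) (Pi.single i a) := by
    refine Finset.prod_congr rfl fun i _ => ?_
    rw [Finset.sum_pair hc.symm, hg, Pi.single_zero, move_zero]
  rw [h, Finset.prod_univ_sum, stepGen, boxSteps]
  refine Finset.sum_congr rfl fun v _ => ?_
  rw [prod_move, Finset.univ_sum_single]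

theorem eulerDer_singleGen (i : Fin n) (M c : ℤ) :
    eulerDer K i (singleGen K n M c) = c * move K M (Pi.single i c) := by
  rw [singleGen, map_sum, Finset.sum_eq_single i]
  · rw [eulerDer_move, Pi.single_eq_same]
  · intro j _ hj
    rw [eulerDer_move, Pi.single_eq_of_ne hj.symm, Int.cast_zero, zero_mul]
  · simp

/-- The logarithmic Euler derivative of `∏ (1 + z T_i^c)` involves only the `i`-th factor. -/
theorem mul_eulerDer_boxGen (i : Fin n) (M c : ℤ) :
    (1 + move K M (Pi.single i c)) * eulerDer K i (boxGen K n M c) =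
      c * move K M (Pi.single i c) * boxGen K n M c := by
  have h0 : eulerDer K i (∏ j ∈ Finset.univ.erase i, (1 + move K M (Pi.single j c))) = 0 := by
    refine Finset.prod_induction _ (fun f => eulerDer K i f = 0) (fun f g hf hg => ?_) ?_ ?_
    · rw [Derivation.leibniz, hf, hg, smul_zero, smul_zero, add_zero]
    · exact Derivation.map_one_eq_zero _
    · intro j hj
      rw [map_add, Derivation.map_one_eq_zero, eulerDer_move,
        Pi.single_eq_of_ne (Finset.ne_of_mem_erase hj).symm, Int.cast_zero, zero_mul, add_zero]
  rw [boxGen, ← Finset.mul_prod_erase _ _ (Finset.mem_univ i), Derivation.leibniz, h0, map_add,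
    Derivation.map_one_eq_zero, eulerDer_move, Pi.single_eq_same]
  simp only [smul_eq_mul]
  ring

/-- If `b D a = c a`, then `b D (a ^ q) = q c a ^ q`. -/
theorem mul_derivation_pow {A : Type*} [CommRing A] [Algebra K A] (D : Derivation K A A)
    {a b c : A} (h : b * D a = c * a) (q : ℕ) : b * D (a ^ q) = q * c * a ^ q := by
  rw [Derivation.leibniz_pow]
  rcases q with _ | q
  · simp
  · rw [Nat.add_sub_cancel, nsmul_eq_mul, smul_eq_mul, pow_succ]
    linear_combination ((q + 1 : ℕ) : A) * a ^ q * h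

/-- The powers with a natural exponent, extended by `0` to negative exponents. -/
def powInt {A : Type*} [CommRing A] (a : A) (k : ℤ) : A := if k < 0 then 0 else a ^ k.toNat

/-- With the extension by `0` the rule for the derivative of a power holds for all integers `k`, the
factor `k` being zero in the only critical case. -/
theorem derivation_powInt {A : Type*} [CommRing A] [Algebra K A] (D : Derivation K A A) (a : A)
    (k : ℤ) : D (powInt a k) = k * (powInt a (k - 1) * D a) := by
  rcases lt_trichotomy k 0 with h | rfl | h
  · rw [powInt, powInt, if_pos h, if_pos (by omega), map_zero, zero_mul, mul_zero]
  · rw [powInt, if_neg (lt_irrefl _), Int.toNat_zero, pow_zero, Derivation.map_one_eq_zero,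
      Int.cast_zero, zero_mul]
  · have h1 : (k - 1).toNat = k.toNat - 1 := by omega
    have h2 : ((k.toNat : ℤ) : A) = k := by rw [Int.toNat_of_nonneg h.le]
    rw [powInt, powInt, if_neg (by omega), if_neg (by omega), Derivation.leibniz_pow, h1,
      nsmul_eq_mul, smul_eq_mul, ← h2, Int.cast_natCast]

theorem sum_fin_telescope {N : ℕ} (f : Fin (N + 1) → ℤ) :
    ∑ j : Fin N, (f j.succ - f j.castSucc) = f (Fin.last N) - f 0 := by
  have h := (Fin.sum_univ_succ f).symm.trans (Fin.sum_univ_castSucc f)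
  rw [Finset.sum_sub_distrib]
  omega

variable (K)

/-- The generating function of the first walk during one instant. -/
def genOne (n : ℕ) : WalkAlg K n := singleGen K n 1 1 + singleGen K n 1 (-1)

/-- The generating function of the second walk. A move by `a` has weight `|a| - a`, so that the total
weight is the number of effective moves minus the displacement, that is twice the number of steps to
the left. -/
def genTwo (n q : ℕ) (k : ℤ) : WalkAlg K n := boxGen K n 0 1 ^ q * powInt (singleGen K n 2 (-1)) k

/-- The generating function of the third walk. -/
def genThree (n p q : ℕ) : WalkAlg K n := boxGen K n 1 1 ^ p * boxGen K n 1 (-1) ^ q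

variable {K}

theorem isSymm_powInt_genOne (k : ℤ) : IsSymm (powInt (genOne K n) k) := by
  rw [powInt]
  split_ifs
  · intro σ M u
    simp
  · have h := isSymm_prod_stepGen (K := K) (fun _ : ℕ => (isStepSet_singleSteps (n := n) (c := 1)
      (by norm_num)).union (isStepSet_singleSteps (c := -1) (by norm_num))) (fun a => |a|) k.toNat
    rw [Finset.prod_const, Finset.card_range, stepGen_union, stepGen_singleSteps abs_zero (by norm_num),
      stepGen_singleSteps abs_zero (by norm_num)] at h
    exact h

theorem not_isWalk {N : ℕ} {step : ℕ → (Fin n → ℤ) → (Fin n → ℤ) → Prop} {x y : Fin n → ℤ}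
    (h : ¬ (StrictMono x ∧ StrictMono y)) (w : Fin (N + 1) → Fin n → ℤ) :
    ¬ IsWalk N step x y w := fun hw => h ⟨hw.1 ▸ hw.2.2.1 0, hw.2.1 ▸ hw.2.2.1 _⟩

theorem walkOne_eq_zero {k : ℤ} {x y : Fin n → ℤ} (h : ¬ (StrictMono x ∧ StrictMono y)) :
    walkOne k x y = 0 := by
  simp only [walkOne, not_isWalk h, false_and, Set.ofPred_false, Set.ncard_empty, ite_self]

theorem walkTwo_eq_zero {q : ℕ} {k : ℤ} {x y : Fin n → ℤ}
    (h : ¬ (StrictMono x ∧ StrictMono y)) : walkTwo q k x y = 0 := by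
  simp only [walkTwo, not_isWalk h, false_and, Set.ofPred_false, Set.ncard_empty, ite_self]

theorem mayRight_iff (a a' : Fin n → ℤ) : MayRight a a' ↔ a' - a ∈ boxSteps n 1 := by
  rw [mem_boxSteps]
  refine forall_congr' fun i => ?_
  rw [Pi.sub_apply]
  omega

theorem mayLeft_iff (a a' : Fin n → ℤ) : MayLeft a a' ↔ a' - a ∈ boxSteps n (-1) := by
  rw [mem_boxSteps]
  refine forall_congr' fun i => ?_
  rw [Pi.sub_apply]
  omega

theorem oneRight_iff (a a' : Fin n → ℤ) : OneRight a a' ↔ a' - a ∈ singleSteps n 1 := by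
  rw [mem_singleSteps]
  refine exists_congr fun i => ?_
  rw [eq_sub_iff_add_eq', eq_comm]

theorem oneLeft_iff (a a' : Fin n → ℤ) : OneLeft a a' ↔ a' - a ∈ singleSteps n (-1) := by
  rw [mem_singleSteps]
  refine exists_congr fun i => ?_
  rw [Pi.single_neg]
  constructor
  · rintro rfl
    abel
  · intro h
    rw [sub_eq_add_neg, h, add_sub_cancel]

theorem prod_range_add_ite {M : Type*} [CommMonoid M] (f : Finset (Fin n → ℤ) → M)
    (S T : Finset (Fin n → ℤ)) (p q : ℕ) :
    ∏ j ∈ Finset.range (p + q), f (if j < p then S else T) = f S ^ p * f T ^ q := by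
  rw [Finset.prod_range_add]
  congr 1
  · rw [Finset.prod_congr rfl fun j hj => by rw [if_pos (Finset.mem_range.1 hj)],
      Finset.prod_const, Finset.card_range]
  · simp

variable [CharZero K]

theorem walkOne_eq (k : ℤ) {x y : Fin n → ℤ} (hx : Monotone x) (hy : Monotone y) :
    (walkOne k x y : K) = altCount K k x y (powInt (genOne K n) k) := by
  rw [walkOne, powInt]
  split_ifs
  · simp
  · have h := ncard_walks (K := K) (fun _ : ℕ => (isStepSet_singleSteps (n := n) (c := 1)
      (by norm_num)).union (isStepSet_singleSteps (c := -1) (by norm_num))) (fun a => |a|) k.toNat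
      k hx hy
    rw [Finset.prod_const, Finset.card_range, stepGen_union, stepGen_singleSteps abs_zero (by norm_num),
      stepGen_singleSteps abs_zero (by norm_num)] at h
    refine Eq.trans ?_ h
    congr 3
    funext w
    refine propext (and_congr_left fun _ => ?_)
    simp only [oneLeft_iff, oneRight_iff, Finset.mem_union, or_comm]

theorem walkTwo_eq (q : ℕ) (k : ℤ) {x y : Fin n → ℤ} (hx : Monotone x) (hy : Monotone y) :
    (walkTwo q k x y : K) = altCount K (2 * k) x y (genTwo K n q k) := by
  rw [walkTwo, genTwo, powInt]
  split_ifs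
  · simp
  · have h := ncard_walks (K := K) (S := fun j : ℕ => if j < q then boxSteps n 1 else
      singleSteps n (-1)) (fun j => by
        split_ifs
        · exact isStepSet_boxSteps (by norm_num)
        · exact isStepSet_singleSteps (by norm_num)) (fun a => |a| - a) (q + k.toNat)
      (2 * k) hx hy
    rw [prod_range_add_ite, stepGen_boxSteps (by norm_num) (by norm_num),
      stepGen_singleSteps (by norm_num) (by norm_num)] at h
    refine Eq.trans ?_ h
    congr 3
    funext w
    have hstep : (fun j (a a' : Fin n → ℤ) => if j < q then MayRight a a' else OneLeft a a') =
        fun j a a' => a' - a ∈ if j < q then boxSteps n 1 else singleSteps n (-1) := by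
      funext j a a'
      split_ifs
      · rw [mayRight_iff]
      · rw [oneLeft_iff]
    rw [hstep]
    refine propext (and_congr_right fun hw => ?_)
    -- the displacements of each walker add up to the difference of its end points
    have htel : ∑ j : Fin (q + k.toNat), ∑ i, (w j.succ i - w j.castSucc i) =
        ∑ i, (y i - x i) := by
      rw [Finset.sum_comm]
      refine Finset.sum_congr rfl fun i _ => ?_
      rw [sum_fin_telescope fun j => w j i, hw.1, hw.2.1]
    rw [effectiveMoves, ← htel]
    simp only [Finset.sum_sub_distrib]
    omega

theorem walkThree_eq (p q : ℕ) (k : ℤ) {x y : Fin n → ℤ} (hx : Monotone x) (hy : Monotone y) :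
    (walkThree p q k x y : K) = altCount K k x y (genThree K n p q) := by
  rw [walkThree, genThree]
  have h := ncard_walks (K := K) (S := fun j : ℕ => if j < p then boxSteps n 1 else
    boxSteps n (-1)) (fun j => by
      split_ifs
      · exact isStepSet_boxSteps (by norm_num)
      · exact isStepSet_boxSteps (by norm_num)) (fun a => |a|) (p + q) k hx hy
  rw [prod_range_add_ite, stepGen_boxSteps abs_zero (by norm_num),
    stepGen_boxSteps abs_zero (by norm_num)] at h
  refine Eq.trans ?_ h
  congr 3
  funext w
  have hstep : (fun j (a a' : Fin n → ℤ) => if j < p then MayRight a a' else MayLeft a a') =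
      fun j a a' => a' - a ∈ if j < p then boxSteps n 1 else boxSteps n (-1) := by
    funext j a a'
    split_ifs
    · rw [mayRight_iff]
    · rw [mayLeft_iff]
  rw [hstep]
  rfl

end Generating

/-! ### The difference equations of the walks -/

section Equations

variable {K : Type*} [Field K] {n : ℕ}

theorem move_single_mul_single (M N : ℤ) (i : Fin n) (c d : ℤ) :
    move K M (Pi.single i c) * move K N (Pi.single i d) = move K (M + N) (Pi.single i (c + d)) := by
  rw [move_mul_move, Pi.single_add]

theorem move_zero_mul_single (M N : ℤ) (i : Fin n) (c : ℤ) :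
    move K M 0 * move K N (Pi.single i c) = move K (M + N) (Pi.single i c) := by
  rw [move_mul_move, zero_add]

/-- `θ_i Q^k = k z (T_i - T_i⁻¹) Q^{k-1}` for `Q = z ∑ (T_j + T_j⁻¹)`, where `T_j` moves the `j`-th
walker to the right. -/
theorem eulerDer_powInt_genOne (i : Fin n) (k : ℤ) :
    eulerDer K i (powInt (genOne K n) k) = (k : WalkAlg K n) *
      ((move K 0 (Pi.single i 1) - move K 0 (Pi.single i (-1))) *
        (move K 1 0 * powInt (genOne K n) (k - 1))) := by
  have h1 := move_zero_mul_single (K := K) 1 0 i 1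
  have h2 := move_zero_mul_single (K := K) 1 0 i (-1)
  rw [add_zero] at h1 h2
  rw [derivation_powInt, genOne, map_add, eulerDer_singleGen, eulerDer_singleGen, ← h1, ← h2]
  push_cast
  ring

/-- The logarithmic Euler derivative of the generating function of the second walk, with the
denominator `1 + T_i` cleared. -/
theorem eulerDer_genTwo (q : ℕ) (k : ℤ) (i : Fin n) :
    (1 + move K 0 (Pi.single i 1)) * eulerDer K i (genTwo K n q k) =
      (q : WalkAlg K n) * (move K 0 (Pi.single i 1) * genTwo K n q k) -
        (k : WalkAlg K n) * ((1 + move K 0 (Pi.single i (-1))) * (move K 2 0 * genTwo K n q (k - 1))) := by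
  have h1 := move_zero_mul_single (K := K) 2 0 i (-1)
  have h2 := move_single_mul_single (K := K) 0 0 i 1 (-1)
  have h3 := mul_derivation_pow (eulerDer K i) (mul_eulerDer_boxGen (K := K) i 0 1) q
  rw [add_zero] at h1
  rw [add_neg_cancel, add_zero, Pi.single_zero, move_zero] at h2
  rw [genTwo, genTwo, Derivation.leibniz, derivation_powInt, eulerDer_singleGen, ← h1]
  simp only [smul_eq_mul]
  push_cast at h3 ⊢
  linear_combination powInt (singleGen K n 2 (-1)) k * h3 - (k : WalkAlg K n) *
    boxGen K n 0 1 ^ q * powInt (singleGen K n 2 (-1)) (k - 1) * move K 2 0 * h2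

/-- The logarithmic Euler derivative of the generating function of the third walk, with the denominator
`(1 + z T_i) (1 + z T_i⁻¹) = z (T_i + T_i⁻¹ + z + z⁻¹)` cleared. -/
theorem eulerDer_genThree (p q : ℕ) (i : Fin n) :
    (move K 0 (Pi.single i (-1)) + move K 0 (Pi.single i 1) + move K 1 0 + move K (-1) 0) *
        eulerDer K i (genThree K n p q) =
      (p : WalkAlg K n) * ((move K 0 (Pi.single i 1) + move K 1 0) * genThree K n p q) -
        (q : WalkAlg K n) * ((move K 0 (Pi.single i (-1)) + move K 1 0) * genThree K n p q) := by
  have h1 := move_zero_mul_single (K := K) 1 0 i 1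
  have h2 := move_zero_mul_single (K := K) 1 0 i (-1)
  have hE := move_single_mul_single (K := K) 0 0 i 1 (-1)
  have hZ := move_mul_move K 1 (-1) (0 : Fin n → ℤ) 0
  have hR := mul_derivation_pow (eulerDer K i) (mul_eulerDer_boxGen (K := K) i 1 1) p
  have hS := mul_derivation_pow (eulerDer K i) (mul_eulerDer_boxGen (K := K) i 1 (-1)) q
  rw [add_zero] at h1 h2
  rw [add_neg_cancel, add_zero, Pi.single_zero, move_zero] at hE
  rw [add_neg_cancel, add_zero, move_zero] at hZ
  rw [← h1] at hR
  rw [← h2] at hS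
  rw [genThree, Derivation.leibniz]
  simp only [smul_eq_mul]
  push_cast at hR hS
  generalize move K 0 (Pi.single i 1) = E at *
  generalize move K 0 (Pi.single i (-1)) = E' at *
  generalize move K 1 0 = Z at *
  generalize move K (-1) 0 = Z' at *
  generalize eulerDer K i (boxGen K n 1 1 ^ p) = r at *
  generalize eulerDer K i (boxGen K n 1 (-1) ^ q) = s at *
  generalize boxGen K n 1 1 ^ p = R at *
  generalize boxGen K n 1 (-1) ^ q = S at *
  linear_combination Z' * (1 + Z * E') * S * hR + Z' * (1 + Z * E) * R * hS -
    (E + E' + Z) * (R * s + S * r) * hZ - Z ^ 2 * Z' * (R * s + S * r) * hE +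
    ((p : WalkAlg K n) * (E + Z) - (q : WalkAlg K n) * (E' + Z)) * R * S * hZ +
    ((p : WalkAlg K n) - (q : WalkAlg K n)) * Z ^ 2 * Z' * R * S * hE

/-- If `f` vanishes away from the strictly increasing sequences and agrees with an alternating
function on the increasing ones, jumps over other walkers may be included in its jump sum. -/
theorem jumpSum_eq_sum_alternating {f Φ : (Fin n → ℤ) → K} (hf : ∀ x, ¬ StrictMono x → f x = 0)
    (hΦ : ∀ x a b, a ≠ b → Φ (x ∘ Equiv.swap a b) = -Φ x) (h : ∀ x, Monotone x → f x = Φ x)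
    {x : Fin n → ℤ} (hx : StrictMono x) : jumpSum f x = ∑ i, Φ (x + Pi.single i 2) := by
  have h0 := sum_jump_eq hΦ hx.injective (c := 1) one_ne_zero
  rw [mul_one] at h0
  rw [jumpSum_eq f hf hx, h0]
  congr 1
  · refine Finset.sum_congr rfl fun i _ => ?_
    split_ifs with hj
    · rfl
    · refine h _ fun a b hab => ?_
      rcases hab.eq_or_lt with rfl | hab
      · exact le_rfl
      · have h1 := hx hab
        have h2 : x b ≠ x i + 1 := fun h => hj ⟨b, h⟩
        simp only [Pi.add_apply, Pi.single_apply]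
        split_ifs with ha hb hb
        · omega
        · subst ha
          omega
        · omega
        · omega
  · refine Finset.sum_congr rfl fun i _ => Finset.sum_congr rfl fun j _ => ?_
    split_ifs with hj
    · refine h _ fun a b hab => ?_
      rcases hab.eq_or_lt with rfl | hab
      · exact le_rfl
      · have h1 := hx hab
        simp only [Pi.add_apply, Pi.single_apply]
        have hij : i ≠ j := by
          rintro rfl
          omega
        have h2 : a = i → b ≠ j → x j < x b := by
          rintro rfl hb
          have h3 : x b ≠ x j := fun h => hb (hx.injective h)
          omega
        split_ifs <;> simp_all <;> omega
    · rfl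

theorem sum_altCount_add_left (M : ℤ) (x y : Fin n → ℤ) (P : WalkAlg K n) :
    ∑ i, altCount K M (x + e i) y P =
      altCount K M x y (∑ i, move K 0 (Pi.single i 1) * P) := by
  have h := sum_altCount_sub_left M (-1) x y P
  simpa only [Pi.single_neg, sub_neg_eq_add, neg_neg] using h

theorem sum_altCount_sub_right (M : ℤ) (x y : Fin n → ℤ) (P : WalkAlg K n) :
    ∑ i, altCount K M x (y - e i) P =
      altCount K M x y (∑ i, move K 0 (Pi.single i 1) * P) := by
  have h := sum_altCount_add_right M (-1) x y P
  simpa only [Pi.single_neg, ← sub_eq_add_neg, neg_neg] using h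

theorem sum_euler_altCount_one (M : ℤ) (x y : Fin n → ℤ) (P : WalkAlg K n) :
    ∑ i, (((y i : K) + 1) * altCount K M x (y + e i) P -
        (x i : K) * altCount K M (x - e i) y P) =
      altCount K M x y (∑ i, move K 0 (Pi.single i (-1)) * eulerDer K i P) := by
  have h := sum_euler_altCount M 1 x y P
  rwa [Int.cast_one] at h

theorem sum_euler_altCount_neg_one (M : ℤ) (x y : Fin n → ℤ) (P : WalkAlg K n) :
    ∑ i, (((x i : K) + 1) * altCount K M (x + e i) y P -
        (y i : K) * altCount K M x (y - e i) P) =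
      -altCount K M x y (∑ i, move K 0 (Pi.single i 1) * eulerDer K i P) := by
  have h := sum_euler_altCount M (-1) x y P
  have h1 := (sum_altCount_add_left M x y P).trans (sum_altCount_sub_right M x y P).symm
  simp only [Pi.single_neg, sub_neg_eq_add, neg_neg, ← sub_eq_add_neg, Int.cast_neg,
    Int.cast_one] at h
  rw [← h]
  simp only [add_mul, sub_mul, one_mul, Finset.sum_sub_distrib, Finset.sum_add_distrib]
  rw [h1]
  ring

theorem monotone_sub_e {x : Fin n → ℤ} (hx : StrictMono x) (i : Fin n) : Monotone (x - e i) := by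
  have := monotone_add_single_neg_one hx i
  rwa [Pi.single_neg, ← sub_eq_add_neg] at this

variable [CharZero K]

/-- Multiply `eulerDer_powInt_genOne` by `T_i⁻¹` and sum over `i`. -/
theorem L1minus_walkOne (k : ℤ) {x y : Fin n → ℤ} (hx : StrictMono x) (hy : StrictMono y) :
    L1minus (fun k x y => (walkOne k x y : K)) k x y = 0 := by
  have hJ : ∑ i, (walkOne (k - 1) x (y + 2 • e i) : K) -
      adjacentSum (fun k x y => (walkOne k x y : K)) (k - 1) x y =
      ∑ i, altCount K (k - 1) x (y + Pi.single i 2) (powInt (genOne K n) (k - 1)) :=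
    jumpSum_eq_sum_alternating (f := fun y => (walkOne (k - 1) x y : K))
      (Φ := fun y => altCount K (k - 1) x y (powInt (genOne K n) (k - 1)))
      (fun y h => by rw [walkOne_eq_zero fun hs => h hs.2, Nat.cast_zero])
      (fun y a b hab => altCount_swap_right _ _ _ _ a b hab)
      (fun y h => walkOne_eq _ hx.monotone h) hy
  have h1 := fun i => walkOne_eq (K := K) k hx.monotone (monotone_add_single_one hy i)
  have h2 := fun i => walkOne_eq (K := K) k (monotone_sub_e hx i) hy.monotone
  rw [L1minus, sub_add, hJ]
  simp only [h1, h2]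
  rw [sum_euler_altCount_one, walkOne_eq _ hx.monotone hy.monotone, sum_altCount_add_right]
  simp only [altCount_sub_weight]
  have hE : ∀ i : Fin n, move K 0 (Pi.single i (-1)) * eulerDer K i (powInt (genOne K n) k) =
      (k : WalkAlg K n) * (move K 1 0 * powInt (genOne K n) (k - 1) -
        move K 1 0 * (move K 0 (Pi.single i (-2)) * powInt (genOne K n) (k - 1))) := by
    intro i
    have h4 := move_single_mul_single (K := K) 0 0 i (-1) 1
    have h5 := move_single_mul_single (K := K) 0 0 i (-1) (-1)
    rw [neg_add_cancel, add_zero, Pi.single_zero, move_zero] at h4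
    rw [eulerDer_powInt_genOne]
    norm_num at h5
    linear_combination (k : WalkAlg K n) * move K 1 0 * powInt (genOne K n) (k - 1) * (h4 - h5)
  simp only [hE, Finset.mul_sum, map_sum, altCount_intCast_mul, map_sub]
  simp only [Finset.sum_sub_distrib, ← Finset.mul_sum, Finset.sum_const, Finset.card_univ,
    Fintype.card_fin, nsmul_eq_mul]
  ring

/-- Sum `eulerDer_powInt_genOne` over `i`. -/
theorem L1zero_walkOne (k : ℤ) {x y : Fin n → ℤ} (hx : StrictMono x) (hy : StrictMono y) :
    L1zero (fun k x y => (walkOne k x y : K)) k x y = 0 := by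
  have h1 := fun i => walkOne_eq (K := K) (k - 1) hx.monotone (monotone_add_single_one hy i)
  have h2 := fun i => walkOne_eq (K := K) (k - 1) (monotone_add_single_one hx i) hy.monotone
  rw [L1zero]
  simp only [h1, h2]
  rw [mul_comm, walkOne_eq _ hx.monotone hy.monotone, sum_sub_mul_altCount, sum_altCount_add_right,
    sum_altCount_add_left]
  simp only [altCount_sub_weight, eulerDer_powInt_genOne, map_sum,
    altCount_intCast_mul, sub_mul, map_sub, mul_left_comm (move K 1 (0 : Fin n → ℤ)),
    Finset.sum_sub_distrib, ← Finset.mul_sum]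
  ring

/-- Multiply `eulerDer_powInt_genOne` by `T_i` and sum over `i`; the jumps are now those of `x`, where
the count is alternating because its generating function is symmetric. -/
theorem L1plus_walkOne (k : ℤ) {x y : Fin n → ℤ} (hx : StrictMono x) (hy : StrictMono y) :
    L1plus (fun k x y => (walkOne k x y : K)) k x y = 0 := by
  have hJ : ∑ i, (walkOne (k - 1) (x + 2 • e i) y : K) -
      adjacentSum (fun k x y => (walkOne k y x : K)) (k - 1) y x =
      ∑ i, altCount K (k - 1) (x + Pi.single i 2) y (powInt (genOne K n) (k - 1)) :=
    jumpSum_eq_sum_alternating (f := fun x => (walkOne (k - 1) x y : K))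
      (Φ := fun x => altCount K (k - 1) x y (powInt (genOne K n) (k - 1)))
      (fun x h => by rw [walkOne_eq_zero fun hs => h hs.1, Nat.cast_zero])
      (fun x a b hab => altCount_swap_left (isSymm_powInt_genOne _) _ _ _ a b hab)
      (fun x h => walkOne_eq _ h hy.monotone) hx
  have h1 := fun i => walkOne_eq (K := K) k hx.monotone (monotone_sub_e hy i)
  have h2 := fun i => walkOne_eq (K := K) k (monotone_add_single_one hx i) hy.monotone
  have h3 := sum_altCount_sub_left (k - 1) (-2) x y (powInt (genOne K n) (k - 1))
  simp only [Pi.single_neg, sub_neg_eq_add, neg_neg] at h3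
  rw [L1plus, L1minus, sub_add, hJ, h3]
  simp only [h1, h2]
  rw [sum_euler_altCount_neg_one, walkOne_eq _ hx.monotone hy.monotone]
  simp only [altCount_sub_weight]
  have hE : ∀ i : Fin n, move K 0 (Pi.single i 1) * eulerDer K i (powInt (genOne K n) k) =
      (k : WalkAlg K n) * (move K 1 0 * (move K 0 (Pi.single i 2) * powInt (genOne K n) (k - 1)) -
        move K 1 0 * powInt (genOne K n) (k - 1)) := by
    intro i
    have h4 := move_single_mul_single (K := K) 0 0 i 1 (-1)
    have h5 := move_single_mul_single (K := K) 0 0 i 1 1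
    rw [add_neg_cancel, add_zero, Pi.single_zero, move_zero] at h4
    rw [eulerDer_powInt_genOne]
    norm_num at h5
    linear_combination (k : WalkAlg K n) * move K 1 0 * powInt (genOne K n) (k - 1) * (h5 - h4)
  simp only [hE, Finset.mul_sum, map_sum, altCount_intCast_mul, map_sub]
  simp only [Finset.sum_sub_distrib, ← Finset.mul_sum, Finset.sum_const, Finset.card_univ,
    Fintype.card_fin, nsmul_eq_mul]
  ring

/-- Multiply `eulerDer_genTwo` by `T_i⁻¹` and sum over `i`. -/
theorem L2minus_walkTwo (q : ℕ) (k : ℤ) {x y : Fin n → ℤ} (hx : StrictMono x)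
    (hy : StrictMono y) : L2minus (fun k x y => (walkTwo q k x y : K)) k x y q = 0 := by
  have hJ : ∑ i, (walkTwo q (k - 1) x (y + 2 • e i) : K) -
      adjacentSum (fun k x y => (walkTwo q k x y : K)) (k - 1) x y =
      ∑ i, altCount K (2 * (k - 1)) x (y + Pi.single i 2) (genTwo K n q (k - 1)) :=
    jumpSum_eq_sum_alternating (f := fun y => (walkTwo q (k - 1) x y : K))
      (Φ := fun y => altCount K (2 * (k - 1)) x y (genTwo K n q (k - 1)))
      (fun y h => by rw [walkTwo_eq_zero fun hs => h hs.2, Nat.cast_zero])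
      (fun y a b hab => altCount_swap_right _ _ _ _ a b hab)
      (fun y h => walkTwo_eq q _ hx.monotone h) hy
  have h1 := fun k i => walkTwo_eq (K := K) q k hx.monotone (monotone_add_single_one hy i)
  have h2 := fun i => walkTwo_eq (K := K) q k (monotone_sub_e hx i) hy.monotone
  have h3 := sum_euler_altCount_one (2 * k) x y (genTwo K n q k)
  have h4 := sum_sub_mul_altCount (2 * k) x y (genTwo K n q k)
  have h5 := sum_altCount_add_right (2 * (k - 1)) 1 x y (genTwo K n q (k - 1))
  have hE : ∀ i : Fin n, move K 0 (Pi.single i (-1)) * eulerDer K i (genTwo K n q k) +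
      eulerDer K i (genTwo K n q k) = (q : WalkAlg K n) * genTwo K n q k -
        (k : WalkAlg K n) * (move K 2 0 * (move K 0 (Pi.single i (-1)) * genTwo K n q (k - 1)) +
          move K 2 0 * (move K 0 (Pi.single i (-2)) * genTwo K n q (k - 1))) := by
    intro i
    have h6 := move_single_mul_single (K := K) 0 0 i (-1) 1
    have h7 := move_single_mul_single (K := K) 0 0 i (-1) (-1)
    have h8 := eulerDer_genTwo (K := K) q k i
    rw [neg_add_cancel, add_zero, Pi.single_zero, move_zero] at h6
    norm_num at h7
    linear_combination move K 0 (Pi.single i (-1)) * h8 +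
      ((q : WalkAlg K n) * genTwo K n q k - eulerDer K i (genTwo K n q k)) * h6 -
      (k : WalkAlg K n) * move K 2 0 * genTwo K n q (k - 1) * h7
  have hS := congrArg (fun G : Fin n → WalkAlg K n => altCount K (2 * k) x y (∑ i, G i)) (funext hE)
  simp only [map_sum, map_add, map_sub, altCount_intCast_mul, altCount_natCast_mul,
    Finset.sum_add_distrib, Finset.sum_sub_distrib, ← Finset.mul_sum, Finset.sum_const,
    Finset.card_univ, Fintype.card_fin, nsmul_eq_mul] at hS
  have hW : 2 * (k - 1) = 2 * k - 2 := by ring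
  rw [sum_altCount_add_right] at hJ
  rw [hW, altCount_sub_weight] at hJ h5
  have h0 : ∑ i, ((x i : K) * altCount K (2 * k) (x - e i) y (genTwo K n q k) -
      ((y i : K) + 1) * altCount K (2 * k) x (y + e i) (genTwo K n q k) +
      ((x i : K) - (y i : K) + q) * altCount K (2 * k) x y (genTwo K n q k)) =
      -∑ i, (((y i : K) + 1) * altCount K (2 * k) x (y + e i) (genTwo K n q k) -
          (x i : K) * altCount K (2 * k) (x - e i) y (genTwo K n q k)) -
        (∑ i, ((y i : K) - (x i : K))) * altCount K (2 * k) x y (genTwo K n q k) +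
        ∑ _i : Fin n, q * altCount K (2 * k) x y (genTwo K n q k) := by
    rw [Finset.sum_mul, ← Finset.sum_neg_distrib, ← Finset.sum_sub_distrib,
      ← Finset.sum_add_distrib]
    exact Finset.sum_congr rfl fun i _ => by ring
  rw [L2minus, Finset.sum_add_distrib (f := fun i => (walkTwo q (k - 1) x (y + e i) : K)),
    walkTwo_eq q k hx.monotone hy.monotone]
  simp only [h1, h2]
  rw [h0, h3, h4, hW, h5]
  simp only [map_sum, Finset.mul_sum, Finset.sum_const, Finset.card_univ, Fintype.card_fin,
    nsmul_eq_mul] at hJ hS ⊢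
  linear_combination (-(k : K)) * hJ - hS

/-- Sum `eulerDer_genTwo` over `i`. -/
theorem L2plus_walkTwo (q : ℕ) (k : ℤ) {x y : Fin n → ℤ} (hx : StrictMono x)
    (hy : StrictMono y) : L2plus (fun k x y => (walkTwo q k x y : K)) k x y q = 0 := by
  have h1 := fun i => walkTwo_eq (K := K) q (k - 1) hx.monotone (monotone_add_single_one hy i)
  have h2 := fun i => walkTwo_eq (K := K) q k hx.monotone (monotone_sub_e hy i)
  have h3 := fun i => walkTwo_eq (K := K) q k (monotone_add_single_one hx i) hy.monotone
  have h4 := sum_euler_altCount_neg_one (2 * k) x y (genTwo K n q k)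
  have h5 := sum_sub_mul_altCount (2 * k) x y (genTwo K n q k)
  have h6 := sum_altCount_add_left (2 * k) x y (genTwo K n q k)
  have h7 := sum_altCount_add_right (2 * (k - 1)) 1 x y (genTwo K n q (k - 1))
  have hE : ∀ i : Fin n, eulerDer K i (genTwo K n q k) +
      move K 0 (Pi.single i 1) * eulerDer K i (genTwo K n q k) =
        (q : WalkAlg K n) * (move K 0 (Pi.single i 1) * genTwo K n q k) -
        (k : WalkAlg K n) * (move K 2 0 * genTwo K n q (k - 1) +
          move K 2 0 * (move K 0 (Pi.single i (-1)) * genTwo K n q (k - 1))) := by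
    intro i
    linear_combination eulerDer_genTwo (K := K) q k i
  have hS := congrArg (fun G : Fin n → WalkAlg K n => altCount K (2 * k) x y (∑ i, G i)) (funext hE)
  simp only [map_sum, map_add, map_sub, altCount_intCast_mul, altCount_natCast_mul,
    Finset.sum_add_distrib, Finset.sum_sub_distrib, ← Finset.mul_sum, Finset.sum_const,
    Finset.card_univ, Fintype.card_fin, nsmul_eq_mul] at hS
  have hW : 2 * (k - 1) = 2 * k - 2 := by ring
  have h0 : ∑ i, ((y i : K) * altCount K (2 * k) x (y - e i) (genTwo K n q k) -
      ((x i : K) + 1 + q) * altCount K (2 * k) (x + e i) y (genTwo K n q k) +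
      ((y i : K) - (x i : K)) * altCount K (2 * k) x y (genTwo K n q k)) =
      -∑ i, (((x i : K) + 1) * altCount K (2 * k) (x + e i) y (genTwo K n q k) -
          (y i : K) * altCount K (2 * k) x (y - e i) (genTwo K n q k)) +
        (∑ i, ((y i : K) - (x i : K))) * altCount K (2 * k) x y (genTwo K n q k) -
        q * ∑ i, altCount K (2 * k) (x + e i) y (genTwo K n q k) := by
    rw [Finset.sum_mul, Finset.mul_sum, ← Finset.sum_neg_distrib, ← Finset.sum_add_distrib,
      ← Finset.sum_sub_distrib]
    exact Finset.sum_congr rfl fun i _ => by ring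
  rw [hW, altCount_sub_weight] at h7
  rw [L2plus, Finset.sum_add_distrib (f := fun _ => (walkTwo q (k - 1) x y : K)),
    walkTwo_eq q k hx.monotone hy.monotone, walkTwo_eq q _ hx.monotone hy.monotone]
  simp only [h1, h2, h3]
  rw [h0, h4, h5, h6, hW, h7, altCount_sub_weight]
  simp only [map_sum, Finset.mul_sum, Finset.sum_const, Finset.card_univ, Fintype.card_fin,
    nsmul_eq_mul, mul_left_comm (move K 2 0) (n : WalkAlg K n), altCount_natCast_mul] at hS ⊢
  linear_combination hS

/-- Sum `eulerDer_genThree` over `i`. -/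
theorem L3_walkThree (p q : ℕ) (k : ℤ) {x y : Fin n → ℤ} (hx : StrictMono x)
    (hy : StrictMono y) : L3 (fun k x y => (walkThree p q k x y : K)) k x y p q = 0 := by
  have h1 := fun i => walkThree_eq (K := K) p q k hx.monotone (monotone_add_single_one hy i)
  have h2 := fun i => walkThree_eq (K := K) p q k hx.monotone (monotone_sub_e hy i)
  have h3 := fun i => walkThree_eq (K := K) p q k (monotone_add_single_one hx i) hy.monotone
  have h4 := fun i => walkThree_eq (K := K) p q k (monotone_sub_e hx i) hy.monotone
  have h5 := sum_euler_altCount_one k x y (genThree K n p q)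
  have h6 := sum_euler_altCount_neg_one k x y (genThree K n p q)
  have h7 := sum_altCount_add_left k x y (genThree K n p q)
  have h8 := sum_altCount_add_right k 1 x y (genThree K n p q)
  have h9 := sum_sub_mul_altCount (k - 1) x y (genThree K n p q)
  have h10 := sum_sub_mul_altCount (k - -1) x y (genThree K n p q)
  have hE : ∀ i : Fin n, move K 0 (Pi.single i (-1)) * eulerDer K i (genThree K n p q) +
      move K 0 (Pi.single i 1) * eulerDer K i (genThree K n p q) +
      move K 1 0 * eulerDer K i (genThree K n p q) +
      move K (-1) 0 * eulerDer K i (genThree K n p q) =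
      (p : WalkAlg K n) * (move K 0 (Pi.single i 1) * genThree K n p q) +
        (p : WalkAlg K n) * (move K 1 0 * genThree K n p q) -
        (q : WalkAlg K n) * (move K 0 (Pi.single i (-1)) * genThree K n p q) -
        (q : WalkAlg K n) * (move K 1 0 * genThree K n p q) := by
    intro i
    linear_combination eulerDer_genThree (K := K) p q i
  have hS := congrArg (fun G : Fin n → WalkAlg K n => altCount K k x y (∑ i, G i)) (funext hE)
  simp only [map_sum, map_add, map_sub, altCount_natCast_mul,
    Finset.sum_add_distrib, Finset.sum_sub_distrib, ← Finset.mul_sum, Finset.sum_const,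
    Finset.card_univ, Fintype.card_fin, nsmul_eq_mul] at hS
  have h0 : ∑ i, (((x i : K) * altCount K k (x - e i) y (genThree K n p q) +
        ((x i : K) + p + 1) * altCount K k (x + e i) y (genThree K n p q)) -
      ((y i : K) * altCount K k x (y - e i) (genThree K n p q) +
        ((y i : K) + q + 1) * altCount K k x (y + e i) (genThree K n p q))) =
      ∑ i, (((x i : K) + 1) * altCount K k (x + e i) y (genThree K n p q) -
          (y i : K) * altCount K k x (y - e i) (genThree K n p q)) -
        ∑ i, (((y i : K) + 1) * altCount K k x (y + e i) (genThree K n p q) -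
          (x i : K) * altCount K k (x - e i) y (genThree K n p q)) +
        p * ∑ i, altCount K k (x + e i) y (genThree K n p q) -
        q * ∑ i, altCount K k x (y + e i) (genThree K n p q) := by
    rw [Finset.mul_sum, Finset.mul_sum, ← Finset.sum_sub_distrib, ← Finset.sum_add_distrib,
      ← Finset.sum_sub_distrib]
    exact Finset.sum_congr rfl fun i _ => by ring
  have hneg : ∑ i, ((x i : K) - (y i : K)) = -∑ i, ((y i : K) - (x i : K)) := by
    rw [← Finset.sum_neg_distrib]
    exact Finset.sum_congr rfl fun i _ => by ring
  rw [L3, walkThree_eq p q _ hx.monotone hy.monotone, walkThree_eq p q _ hx.monotone hy.monotone,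
    hneg, ← sub_neg_eq_add k 1]
  simp only [h1, h2, h3, h4]
  rw [h0, h5, h6, h7, h8, neg_mul, mul_add, h9, h10]
  simp only [altCount_sub_weight, map_sum, Finset.mul_sum,
    mul_left_comm (move K 1 0) (n : WalkAlg K n), altCount_natCast_mul] at hS ⊢
  linear_combination -hS

end Equations

end VirasoroFourier

end

open VirasoroFourier in
theorem mainTheorem2 {K : Type*} [Field K] [CharZero K] (n : ℕ) :
    -- the double Schur series are well-defined formal sums
    (∀ (b : ℤ → Part n → Part n → K) (k : ℤ),
      IsFormalSum (fun p : Part n × Part n => b k p.1 p.2 • schurPair K p.1 p.2)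
        (doubleSeries b k)) ∧
    -- case 1
    (Translates (n := n) substKLambdaInv
        ((bigVMinusOne (Polynomial K) n).shift shiftOne) L1minus ∧
      Translates (n := n) substKLambdaInv
        ((bigVZero (Polynomial K)).shift shiftOne) L1zero ∧
      Translates (n := n) substKLambdaInv
        ((-bigVOne (Polynomial K) n).shift shiftOne) L1plus) ∧
    -- case 2
    (∀ q : K,
      Translates (n := n) substKLambdaInv
        ((bigVZero (Polynomial K) + bigVMinusOne (Polynomial K) n).shift (shiftTwo q))
        (fun B k x y => L2minus B k x y q) ∧
      Translates (n := n) substKLambdaInv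
        ((-(bigVZero (Polynomial K) + bigVOne (Polynomial K) n)).shift (shiftTwo q))
        (fun B k x y => L2plus B k x y q)) ∧
    -- case 3
    (∀ p q : K,
      Translates (n := n) substLambdaInv
        ((bigVMinusOne (LaurentPolynomial K) n +
            (LaurentPolynomial.T 1 + LaurentPolynomial.T (-1) : LaurentPolynomial K) •
              bigVZero (LaurentPolynomial K) +
            bigVOne (LaurentPolynomial K) n).shift (shiftThree p q))
        (fun B k x y => L3 B k x y p q)) ∧
    -- the difference equations of the three random walks
    (∀ (k : ℤ) (lam mu : Part n),
      L1minus (fun k x y => (walkOne k x y : K)) k (pos lam) (pos mu) = 0 ∧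
      L1zero (fun k x y => (walkOne k x y : K)) k (pos lam) (pos mu) = 0 ∧
      L1plus (fun k x y => (walkOne k x y : K)) k (pos lam) (pos mu) = 0) ∧
    (∀ (q : ℕ) (k : ℤ) (lam mu : Part n),
      L2minus (fun k x y => (walkTwo q k x y : K)) k (pos lam) (pos mu) q = 0 ∧
      L2plus (fun k x y => (walkTwo q k x y : K)) k (pos lam) (pos mu) q = 0) ∧
    (∀ (p q : ℕ) (k : ℤ) (lam mu : Part n),
      L3 (fun k x y => (walkThree p q k x y : K)) k (pos lam) (pos mu) p q = 0) := by
  refine ⟨isFormalSum_doubleSeries, ⟨translates_L1minus, translates_L1zero, translates_L1plus⟩,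
    fun q => ⟨translates_L2minus q, translates_L2plus q⟩, translates_L3, fun k lam mu => ?_,
    fun q k lam mu => ?_, fun p q k lam mu => ?_⟩
  · have hx := pos_strictMono lam
    have hy := pos_strictMono mu
    exact ⟨L1minus_walkOne k hx hy, L1zero_walkOne k hx hy, L1plus_walkOne k hx hy⟩
  · have hx := pos_strictMono lam
    have hy := pos_strictMono mu
    exact ⟨L2minus_walkTwo q k hx hy, L2plus_walkTwo q k hx hy⟩
  · exact L3_walkThree p q k (pos_strictMono lam) (pos_strictMono mu)
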